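/- Let $\Gamma$ be a (discrete) group. (1) Let $\Lambda$ be a finite index subgroup of $\Gamma$, and let $\Gamma$ act on the finite discrete space $\Gamma/\Lambda$ by left multiplication. Then there is a $*$-isomorphism $$C(\Gamma/\Lambda)\rtimes_r\Gamma\;\cong\; M_{\Gamma/\Lambda}(\mathbb C)\otimes C^*_r(\Lambda).$$ (2) Let $\Gamma_0\gneq\Gamma_1\gneq\Gamma_2\gneq\cdots$ be a strictly decreasing sequence of finite index subgroups of $\Gamma$, and let $\Gamma\curvearrowright X:=\varprojlim\Gamma/\Gamma_i$ be the associated odometer, i.e. the action by left multiplication in each coordinate on the inverse limit of the finite discrete spaces $\Gamma/\Gamma_i$ along the maps $\gamma\Gamma_{i+1}\mapsto\gamma\Gamma_i$. Then, for $*=0,1$, $$K_*(C(X)\rtimes_r\Gamma)\;\cong\;\varinjlim_i K_*(C^*_r(\Gamma_i))$$ as abelian groups. The connecting maps are the transfer maps $K_*(C^*_r(\Gamma_i))\to K_*\big(M_{\Gamma_i/\Gamma_{i+1}}(C^*_r(\Gamma_{i+1}))\big)=K_*(C^*_r(\Gamma_{i+1}))$ induced by the unital $*$-homomorphism $\tau_i\colon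 C^*_r(\Gamma_i)\to M_{\Gamma_i/\Gamma_{i+1}}(C^*_r(\Gamma_{i+1}))$ which exists and is determined by the following rule: for chosen (arbitrary) representatives $r_c\in\Gamma_i$ of the cosets $c\in\Gamma_i/\Gamma_{i+1}$ and for $g\in\Gamma_i$, the $(c,d)$ entry of $\tau_i(\delta_g)$ is $\delta_{r_c^{-1}gr_d}$ if $r_c^{-1}gr_d\in\Gamma_{i+1}$, and $0$ otherwise. Here $\delta_g$ denotes the canonical unitaries of the reduced group $C^*$-algebras. -/

import Mathlib

open CategoryTheory Limits
open scoped ENNReal TensorProduct Matrix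

universe u v

noncomputable section

/-! ### Operators on `ℓ²` -/

/-- The Hilbert space `ℓ²(ι)`. -/
abbrev EllTwo (ι : Type u) : Type u := lp (fun _ : ι => ℂ) 2

namespace EllTwo

variable {ι : Type u}

/-- The operator `(U ξ)(i) = ξ(σ⁻¹ i)` on `ℓ²(ι)` given by a permutation `σ` of `ι`; it maps the
basis vector at `i` to the basis vector at `σ i`. -/
def permOp (σ : Equiv.Perm ι) : EllTwo ι →L[ℂ] EllTwo ι :=
  LinearMap.mkContinuous
    { toFun := fun ξ => ⟨fun i => ξ (σ.symm i), by
        refine (memℓp_gen_iff (p := 2) (by norm_num)).mpr ?_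
        exact (Equiv.summable_iff σ.symm).mpr
          ((memℓp_gen_iff (by norm_num)).mp (lp.memℓp ξ))⟩
      map_add' := fun _ _ => rfl
      map_smul' := fun _ _ => rfl } 1 fun ξ => le_of_eq <| by
    rw [one_mul, lp.norm_eq_tsum_rpow (by norm_num), lp.norm_eq_tsum_rpow (by norm_num)]
    congr 1
    exact Equiv.tsum_eq σ.symm fun i => ‖ξ i‖ ^ (2 : ℝ≥0∞).toReal

theorem permOp_apply (σ : Equiv.Perm ι) (ξ : EllTwo ι) (i : ι) :
    permOp σ ξ i = ξ (σ.symm i) := rfl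

/-- The operator `(M ξ)(i) = f(i) ξ(i)` on `ℓ²(ι)` of multiplication by a bounded function `f`. -/
def mulOp (f : ι → ℂ) (C : ℝ) (hf : ∀ i, ‖f i‖ ≤ C) : EllTwo ι →L[ℂ] EllTwo ι :=
  have hmul (ξ : EllTwo ι) (i : ι) : ‖f i * ξ i‖ ≤ ‖((C : ℂ) • ξ) i‖ := by
    rw [lp.coeFn_smul, Pi.smul_apply, smul_eq_mul, norm_mul, norm_mul]
    refine mul_le_mul_of_nonneg_right ((hf i).trans ?_) (norm_nonneg _)
    simpa using le_abs_self C
  have hmem (ξ : EllTwo ι) : Memℓp (fun i => f i * ξ i) 2 :=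
    (lp.memℓp ((C : ℂ) • ξ)).mono' (hmul ξ)
  LinearMap.mkContinuous
    { toFun := fun ξ => ⟨fun i => f i * ξ i, hmem ξ⟩
      map_add' := fun ξ η => by
        ext i
        exact mul_add _ _ _
      map_smul' := fun c ξ => by
        ext i
        exact mul_left_comm _ _ _ } ‖(C : ℂ)‖ fun ξ => by
    rw [← norm_smul]
    exact lp.norm_mono (by norm_num) (hmul ξ)

theorem mulOp_apply (f : ι → ℂ) (C : ℝ) (hf : ∀ i, ‖f i‖ ≤ C) (ξ : EllTwo ι) (i : ι) :
    mulOp f C hf ξ i = f i * ξ i := rfl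

end EllTwo

/-! ### The reduced group C⋆-algebra of a discrete group -/

section GroupAlgebra

variable (G : Type u) [Group G]

/-- The left regular representation `(λ_g ξ)(h) = ξ(g⁻¹ h)` of `G` on `ℓ²(G)`. -/
def leftRegular (g : G) : EllTwo G →L[ℂ] EllTwo G :=
  EllTwo.permOp (Equiv.mulLeft g)

/-- The reduced group C⋆-algebra `C⋆_r(G)` of the discrete group `G`: the norm closure in
`B(ℓ²(G))` of the ⋆-algebra generated by the operators `λ_g`. -/
def reducedGroupCStar : StarSubalgebra ℂ (EllTwo G →L[ℂ] EllTwo G) :=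
  (StarAlgebra.adjoin ℂ (Set.range (leftRegular G))).topologicalClosure

instance : IsClosed (reducedGroupCStar G : Set (EllTwo G →L[ℂ] EllTwo G)) :=
  StarSubalgebra.isClosed_topologicalClosure _

variable {G} in
/-- The canonical unitary `δ_g` of `C⋆_r(G)`. -/
def groupUnitary (g : G) : reducedGroupCStar G :=
  ⟨leftRegular G g, StarSubalgebra.le_topologicalClosure _
    (StarAlgebra.subset_adjoin ℂ _ ⟨g, rfl⟩)⟩

end GroupAlgebra

/-! ### The reduced crossed product `C(X) ⋊_r G` -/

section CrossedProduct

variable (G : Type u) [Group G] (X : Type v) [TopologicalSpace X] [CompactSpace X] [MulAction G X]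
  [ContinuousConstSMul G X]

/-- The representation of `C(X)` on `ℓ²(G × X) = ℓ²(G, ℓ²(X))` attached to the faithful
representation of `C(X)` on `ℓ²(X)` by multiplication:
`(π(f) ξ)(g, x) = (g⁻¹ • f)(x) ξ(g, x) = f(g x) ξ(g, x)`. -/
def crossedFun (f : C(X, ℂ)) : EllTwo (G × X) →L[ℂ] EllTwo (G × X) :=
  EllTwo.mulOp (fun p => f (p.1 • p.2)) ‖f‖ fun _ => f.norm_coe_le_norm _

/-- The representation `(λ_g ξ)(h, x) = ξ(g⁻¹ h, x)` of `G` on `ℓ²(G × X)`. -/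
def crossedGroup (g : G) : EllTwo (G × X) →L[ℂ] EllTwo (G × X) :=
  EllTwo.permOp ((Equiv.mulLeft g).prodCongr (Equiv.refl X))

/-- The reduced crossed product `C(X) ⋊_r G` of the action of the discrete group `G` on the compact
space `X`: the norm closure of the ⋆-algebra generated by the regular representation induced by
the faithful representation of `C(X)` on `ℓ²(X)`. -/
def reducedCrossedProduct : StarSubalgebra ℂ (EllTwo (G × X) →L[ℂ] EllTwo (G × X)) :=
  (StarAlgebra.adjoin ℂ
    (Set.range (crossedFun G X) ∪ Set.range (crossedGroup G X))).topologicalClosure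

instance : IsClosed (reducedCrossedProduct G X : Set (EllTwo (G × X) →L[ℂ] EllTwo (G × X))) :=
  StarSubalgebra.isClosed_topologicalClosure _

end CrossedProduct

/-! ### Coset spaces and odometers -/

section Odometer

variable {G : Type u} [Group G]

instance cosetFintype (H : Subgroup G) [H.FiniteIndex] : Fintype (G ⧸ H) :=
  Subgroup.fintypeQuotientOfFiniteIndex

instance cosetDecidableEq (H : Subgroup G) : DecidableEq (G ⧸ H) := Classical.decEq _

instance cosetDiscrete [TopologicalSpace G] [DiscreteTopology G] (H : Subgroup G) :
    DiscreteTopology (G ⧸ H) :=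
  QuotientGroup.discreteTopology (isOpen_discrete _)

variable (Gs : ℕ → Subgroup G) (hs : ∀ i, Gs (i + 1) ≤ Gs i)

/-- The inverse limit of the coset spaces `G ⧸ Gs i` along the projections
`g Gs (i + 1) ↦ g Gs i`, a subspace of the product of the discrete spaces `G ⧸ Gs i`. -/
def odometer : Set (∀ i, G ⧸ Gs i) :=
  {x | ∀ i, Subgroup.quotientMapOfLE (hs i) (x (i + 1)) = x i}

/-- The action of `G` on the inverse limit by left multiplication in every coordinate. -/
instance : MulAction G (odometer Gs hs) where
  smul g x := ⟨fun i => g • x.1 i, fun i => by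
    have h := x.2 i
    dsimp only
    rw [← h]
    induction x.1 (i + 1) using QuotientGroup.induction_on
    rfl⟩
  one_smul x := Subtype.ext (funext fun i => one_smul G (x.1 i))
  mul_smul g h x := Subtype.ext (funext fun i => mul_smul g h (x.1 i))

variable [TopologicalSpace G] [DiscreteTopology G]

instance : ContinuousConstSMul G (odometer Gs hs) where
  continuous_const_smul g := Continuous.subtype_mk
    (continuous_pi fun i => ((continuous_apply i).comp continuous_subtype_val).const_smul g) _

instance [∀ i, (Gs i).FiniteIndex] : CompactSpace (odometer Gs hs) := by
  refine isCompact_iff_compactSpace.mp (IsClosed.isCompact ?_)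
  have h : odometer Gs hs =
      ⋂ i, {x | Subgroup.quotientMapOfLE (hs i) (x (i + 1)) = x i} := by
    ext x
    simp [odometer]
  rw [h]
  exact isClosed_iInter fun i => isClosed_eq
    (continuous_of_discreteTopology.comp (continuous_apply (i + 1))) (continuous_apply i)

end Odometer
/-! ### Matrices -/

section MatrixAux

variable {A : Type u} {B : Type v} [Ring A] [StarRing A] [Ring B] [StarRing B]
  [Algebra ℂ A] [Algebra ℂ B]
variable {ι κ μ ν : Type} {k : Type*} [Fintype k] [DecidableEq k]

/-- For a ⋆-homomorphism `φ : A → M_k(B)`, the matrix over `B` with index sets `ι × k`, `κ × k`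
obtained from an `ι × κ` matrix over `A` by replacing each entry by its image under `φ`. -/
def inflate (φ : A →⋆ₐ[ℂ] Matrix k k B) (M : Matrix ι κ A) : Matrix (ι × k) (κ × k) B :=
  Matrix.of fun x y => φ (M x.1 y.1) x.2 y.2

variable (φ : A →⋆ₐ[ℂ] Matrix k k B)

theorem inflate_mul [Fintype κ] (M : Matrix ι κ A) (N : Matrix κ μ A) :
    inflate φ (M * N) = inflate φ M * inflate φ N := by
  ext x y
  simp [inflate, Matrix.mul_apply, Matrix.sum_apply, Fintype.sum_prod_type]

theorem inflate_conjTranspose (M : Matrix ι κ A) : inflate φ Mᴴ = (inflate φ M)ᴴ := by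
  ext x y
  simp [inflate, map_star, Matrix.star_apply]

theorem inflate_one [DecidableEq ι] : inflate φ (1 : Matrix ι ι A) = 1 := by
  ext ⟨a, b⟩ ⟨c, d⟩
  by_cases h : a = c <;> simp [inflate, Matrix.one_apply, h]

/-- Identification of `{0, …, n - 1} × k` with `{0, …, n |k| - 1}`. -/
def inflateIndex (k : Type*) [Fintype k] (n : ℕ) : Fin (n * Fintype.card k) ≃ Fin n × k :=
  finProdFinEquiv.symm.trans ((Equiv.refl _).prodCongr (Fintype.equivFin k).symm)

/-- The map `M_n(A) → M_{n |k|}(B)` induced by a ⋆-homomorphism `φ : A → M_k(B)`. -/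
def inflateFin (n : ℕ) (M : Matrix (Fin n) (Fin n) A) :
    Matrix (Fin (n * Fintype.card k)) (Fin (n * Fintype.card k)) B :=
  (inflate φ M).submatrix (inflateIndex k n) (inflateIndex k n)

theorem inflateFin_mul (n : ℕ) (M N : Matrix (Fin n) (Fin n) A) :
    inflateFin φ n (M * N) = inflateFin φ n M * inflateFin φ n N := by
  rw [inflateFin, inflate_mul, inflateFin, inflateFin, Matrix.submatrix_mul_equiv]

theorem inflateFin_star (n : ℕ) (M : Matrix (Fin n) (Fin n) A) :
    inflateFin φ n (star M) = star (inflateFin φ n M) := by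
  simp only [inflateFin, Matrix.star_eq_conjTranspose, inflate_conjTranspose,
    Matrix.conjTranspose_submatrix]

theorem inflateFin_fromBlocks (n m : ℕ) (M : Matrix (Fin n) (Fin n) A)
    (N : Matrix (Fin m) (Fin m) A) :
    ∃ e : Fin (n * Fintype.card k) ⊕ Fin (m * Fintype.card k) ≃ Fin ((n + m) * Fintype.card k),
      (inflateFin φ (n + m) ((Matrix.fromBlocks M 0 0 N).submatrix
        finSumFinEquiv.symm finSumFinEquiv.symm)).submatrix e e =
      Matrix.fromBlocks (inflateFin φ n M) 0 0 (inflateFin φ m N) := by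
  refine ⟨((inflateIndex k n).sumCongr (inflateIndex k m)).trans
    ((Equiv.sumProdDistrib _ _ _).symm.trans ((finSumFinEquiv.prodCongr (Equiv.refl k)).trans
      (inflateIndex k (n + m)).symm)), ?_⟩
  ext (i | i) (j | j) <;> simp [inflateFin, inflate]

theorem inflateFin_one (n : ℕ) : inflateFin φ n (1 : Matrix (Fin n) (Fin n) A) = 1 := by
  rw [inflateFin, inflate_one, Matrix.submatrix_one_equiv]

end MatrixAux

/-! ### The group `K₀` -/

section KZero

/-- A projection in a matrix algebra `M_n(A)`. -/
structure MatProj (A : Type u) [Ring A] [StarRing A] where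
  /-- The size `n` of the matrix. -/
  size : ℕ
  /-- The matrix. -/
  mat : Matrix (Fin size) (Fin size) A
  isProj : IsStarProjection mat

variable {A : Type u} {B : Type v} [Ring A] [StarRing A] [Ring B] [StarRing B]

/-- Murray–von Neumann equivalence of square matrices, possibly of different sizes:
`p = v v⋆` and `q = v⋆ v` for some rectangular matrix `v`. -/
def MvEquiv {ι κ : Type} [Fintype ι] [Fintype κ] (p : Matrix ι ι A) (q : Matrix κ κ A) : Prop :=
  ∃ v : Matrix ι κ A, v * vᴴ = p ∧ vᴴ * v = q

namespace MvEquiv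

variable {ι κ μ ν : Type} [Fintype ι] [Fintype κ] [Fintype μ] [Fintype ν]

theorem refl {p : Matrix ι ι A} (hp : IsStarProjection p) : MvEquiv p p := by
  have h : pᴴ = p := hp.isSelfAdjoint
  exact ⟨p, by rw [h, hp.isIdempotentElem.eq], by rw [h, hp.isIdempotentElem.eq]⟩

theorem symm {p : Matrix ι ι A} {q : Matrix κ κ A} (h : MvEquiv p q) : MvEquiv q p := by
  obtain ⟨v, hp, hq⟩ := h
  exact ⟨vᴴ, by rwa [Matrix.conjTranspose_conjTranspose],
    by rwa [Matrix.conjTranspose_conjTranspose]⟩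

theorem trans {p : Matrix ι ι A} {q : Matrix κ κ A} {r : Matrix μ μ A}
    (hp : IsStarProjection p) (hr : IsStarProjection r) (h : MvEquiv p q) (h' : MvEquiv q r) :
    MvEquiv p r := by
  obtain ⟨v, hv, hv'⟩ := h
  obtain ⟨w, hw, hw'⟩ := h'
  refine ⟨v * w, ?_, ?_⟩
  · calc v * w * (v * w)ᴴ = v * (w * wᴴ) * vᴴ := by
          rw [Matrix.conjTranspose_mul]; simp only [Matrix.mul_assoc]
      _ = (v * vᴴ) * (v * vᴴ) := by rw [hw, ← hv']; simp only [Matrix.mul_assoc]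
      _ = p := by rw [hv, hp.isIdempotentElem.eq]
  · calc (v * w)ᴴ * (v * w) = wᴴ * (vᴴ * v) * w := by
          rw [Matrix.conjTranspose_mul]; simp only [Matrix.mul_assoc]
      _ = (wᴴ * w) * (wᴴ * w) := by rw [hv', ← hw]; simp only [Matrix.mul_assoc]
      _ = r := by rw [hw', hr.isIdempotentElem.eq]

theorem submatrix {p : Matrix ι ι A} (hp : IsStarProjection p) (e : κ ≃ ι) :
    MvEquiv p (p.submatrix e e) := by
  have h : pᴴ = p := hp.isSelfAdjoint
  refine ⟨p.submatrix id e, ?_, ?_⟩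
  · rw [Matrix.conjTranspose_submatrix, h, Matrix.submatrix_mul_equiv, hp.isIdempotentElem.eq,
      Matrix.submatrix_id_id]
  · rw [Matrix.conjTranspose_submatrix, h, ← Matrix.submatrix_mul _ _ _ _ _ Function.bijective_id,
      hp.isIdempotentElem.eq]

theorem fromBlocks {p : Matrix ι ι A} {q : Matrix κ κ A} {p' : Matrix μ μ A} {q' : Matrix ν ν A}
    (h : MvEquiv p p') (h' : MvEquiv q q') :
    MvEquiv (Matrix.fromBlocks p 0 0 q) (Matrix.fromBlocks p' 0 0 q') := by
  obtain ⟨v, hv, hv'⟩ := h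
  obtain ⟨w, hw, hw'⟩ := h'
  refine ⟨Matrix.fromBlocks v 0 0 w, ?_, ?_⟩ <;>
    simp [Matrix.fromBlocks_conjTranspose, Matrix.fromBlocks_multiply, *]

end MvEquiv

theorem IsStarProjection.matrix_submatrix {ι κ : Type} [Fintype ι] [Fintype κ] {p : Matrix ι ι A}
    (hp : IsStarProjection p) (e : κ ≃ ι) : IsStarProjection (p.submatrix e e) where
  isIdempotentElem := by
    rw [IsIdempotentElem, Matrix.submatrix_mul_equiv, hp.isIdempotentElem.eq]
  isSelfAdjoint := by
    have h : pᴴ = p := hp.isSelfAdjoint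
    rw [IsSelfAdjoint, Matrix.star_eq_conjTranspose, Matrix.conjTranspose_submatrix, h]

theorem IsStarProjection.matrix_fromBlocks {ι κ : Type} [Fintype ι] [Fintype κ] {p : Matrix ι ι A}
    {q : Matrix κ κ A} (hp : IsStarProjection p) (hq : IsStarProjection q) :
    IsStarProjection (Matrix.fromBlocks p 0 0 q) where
  isIdempotentElem := by
    simp [IsIdempotentElem, Matrix.fromBlocks_multiply, hp.isIdempotentElem.eq,
      hq.isIdempotentElem.eq]
  isSelfAdjoint := by
    have h : pᴴ = p := hp.isSelfAdjoint
    have h' : qᴴ = q := hq.isSelfAdjoint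
    simp [IsSelfAdjoint, Matrix.star_eq_conjTranspose, Matrix.fromBlocks_conjTranspose, h, h']

namespace MatProj

instance setoid (A : Type u) [Ring A] [StarRing A] : Setoid (MatProj A) where
  r p q := MvEquiv p.mat q.mat
  iseqv :=
    { refl := fun p => .refl p.isProj
      symm := fun h => h.symm
      trans := fun {p _ r} h h' => h.trans p.isProj r.isProj h' }

/-- The zero projection of size `0`. -/
def zero (A : Type u) [Ring A] [StarRing A] : MatProj A := ⟨0, 0, .zero _⟩

/-- The orthogonal sum `p ⊕ q`, the block diagonal matrix with blocks `p` and `q`. -/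
def add (p q : MatProj A) : MatProj A where
  size := p.size + q.size
  mat := (Matrix.fromBlocks p.mat 0 0 q.mat).submatrix finSumFinEquiv.symm finSumFinEquiv.symm
  isProj := (p.isProj.matrix_fromBlocks q.isProj).matrix_submatrix _

theorem mat_add_equiv (p q : MatProj A) :
    MvEquiv (add p q).mat (Matrix.fromBlocks p.mat 0 0 q.mat) :=
  (MvEquiv.submatrix (p.isProj.matrix_fromBlocks q.isProj) _).symm

end MatProj

/-- The set of Murray–von Neumann classes of projections in matrices over `A`. -/
def ProjClass (A : Type u) [Ring A] [StarRing A] : Type u := Quotient (MatProj.setoid A)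

namespace ProjClass

instance : Zero (ProjClass A) := ⟨⟦MatProj.zero A⟧⟩

instance : Add (ProjClass A) :=
  ⟨Quotient.map₂ MatProj.add fun p p' h q q' h' =>
    ((MatProj.mat_add_equiv p q).trans (MatProj.add p q).isProj
      (p'.isProj.matrix_fromBlocks q'.isProj) (MvEquiv.fromBlocks h h')).trans
      (MatProj.add p q).isProj (MatProj.add p' q').isProj (MatProj.mat_add_equiv p' q').symm⟩

protected theorem add_comm (x y : ProjClass A) : x + y = y + x := by
  induction x using Quotient.inductionOn with | _ p
  induction y using Quotient.inductionOn with | _ q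
  refine Quotient.sound ?_
  have hpq := p.isProj.matrix_fromBlocks q.isProj
  have hqp := q.isProj.matrix_fromBlocks p.isProj
  have h := MvEquiv.submatrix hpq (Equiv.sumComm (Fin q.size) (Fin p.size))
  have e : (Matrix.fromBlocks p.mat 0 0 q.mat).submatrix
      (Equiv.sumComm (Fin q.size) (Fin p.size)) (Equiv.sumComm (Fin q.size) (Fin p.size)) =
      Matrix.fromBlocks q.mat 0 0 p.mat := by
    ext (i | i) (j | j) <;> rfl
  rw [e] at h
  exact ((MatProj.mat_add_equiv p q).trans (MatProj.add p q).isProj hqp h).trans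
    (MatProj.add p q).isProj (MatProj.add q p).isProj (MatProj.mat_add_equiv q p).symm

protected theorem zero_add (x : ProjClass A) : 0 + x = x := by
  induction x using Quotient.inductionOn with | _ p
  refine Quotient.sound ?_
  have hp := (IsStarProjection.zero (Matrix (Fin 0) (Fin 0) A)).matrix_fromBlocks p.isProj
  have h := MvEquiv.submatrix hp (Equiv.emptySum (Fin 0) (Fin p.size)).symm
  have e : (Matrix.fromBlocks (0 : Matrix (Fin 0) (Fin 0) A) 0 0 p.mat).submatrix
      (Equiv.emptySum (Fin 0) (Fin p.size)).symm (Equiv.emptySum (Fin 0) (Fin p.size)).symm =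
      p.mat := by
    ext i j
    rfl
  rw [e] at h
  exact (MatProj.mat_add_equiv _ p).trans (MatProj.add _ p).isProj p.isProj h

protected theorem add_assoc (x y z : ProjClass A) : x + y + z = x + (y + z) := by
  induction x using Quotient.inductionOn with | _ p
  induction y using Quotient.inductionOn with | _ q
  induction z using Quotient.inductionOn with | _ r
  refine Quotient.sound ?_
  have hpq := p.isProj.matrix_fromBlocks q.isProj
  have hqr := q.isProj.matrix_fromBlocks r.isProj
  have h := MvEquiv.submatrix (hpq.matrix_fromBlocks r.isProj)
    (Equiv.sumAssoc (Fin p.size) (Fin q.size) (Fin r.size)).symm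
  have e : (Matrix.fromBlocks (Matrix.fromBlocks p.mat 0 0 q.mat) 0 0 r.mat).submatrix
      (Equiv.sumAssoc (Fin p.size) (Fin q.size) (Fin r.size)).symm
      (Equiv.sumAssoc (Fin p.size) (Fin q.size) (Fin r.size)).symm =
      Matrix.fromBlocks p.mat 0 0 (Matrix.fromBlocks q.mat 0 0 r.mat) := by
    ext (i | i | i) (j | j | j) <;> rfl
  rw [e] at h
  have h₁ := (MatProj.mat_add_equiv (MatProj.add p q) r).trans (MatProj.isProj _)
    (hpq.matrix_fromBlocks r.isProj)
    (MvEquiv.fromBlocks (MatProj.mat_add_equiv p q) (.refl r.isProj))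
  have h₂ := (MatProj.mat_add_equiv p (MatProj.add q r)).trans (MatProj.isProj _)
    (p.isProj.matrix_fromBlocks hqr)
    (MvEquiv.fromBlocks (.refl p.isProj) (MatProj.mat_add_equiv q r))
  exact (h₁.trans (MatProj.isProj _) (p.isProj.matrix_fromBlocks hqr) h).trans
    (MatProj.isProj _) (MatProj.isProj _) h₂.symm

instance : AddCommMonoid (ProjClass A) where
  add_assoc := ProjClass.add_assoc
  zero_add := ProjClass.zero_add
  add_zero x := by rw [ProjClass.add_comm, ProjClass.zero_add]
  add_comm := ProjClass.add_comm
  nsmul := nsmulRec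

variable [Algebra ℂ A] [Algebra ℂ B] {k : Type*} [Fintype k] [DecidableEq k]
  (φ : A →⋆ₐ[ℂ] Matrix k k B)

theorem inflateFin_equiv {φ : A →⋆ₐ[ℂ] Matrix k k B} {n : ℕ} {p : Matrix (Fin n) (Fin n) A}
    (hp : IsStarProjection p) : IsStarProjection (inflateFin φ n p) where
  isIdempotentElem := by
    rw [IsIdempotentElem, ← inflateFin_mul, hp.isIdempotentElem.eq]
  isSelfAdjoint := by
    rw [IsSelfAdjoint, ← inflateFin_star, hp.isSelfAdjoint.star_eq]

/-- The map `[p] ↦ [φ(p)]` on classes of projections given by a ⋆-homomorphism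
`φ : A → M_k(B)`, where `φ` is applied entrywise and `M_n(M_k(B))` is identified with
`M_{n |k|}(B)`. -/
def map : ProjClass A →+ ProjClass B where
  toFun := Quotient.map (fun p => ⟨p.size * Fintype.card k, inflateFin φ p.size p.mat,
      inflateFin_equiv p.isProj⟩) fun p q h => by
    obtain ⟨v, hv, hv'⟩ := h
    refine ⟨(inflate φ v).submatrix (inflateIndex k p.size) (inflateIndex k q.size), ?_, ?_⟩
    · rw [Matrix.conjTranspose_submatrix, Matrix.submatrix_mul_equiv, ← inflate_conjTranspose,
        ← inflate_mul, hv]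
      rfl
    · rw [Matrix.conjTranspose_submatrix, Matrix.submatrix_mul_equiv, ← inflate_conjTranspose,
        ← inflate_mul, hv']
      rfl
  map_zero' := Quotient.sound ⟨fun i => (Fin.cast (Nat.zero_mul _) i).elim0, by
    ext i
    exact (Fin.cast (Nat.zero_mul _) i).elim0, by
    ext i
    exact i.elim0⟩
  map_add' x y := by
    induction x using Quotient.inductionOn with | _ p
    induction y using Quotient.inductionOn with | _ q
    refine Quotient.sound ?_
    obtain ⟨e, he⟩ := inflateFin_fromBlocks φ p.size q.size p.mat q.mat
    have h := MvEquiv.submatrix (inflateFin_equiv (φ := φ) (MatProj.add p q).isProj) e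
    have h : MvEquiv (inflateFin φ _ (MatProj.add p q).mat)
        (Matrix.fromBlocks (inflateFin φ p.size p.mat) 0 0 (inflateFin φ q.size q.mat)) :=
      he ▸ h
    exact h.trans (inflateFin_equiv (MatProj.add p q).isProj) (MatProj.isProj _)
      (MatProj.mat_add_equiv ⟨_, _, inflateFin_equiv p.isProj⟩
        ⟨_, _, inflateFin_equiv q.isProj⟩).symm

end ProjClass

/-- The group `K₀(A)` of a unital C⋆-algebra `A`: the Grothendieck group of the monoid of
Murray–von Neumann classes of projections in matrices over `A`. -/
abbrev KZero (A : Type u) [Ring A] [StarRing A] : Type u :=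
  Algebra.GrothendieckAddGroup (ProjClass A)

/-- The homomorphism `K₀(A) → K₀(M_k(B)) = K₀(B)` induced by a ⋆-homomorphism
`φ : A → M_k(B)`. -/
def KZero.map [Algebra ℂ A] [Algebra ℂ B] {k : Type*} [Fintype k] [DecidableEq k]
    (φ : A →⋆ₐ[ℂ] Matrix k k B) : KZero A →+ KZero B :=
  Algebra.GrothendieckAddGroup.lift
    (Algebra.GrothendieckAddGroup.of.comp (ProjClass.map φ))

end KZero

/-! ### The group `K₁` -/

section KOne

open scoped CStarAlgebra

variable (A : Type u) {B : Type v} [CStarAlgebra A] [CStarAlgebra B]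

/-- The unitary group `U_n(A)`, with the topology of `M_n(A)`. -/
abbrev MatUnitary (n : ℕ) : Type u := unitary (Matrix (Fin n) (Fin n) A)

/-- The subgroup of `U_n(A)` of the unitaries that are homotopic to `1` in `U_n(A)`. -/
def unitaryNull (n : ℕ) : Subgroup (MatUnitary A n) where
  carrier := {u | Joined 1 u}
  one_mem' := Joined.refl 1
  mul_mem' {u v} hu hv := by
    have h := Joined.mul hu hv
    rwa [mul_one] at h
  inv_mem' {u} hu := by
    have h := Joined.inv hu
    rwa [inv_one] at h

instance unitaryNull_normal (n : ℕ) : (unitaryNull A n).Normal where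
  conj_mem u hu g := by
    have h := Joined.mul (Joined.mul (Joined.refl g) hu) (Joined.refl g⁻¹)
    rwa [mul_one, mul_inv_cancel] at h

variable {A}

/-- The `m × m` matrix `u ⊕ 1` for an `n × n` matrix `u` with `n ≤ m`. -/
def padMat (n m : ℕ) (u : Matrix (Fin n) (Fin n) A) : Matrix (Fin m) (Fin m) A :=
  Matrix.of fun i j =>
    if h : i.1 < n ∧ j.1 < n then u ⟨i, h.1⟩ ⟨j, h.2⟩ else if i = j then 1 else 0

theorem padMat_eq (n d : ℕ) (u : Matrix (Fin n) (Fin n) A) :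
    padMat n (n + d) u = (Matrix.fromBlocks u 0 0 1).submatrix
      finSumFinEquiv.symm finSumFinEquiv.symm := by
  have h : (padMat n (n + d) u).submatrix finSumFinEquiv finSumFinEquiv =
      Matrix.fromBlocks u 0 0 1 := by
    ext (i | i) (j | j)
    · simp [padMat]
    · have : Fin.castAdd d i ≠ Fin.natAdd n j := by
        simp only [ne_eq, Fin.ext_iff, Fin.val_castAdd, Fin.val_natAdd]; omega
      simp [padMat, this]
    · have : Fin.natAdd n i ≠ Fin.castAdd d j := by
        simp only [ne_eq, Fin.ext_iff, Fin.val_castAdd, Fin.val_natAdd]; omega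
      simp [padMat, this]
    · simp [padMat, Matrix.one_apply]
  rw [← h]
  simp

theorem padMat_mul {n m : ℕ} (h : n ≤ m) (u v : Matrix (Fin n) (Fin n) A) :
    padMat n m (u * v) = padMat n m u * padMat n m v := by
  obtain ⟨d, rfl⟩ := Nat.exists_eq_add_of_le h
  simp only [padMat_eq, Matrix.submatrix_mul_equiv, Matrix.fromBlocks_multiply]
  simp

theorem padMat_star (n m : ℕ) (u : Matrix (Fin n) (Fin n) A) :
    padMat n m (star u) = star (padMat n m u) := by
  ext i j
  simp only [padMat, Matrix.star_apply, Matrix.of_apply, and_comm (a := j.1 < n),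
    eq_comm (a := j)]
  split_ifs <;> simp

theorem padMat_one (n m : ℕ) : padMat n m (1 : Matrix (Fin n) (Fin n) A) = 1 := by
  ext i j
  simp only [padMat, Matrix.of_apply, Matrix.one_apply, Fin.ext_iff]
  split_ifs <;> rfl

theorem continuous_padMat (n m : ℕ) :
    Continuous (padMat n m : Matrix (Fin n) (Fin n) A → Matrix (Fin m) (Fin m) A) := by
  refine continuous_matrix fun i j => ?_
  by_cases h : i.1 < n ∧ j.1 < n
  · simpa [padMat, h] using
      continuous_id.matrix_elem (A := fun u : Matrix (Fin n) (Fin n) A => u) ⟨i, h.1⟩ ⟨j, h.2⟩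
  · simpa [padMat, h] using continuous_const

/-- The homomorphism `U_n(A) → U_m(A)`, `u ↦ u ⊕ 1`, for `n ≤ m`. -/
def unitaryPad {n m : ℕ} (h : n ≤ m) : MatUnitary A n →* MatUnitary A m where
  toFun u := ⟨padMat n m u, by
    rw [Unitary.mem_iff, ← padMat_star, ← padMat_mul h, ← padMat_mul h, u.2.1, u.2.2, padMat_one]
    exact ⟨rfl, rfl⟩⟩
  map_one' := Subtype.ext (padMat_one n m)
  map_mul' u v := Subtype.ext (by simpa using padMat_mul h u.1 v.1)

theorem continuous_unitaryPad {n m : ℕ} (h : n ≤ m) :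
    Continuous (unitaryPad h : MatUnitary A n →* MatUnitary A m) :=
  Continuous.subtype_mk ((continuous_padMat n m).comp continuous_subtype_val) _

theorem joined_one_map {n m : ℕ} (f : MatUnitary A n →* MatUnitary B m) (hf : Continuous f) :
    unitaryNull A n ≤ (unitaryNull B m).comap f := fun u hu => by
  have h := Joined.map hu hf
  rwa [map_one] at h

variable (A) in
/-- The group `π₀(U_n(A)) = U_n(A) / U_n(A)₀` of homotopy classes of unitaries in `M_n(A)`. -/
abbrev UnitaryClass (n : ℕ) : Type u := MatUnitary A n ⧸ unitaryNull A n

/-- The homomorphism `[u] ↦ [u ⊕ 1]` from `U_n(A) / U_n(A)₀` to `U_m(A) / U_m(A)₀`. -/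
def classPad (n m : ℕ) (h : n ≤ m) : UnitaryClass A n →* UnitaryClass A m :=
  QuotientGroup.map _ _ (unitaryPad h) (joined_one_map _ (continuous_unitaryPad h))

instance : DirectedSystem (UnitaryClass A) (classPad (A := A) · · ·) where
  map_self n x := by
    induction x using QuotientGroup.induction_on with | _ u
    refine congrArg QuotientGroup.mk (Subtype.ext ?_)
    ext i j
    simp [unitaryPad, padMat]
  map_map n m l h h' x := by
    induction x using QuotientGroup.induction_on with | _ u
    refine congrArg QuotientGroup.mk (Subtype.ext ?_)
    ext i j
    simp only [unitaryPad, padMat, Matrix.of_apply, MonoidHom.coe_mk, OneHom.coe_mk, Fin.ext_iff]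
    split_ifs <;> first | rfl | omega

variable (A) in
/-- The direct limit of the groups `U_n(A) / U_n(A)₀` along the maps `[u] ↦ [u ⊕ 1]`. -/
abbrev KOneMul : Type u := DirectLimit (UnitaryClass A) (classPad (A := A))

section Rotation

variable {n : ℕ}

/-- The rotation matrix by the angle `t` in `M_2(M_n(A))`. -/
def rotMat (n : ℕ) (t : ℝ) : Matrix (Fin n ⊕ Fin n) (Fin n ⊕ Fin n) A :=
  Matrix.fromBlocks ((Real.cos t : ℂ) • 1) (-((Real.sin t : ℂ) • 1))
    ((Real.sin t : ℂ) • 1) ((Real.cos t : ℂ) • 1)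

theorem rotMat_star (t : ℝ) : star (rotMat (A := A) n t) = rotMat n (-t) := by
  simp only [rotMat, Matrix.star_eq_conjTranspose, Matrix.fromBlocks_conjTranspose,
    Matrix.conjTranspose_smul, Matrix.conjTranspose_neg, Matrix.conjTranspose_one, Complex.star_def,
    Complex.conj_ofReal, Real.cos_neg, Real.sin_neg, Complex.ofReal_neg, neg_smul, neg_neg]

theorem rotMat_mul_neg (t : ℝ) : rotMat (A := A) n t * rotMat n (-t) = 1 := by
  have h : (Real.cos t : ℂ) * Real.cos t + Real.sin t * Real.sin t = 1 := by
    exact_mod_cast (by nlinarith [Real.sin_sq_add_cos_sq t] :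
      Real.cos t * Real.cos t + Real.sin t * Real.sin t = 1)
  have h' : (Real.sin t : ℂ) * Real.sin t + Real.cos t * Real.cos t = 1 := by
    rw [add_comm, h]
  simp only [rotMat, Matrix.fromBlocks_multiply, Real.cos_neg, Real.sin_neg, Complex.ofReal_neg,
    neg_smul, neg_neg, neg_mul, mul_neg, smul_mul_smul_comm, mul_one, ← add_smul, h, h', one_smul]
  rw [mul_comm (Real.sin t : ℂ) (Real.cos t : ℂ), add_neg_cancel, Matrix.fromBlocks_one]

/-- The rotation by the angle `t` as a unitary. -/
def rotUnitary (n : ℕ) (t : ℝ) : unitary (Matrix (Fin n ⊕ Fin n) (Fin n ⊕ Fin n) A) :=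
  ⟨rotMat n t, by
    rw [Unitary.mem_iff, rotMat_star]
    refine ⟨?_, rotMat_mul_neg t⟩
    have h := rotMat_mul_neg (A := A) (n := n) (-t)
    rwa [neg_neg] at h⟩

theorem continuous_rotUnitary : Continuous (rotUnitary (A := A) n) := by
  refine Continuous.subtype_mk ?_ _
  refine Continuous.matrix_fromBlocks ?_ ?_ ?_ ?_ <;> fun_prop

/-- The block diagonal unitary `u ⊕ v`. -/
def blockUnitary (u v : MatUnitary A n) : unitary (Matrix (Fin n ⊕ Fin n) (Fin n ⊕ Fin n) A) :=
  ⟨Matrix.fromBlocks u 0 0 v, by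
    rw [Unitary.mem_iff, Matrix.star_eq_conjTranspose, Matrix.fromBlocks_conjTranspose,
      Matrix.fromBlocks_multiply, Matrix.fromBlocks_multiply, ← Matrix.star_eq_conjTranspose u.1,
      ← Matrix.star_eq_conjTranspose v.1, u.2.1, u.2.2, v.2.1, v.2.2]
    simp⟩

theorem blockUnitary_mul (u v u' v' : MatUnitary A n) :
    blockUnitary u v * blockUnitary u' v' = blockUnitary (u * u') (v * v') := by
  refine Subtype.ext ?_
  simp [blockUnitary, Matrix.fromBlocks_multiply]

theorem joined_blockUnitary (v : MatUnitary A n) : Joined (blockUnitary v 1) (blockUnitary 1 v) := by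
  have h := (PathConnectedSpace.joined (0 : ℝ) (Real.pi / 2)).map
    (f := fun t => rotUnitary n t * blockUnitary v 1 * (rotUnitary n t)⁻¹)
    ((continuous_rotUnitary.mul continuous_const).mul continuous_rotUnitary.inv)
  have h₀ : rotUnitary (A := A) n 0 = 1 := by
    refine Subtype.ext ?_
    simp [rotUnitary, rotMat]
  have h₁ : rotUnitary (A := A) n (Real.pi / 2) * blockUnitary v 1 =
      blockUnitary 1 v * rotUnitary n (Real.pi / 2) := by
    refine Subtype.ext ?_
    simp [rotUnitary, rotMat, blockUnitary, Matrix.fromBlocks_multiply]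
  rwa [h₀, h₁, mul_assoc (blockUnitary 1 v), mul_inv_cancel, mul_one, one_mul, inv_one,
    mul_one] at h

theorem joined_block_comm (u v : MatUnitary A n) :
    Joined (blockUnitary (u * v) 1) (blockUnitary (v * u) 1) := by
  have h₁ := Joined.mul (Joined.refl (blockUnitary u 1)) (joined_blockUnitary v)
  have h₂ := Joined.mul (joined_blockUnitary v) (Joined.refl (blockUnitary u 1))
  simp only [blockUnitary_mul, mul_one, one_mul] at h₁ h₂
  exact h₁.trans h₂.symm

theorem joined_pad_comm (u v : MatUnitary A n) :
    Joined (unitaryPad (Nat.le_add_right n n) (u * v))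
      (unitaryPad (Nat.le_add_right n n) (v * u)) := by
  have key (w : unitary (Matrix (Fin n ⊕ Fin n) (Fin n ⊕ Fin n) A)) :
      (w : Matrix (Fin n ⊕ Fin n) (Fin n ⊕ Fin n) A).submatrix finSumFinEquiv.symm
        finSumFinEquiv.symm ∈ unitary (Matrix (Fin (n + n)) (Fin (n + n)) A) := by
    rw [Unitary.mem_iff, Matrix.star_eq_conjTranspose, Matrix.conjTranspose_submatrix,
      Matrix.submatrix_mul_equiv, Matrix.submatrix_mul_equiv, ← Matrix.star_eq_conjTranspose,
      w.2.1, w.2.2, Matrix.submatrix_one_equiv]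
    exact ⟨rfl, rfl⟩
  have h := (joined_block_comm u v).map
    (f := fun w => (⟨_, key w⟩ : MatUnitary A (n + n)))
    (Continuous.subtype_mk (continuous_subtype_val.matrix_submatrix _ _) _)
  have e (w : MatUnitary A n) :
      (⟨_, key (blockUnitary w 1)⟩ : MatUnitary A (n + n)) =
        unitaryPad (Nat.le_add_right n n) w :=
    Subtype.ext (by simpa [blockUnitary, unitaryPad] using (padMat_eq n n w.1).symm)
  rwa [e, e] at h

end Rotation

instance : CommGroup (KOneMul A) where
  mul_comm x y := by
    induction x, y using DirectLimit.induction₂ with | _ n x y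
    induction x using QuotientGroup.induction_on with | _ u
    induction y using QuotientGroup.induction_on with | _ v
    rw [DirectLimit.mul_def, DirectLimit.mul_def]
    refine Quotient.sound ⟨n + n, Nat.le_add_right n n, Nat.le_add_right n n, ?_⟩
    refine QuotientGroup.eq.mpr ?_
    have h := Joined.mul (Joined.refl (unitaryPad (Nat.le_add_right n n) (u * v))⁻¹)
      (joined_pad_comm u v)
    rwa [inv_mul_cancel] at h

variable (A) in
/-- The group `K₁(A)` of a unital C⋆-algebra `A`, written additively: unitaries in matrices over
`A` up to homotopy and up to `u ∼ u ⊕ 1`. -/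
abbrev KOne : Type u := Additive (KOneMul A)

variable {k : Type*} [Fintype k] [DecidableEq k] (φ : A →⋆ₐ[ℂ] Matrix k k B)

theorem continuous_inflateFin (n : ℕ) : Continuous (inflateFin φ n) := by
  let _ := CStarAlgebra.spectralOrder B
  have := CStarAlgebra.spectralOrderedRing B
  have hφ : Continuous φ := map_continuous
    ((CStarMatrix.ofMatrixStarAlgEquiv (n := k) (A := B)).toStarAlgHom.comp φ)
  refine continuous_matrix fun i j => ?_
  exact (hφ.comp (continuous_id.matrix_elem _ _)).matrix_elem _ _

/-- The homomorphism `U_n(A) → U_{n |k|}(B)` induced by a unital ⋆-homomorphism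
`φ : A → M_k(B)`. -/
def unitaryInflate (n : ℕ) : MatUnitary A n →* MatUnitary B (n * Fintype.card k) where
  toFun u := ⟨inflateFin φ n u.1, by
    rw [Unitary.mem_iff, ← inflateFin_star, ← inflateFin_mul, ← inflateFin_mul, u.2.1, u.2.2,
      inflateFin_one]
    exact ⟨rfl, rfl⟩⟩
  map_one' := Subtype.ext (inflateFin_one φ n)
  map_mul' u v := Subtype.ext (by simpa using inflateFin_mul φ n u.1 v.1)

/-- The homomorphism from `U_n(A) / U_n(A)₀` induced by a unital ⋆-homomorphism
`φ : A → M_k(B)`. -/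
def classInflate (n : ℕ) : UnitaryClass A n →* UnitaryClass B (n * Fintype.card k) :=
  QuotientGroup.map _ _ (unitaryInflate φ n) (joined_one_map _
    (Continuous.subtype_mk ((continuous_inflateFin φ n).comp continuous_subtype_val) _))

theorem unitaryInflate_pad {n m : ℕ} (h : n ≤ m) (u : MatUnitary A n) :
    unitaryInflate φ m (unitaryPad h u) =
      unitaryPad (Nat.mul_le_mul_right _ h) (unitaryInflate φ n u) := by
  have h₁ (n : ℕ) (i : Fin (n * Fintype.card k)) :
      (inflateIndex k n i).1.1 = i.1 / Fintype.card k := rfl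
  have h₂ (n m : ℕ) (i : Fin (n * Fintype.card k)) (j : Fin (m * Fintype.card k))
      (hij : i.1 = j.1) : (inflateIndex k n i).2 = (inflateIndex k m j).2 := by
    simp only [inflateIndex, Equiv.trans_apply, Equiv.prodCongr_apply, Prod.map]
    refine congrArg _ (Fin.ext ?_)
    exact congrArg (· % Fintype.card k) hij
  have hlt (i : Fin (m * Fintype.card k)) :
      (inflateIndex k m i).1.1 < n ↔ i.1 < n * Fintype.card k := by
    have hc : 0 < Fintype.card k := Nat.pos_of_ne_zero fun h0 => by
      have := i.2
      simp [h0] at this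
    rw [h₁, Nat.div_lt_iff_lt_mul hc]
  refine Subtype.ext ?_
  ext i j
  change φ (padMat n m u.1 (inflateIndex k m i).1 (inflateIndex k m j).1) (inflateIndex k m i).2
    (inflateIndex k m j).2 = padMat _ _ (inflateFin φ n u.1) i j
  simp only [padMat, Matrix.of_apply, hlt]
  split_ifs with h₃ h₄ h₅ h₅
  · refine congr_arg₂ _ (h₂ _ _ _ _ rfl) (h₂ _ _ _ _ rfl)
  · rw [map_one, h₅, Matrix.one_apply_eq]
  · rw [map_one, Matrix.one_apply_ne]
    exact fun h₆ => h₅ ((inflateIndex k m).injective (Prod.ext h₄ h₆))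
  · exact absurd (congrArg (fun x => (inflateIndex k m x).1) h₅) h₄
  · rw [map_zero, Matrix.zero_apply]

/-- The homomorphism `K₁(A) → K₁(M_k(B)) = K₁(B)` induced by a unital ⋆-homomorphism
`φ : A → M_k(B)`: it sends the class of `u ∈ U_n(A)` to the class of `φ(u)`, where `φ` is applied
entrywise and `M_n(M_k(B))` is identified with `M_{n |k|}(B)`. -/
def KOne.map : KOne A →+ KOne B :=
  MonoidHom.toAdditive
    { toFun := DirectLimit.lift _ (fun n x => ⟦⟨n * Fintype.card k, classInflate φ n x⟩⟧)
        fun n m h x => by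
          induction x using QuotientGroup.induction_on with | _ u
          refine (DirectLimit.eq_of_le (f := classPad) _ (m * Fintype.card k)
            (Nat.mul_le_mul_right _ h)).trans ?_
          have e : classPad _ _ (Nat.mul_le_mul_right _ h) (classInflate φ n u) =
              classInflate φ m (classPad n m h u) :=
            congrArg QuotientGroup.mk (unitaryInflate_pad φ h u).symm
          rw [e]
      map_one' := by
        rw [DirectLimit.one_def 0, DirectLimit.lift_def, map_one, DirectLimit.one_def]
      map_mul' := fun x y => by
        induction x, y using DirectLimit.induction₂ with | _ n x y
        rw [DirectLimit.mul_def, DirectLimit.lift_def, DirectLimit.lift_def, DirectLimit.lift_def,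
          map_mul, DirectLimit.mul_def] }

end KOne

/-! ### The connecting maps -/

section Transfer

variable {G : Type u} [Group G]

open Classical in
/-- Let `L` and `D` be subgroups of `G` (with `L ≤ D` of finite index in the application) and let
`r` be a choice of representatives of the cosets of `L` in `D`. For `g ∈ D`, this is the matrix
over `C⋆_r(L)` of left multiplication by `g` with respect to these representatives: its `(c, d)`
entry is `δ_h` if `g r(d) = r(c) h` with `h ∈ L`, and `0` if there is no such `h`. -/
def cosetMatrix (D L : Subgroup G) (r : D ⧸ L.subgroupOf D → D) (g : D) :
    Matrix (D ⧸ L.subgroupOf D) (D ⧸ L.subgroupOf D) (reducedGroupCStar L) :=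
  Matrix.of fun c d =>
    if h : (((r c)⁻¹ * g * r d : D) : G) ∈ L then groupUnitary ⟨_, h⟩ else 0

end Transfer

end

open Filter Topology
open scoped CStarAlgebra
open ContinuousLinearMap (adjoint)

noncomputable section

/-! ### Perturbation of projections, partial isometries and unitaries in a C⋆-algebra. -/

section CStarPerturbation

variable {C : Type*} [CStarAlgebra C]

/-! Let X be the odometer. In B(ℓ²(Γ × X)) let A_i be the C⋆-algebra generated by the operators λ_g
and by the functions on X that factor through the coordinate X → Γ/Γ_i (`pulledCrossedProduct`). The
A_i increase, and by Stone–Weierstrass their union is dense in C(X) ⋊_r Γ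
(`reducedCrossedProduct_le_of_separates`).

Each A_i is a copy of M_{Γ/Γ_i}(C⋆_r(Γ_i)) (`pulledCompression_bijective`). Take a point x₀ over the
trivial coset. The slice ℓ²(Γ × {x₀}) is invariant under A_i, and the cosets sΓ_i cut it into copies
of ℓ²(Γ_i). A function acts on each copy by a scalar, and λ_g permutes the copies up to left
translations by elements of Γ_i, so all matrix coefficients lie in C⋆_r(Γ_i). One slice suffices for
faithfulness, because right translations carry it onto every other slice and commute with A_i
(`comp_orbitOp`). For surjectivity, λ_{s h t⁻¹} times the indicator of tΓ_i is the matrix unit at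
(s, t) with entry δ_h. Part (1) is the case X = Γ/Λ with the identity as coordinate, combined with
M_n(ℂ) ⊗ A ≅ M_n(A).

In part (2), the transfer τ_i is the same compression applied to C⋆_r(Γ_i) on ℓ²(Γ_i). Compressing
A_i to Γ_i and then applying τ_i amounts to compressing along a transversal of Γ_{i+1} made of
products of representatives; including A_i in A_{i+1} and then compressing uses another transversal.
Two transversals give matrices conjugate by a unitary (`exists_frame_change`), so in K-theory the
inclusion A_i ⊆ A_{i+1} becomes τ_i.

What remains is the continuity of K₀ and K₁ for a dense increasing union. Projections, partial
isometries and unitaries are approximated by elements of some A_m and then corrected by functional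
calculus. A unitary connected to 1 is a product of exponentials, whose exponents can be approximated
one at a time (`Approximates.exists_joined_one`). `nonempty_iso_colimit_ofSequence` converts this
into an isomorphism with the categorical colimit. -/

theorem exists_inv_sqrt {h : C} (hh : IsSelfAdjoint h) {r : ℝ} (hr : ‖h - 1‖ ≤ r) (hr1 : r < 1) :
    ∃ s : C, IsSelfAdjoint s ∧ s * s * h = 1 ∧ (∀ b, Commute h b → Commute s b) ∧
      (r ≤ 1 / 2 → ‖s - 1‖ ≤ 1 / 2) := by
  have hsp : ∀ x ∈ spectrum ℝ h, |x - 1| ≤ r := fun x hx => by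
    have h1 := norm_apply_le_norm_cfc (𝕜 := ℝ) (fun x => x - 1) h hx
    rw [cfc_sub (fun x => x) (fun _ => 1) h, cfc_id' ℝ h, cfc_const_one ℝ h] at h1
    exact h1.trans hr
  have hpos : ∀ x ∈ spectrum ℝ h, 0 < x := fun x hx => by
    have := (abs_le.mp (hsp x hx)).1
    linarith
  have hc : ContinuousOn (fun x : ℝ => (√x)⁻¹) (spectrum ℝ h) :=
    Real.continuous_sqrt.continuousOn.inv₀ fun x hx => (Real.sqrt_pos.mpr (hpos x hx)).ne'
  -- The witness is h^{-1/2}, available because the spectrum of h lies within r < 1 of 1.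
  refine ⟨cfc (fun x : ℝ => (√x)⁻¹) h, cfc_predicate _ h, ?_, fun b hb => hb.cfc_real _, ?_⟩
  · nth_rw 3 [← cfc_id' ℝ h]
    rw [← cfc_mul _ _ h hc hc, ← cfc_mul (fun x => (√x)⁻¹ * (√x)⁻¹) (fun x => x) h (hc.mul hc) continuousOn_id, ← cfc_const_one ℝ h]
    refine cfc_congr fun x hx => ?_
    have h0 := hpos x hx
    have h1 := (Real.sqrt_pos.mpr h0).ne'
    have h2 := Real.mul_self_sqrt h0.le
    change (√x)⁻¹ * (√x)⁻¹ * x = 1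
    rw [← mul_inv, h2, inv_mul_cancel₀ h0.ne']
  · intro hr2
    rw [← cfc_const_one ℝ h, ← cfc_sub _ _ h hc continuousOn_const]
    refine norm_cfc_le (by norm_num) fun x hx => ?_
    have h0 := hpos x hx
    have h3 := abs_le.mp (hsp x hx)
    -- Here x lies in [1/2, 3/2]. The bounds 2/3 and 2 on √x are chosen so that its inverse lies in
    -- [1/2, 3/2].
    have h4 : 2 / 3 ≤ √x := Real.le_sqrt_of_sq_le (by linarith)
    have h5 : √x ≤ 2 := Real.sqrt_le_iff.mpr ⟨by norm_num, by linarith⟩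
    have h6 : (√x)⁻¹ ≤ (2 / 3)⁻¹ := inv_anti₀ (by norm_num) h4
    have h7 : (2 : ℝ)⁻¹ ≤ (√x)⁻¹ := inv_anti₀ (by linarith) h5
    rw [Real.norm_eq_abs, abs_le]
    constructor <;> linarith

/-- Polar decomposition of z between the corners of p and q. Adding 1 - p makes z z⋆ invertible in C
and not merely in pCp, and v = (z z⋆ + 1 - p)^{-1/2} z. The second norm bound makes z⋆ z + 1 - q
invertible; since v⋆ v - q annihilates it, v⋆ v is all of q. -/
theorem exists_partialIsometry {p q z : C} (hp : IsStarProjection p) (hq : IsStarProjection q)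
    (hpz : p * z = z) (hzq : z * q = z) (h₁ : ‖z * star z - p‖ < 1) (h₂ : ‖star z * z - q‖ < 1) :
    ∃ v : C, v * star v = p ∧ star v * v = q := by
  have hp1 : p * p = p := hp.isIdempotentElem
  have hq1 : q * q = q := hq.isIdempotentElem
  have hps : star p = p := hp.isSelfAdjoint
  have hqs : star q = q := hq.isSelfAdjoint
  have hzp : star z * p = star z := by rw [← hps, ← star_mul, hpz]
  have hqz : q * star z = star z := by rw [← hqs, ← star_mul, hzq]
  have aux {e x : C} (hes : star e = e) (hx : star x = x) (hlt : ‖x - e‖ < 1) :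
      ∃ s : C, IsSelfAdjoint s ∧ s * s * (x + 1 - e) = 1 ∧
        ∀ b, Commute (x + 1 - e) b → Commute s b := by
    obtain ⟨s, hs1, hs2, hs3, -⟩ := exists_inv_sqrt (h := x + 1 - e)
      (by rw [IsSelfAdjoint, star_sub, star_add, hx, star_one, hes])
      (le_of_eq (by congr 1; abel : ‖x + 1 - e - 1‖ = ‖x - e‖)) hlt
    exact ⟨s, hs1, hs2, hs3⟩
  obtain ⟨s, hs1, hs2, hs3⟩ := aux hps (by rw [star_mul, star_star]) h₁
  obtain ⟨t, ht1, ht2, ht3⟩ := aux hqs (by rw [star_mul, star_star]) h₂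
  set h := z * star z + 1 - p with hdef
  set k := star z * z + 1 - q with kdef
  have hph : p * h = z * star z := by
    rw [hdef, mul_sub, mul_add, ← mul_assoc, hpz, mul_one, hp1]; abel
  have hhp : h * p = z * star z := by
    rw [hdef, sub_mul, add_mul, mul_assoc, hzp, one_mul, hp1]; abel
  have hqk : q * k = star z * z := by
    rw [kdef, mul_sub, mul_add, ← mul_assoc, hqz, mul_one, hq1]; abel
  have hs4 : s * p = p * s := hs3 p (hhp.trans hph.symm)
  have hs5 : s * h = h * s := (hs3 h (Commute.refl h))
  have ht5 : t * k = k * t := (ht3 k (Commute.refl k))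
  refine ⟨s * z, ?_, ?_⟩
  · calc s * z * star (s * z) = s * (z * star z) * s := by
          rw [star_mul, hs1.star_eq]; simp only [mul_assoc]
      _ = p * (s * s * h) := by
          rw [← hph, ← mul_assoc, hs4, mul_assoc, mul_assoc, mul_assoc, ← hs5]
      _ = p := by rw [hs2, mul_one]
  · have hz : z * star z * z = h * z := by
      rw [hdef, sub_mul, add_mul, one_mul, hpz, add_sub_cancel_right]
    have e1 : (star z * (s * s) * z - q) * k = 0 := by
      have e2 : star z * (s * s) * z * k = star z * z := by
        rw [kdef, mul_sub, mul_add, mul_one, mul_assoc _ z q, hzq, add_sub_cancel_right]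
        calc star z * (s * s) * z * (star z * z) = star z * (s * s) * (z * star z * z) := by
              simp only [mul_assoc]
          _ = star z * (s * s * h) * z := by rw [hz]; simp only [mul_assoc]
          _ = star z * z := by rw [hs2, mul_one]
      rw [sub_mul, e2, hqk, sub_self]
    have e3 : k * (t * t) = 1 := by rw [← mul_assoc, ← ht5, mul_assoc, ← ht5, ← mul_assoc, ht2]
    have e4 : star z * (s * s) * z - q = 0 := by
      rw [← mul_one (_ - q), ← e3, ← mul_assoc, e1, zero_mul]
    rw [star_mul, hs1.star_eq, ← sub_eq_zero, ← e4]
    simp only [mul_assoc]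

/-- Take z = p q: then z z⋆ - p = p (q - p) p has norm less than 1, and symmetrically for z⋆ z - q.
-/
theorem exists_partialIsometry_of_norm_sub_lt_one {p q : C} (hp : IsStarProjection p)
    (hq : IsStarProjection q) (h : ‖p - q‖ < 1) : ∃ v : C, v * star v = p ∧ star v * v = q := by
  have hp1 : p * p = p := hp.isIdempotentElem
  have hq1 : q * q = q := hq.isIdempotentElem
  have hps : star p = p := hp.isSelfAdjoint
  have hqs : star q = q := hq.isSelfAdjoint
  have key {a b : C} (ha : IsStarProjection a) (hb : b * b = b) (hab : ‖b - a‖ < 1) :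
      ‖a * b * (b * a) - a‖ < 1 := by
    have h1 : a * b * (b * a) - a = a * (b - a) * a := by
      rw [mul_sub, sub_mul, mul_assoc, ← mul_assoc b b, hb, ← mul_assoc,
        ha.isIdempotentElem.eq, ha.isIdempotentElem.eq]
    have hn : ‖a‖ ≤ 1 := ha.norm_le
    rw [h1]
    calc ‖a * (b - a) * a‖ ≤ ‖a‖ * ‖b - a‖ * ‖a‖ := norm_mul₃_le
      _ ≤ 1 * ‖b - a‖ * 1 := by gcongr
      _ < 1 := by simpa using hab
  refine exists_partialIsometry (z := p * q) hp hq (by rw [← mul_assoc, hp1])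
    (by rw [mul_assoc, hq1]) ?_ ?_
  · rw [star_mul, hps, hqs]
    exact key hp hq1 (by rwa [norm_sub_rev])
  · rw [star_mul, hps, hqs]
    exact key hq hp1 h

/-- On [1/4, 3/4] one has x - x² ≥ 3/16, so the spectrum of a avoids this interval. A step function
jumping at 1/2 is therefore continuous on the spectrum, and it differs from x there by at most 1/4.
-/
theorem exists_isStarProjection_near {a : C} (ha : IsSelfAdjoint a) (h : ‖a * a - a‖ < 3 / 16) :
    ∃ q : C, IsStarProjection q ∧ ‖q - a‖ ≤ 1 / 4 := by
  have hsp : ∀ x ∈ spectrum ℝ a, |x * x - x| < 3 / 16 := fun x hx => by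
    have h1 := norm_apply_le_norm_cfc (𝕜 := ℝ) (fun x => x * x - x) a hx
    rw [cfc_sub (fun x => x * x) (fun x => x) a, cfc_mul (fun x => x) (fun x => x) a,
      cfc_id' ℝ a] at h1
    exact h1.trans_lt h
  have hgap : ∀ x ∈ spectrum ℝ a, x < 1 / 4 ∨ 3 / 4 < x := fun x hx => by
    by_contra! hcon
    have := (abs_lt.mp (hsp x hx)).1
    nlinarith
  set f : ℝ → ℝ := fun x => if x < 1 / 2 then 0 else 1 with hf
  have hc : ContinuousOn f (spectrum ℝ a) := fun x hx => by
    refine ContinuousAt.continuousWithinAt ?_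
    rcases hgap x hx with h1 | h1
    · refine (continuousAt_const (y := (0 : ℝ))).congr ?_
      filter_upwards [Iio_mem_nhds (show x < 1 / 2 by linarith)] with y hy
      exact (if_pos hy).symm
    · refine (continuousAt_const (y := (1 : ℝ))).congr ?_
      filter_upwards [Ioi_mem_nhds (show 1 / 2 < x by linarith)] with y hy
      exact (if_neg (not_lt.mpr (Set.mem_Ioi.mp hy).le)).symm
  refine ⟨cfc f a, ⟨?_, cfc_predicate _ a⟩, ?_⟩
  · rw [IsIdempotentElem, ← cfc_mul f f a]
    refine cfc_congr fun x _ => ?_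
    simp [hf]
  · nth_rw 2 [← cfc_id' ℝ a]
    rw [← cfc_sub f (fun x => x) a]
    refine norm_cfc_le (by norm_num) fun x hx => ?_
    have h2 := abs_lt.mp (hsp x hx)
    rw [Real.norm_eq_abs, abs_le]
    rcases hgap x hx with h1 | h1
    · have h3 : f x = 0 := if_pos (by linarith)
      rw [h3]
      constructor <;> nlinarith
    · have h3 : f x = 1 := if_neg (by linarith)
      rw [h3]
      constructor <;> nlinarith

/-- The unitary is a (a⋆ a)^{-1/2}. It is an isometry by the first bound; the second makes a a⋆
invertible, which supplies a right inverse. -/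
theorem exists_unitary_near {a : C} (h₁ : ‖star a * a - 1‖ ≤ 1 / 2) (h₂ : ‖a * star a - 1‖ < 1) :
    ∃ u : unitary C, ‖(u : C) - a‖ ≤ ‖a‖ * (1 / 2) := by
  obtain ⟨s, hs1, hs2, hs3, hs4⟩ := exists_inv_sqrt (.star_mul_self a) h₁ (by norm_num)
  obtain ⟨t, -, ht2, ht3, -⟩ := exists_inv_sqrt (.mul_star_self a) le_rfl h₂
  have hs5 := hs3 _ (Commute.refl _)
  have ht5 := ht3 _ (Commute.refl _)
  have e1 : star (a * s) * (a * s) = 1 := by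
    rw [star_mul, hs1.star_eq, ← hs2, mul_assoc s s, hs5.eq]
    simp only [mul_assoc]
  have e2 : a * s * (s * (star a * a) * (star a * (t * t))) = 1 := by
    calc a * s * (s * (star a * a) * (star a * (t * t)))
        = a * (s * s * (star a * a)) * star a * (t * t) := by simp only [mul_assoc]
      _ = t * (t * (a * star a)) := by rw [hs2, mul_one, ← mul_assoc, ← ht5.eq, mul_assoc, ← ht5.eq]
      _ = 1 := by rw [← mul_assoc, ht2]
  have e3 := left_inv_eq_right_inv e1 e2
  refine ⟨⟨a * s, Unitary.mem_iff.mpr ⟨e1, by rw [e3, e2]⟩⟩, ?_⟩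
  calc ‖a * s - a‖ = ‖a * (s - 1)‖ := by rw [mul_sub, mul_one]
    _ ≤ ‖a‖ * ‖s - 1‖ := norm_mul_le _ _
    _ ≤ ‖a‖ * (1 / 2) := by gcongr; exact hs4 le_rfl

end CStarPerturbation

/-! ### Lifting projections, equivalences, unitaries and homotopies to an approximating sequence of
algebras. -/

section Approximation

variable {C : Type*} [CStarAlgebra C] {D : ℕ → Type*} [∀ m, CStarAlgebra (D m)]

/-- Every element of `C` is a limit of elements coming from the algebras `D m`. -/
def Approximates (j : ∀ m, D m →⋆ₐ[ℂ] C) : Prop :=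
  ∀ c, ∃ s : ∀ m, D m, Tendsto (fun m => j m (s m)) atTop (𝓝 c)

theorem continuous_starAlgHom {A B : Type*} [CStarAlgebra A] [CStarAlgebra B]
    (f : A →⋆ₐ[ℂ] B) : Continuous f :=
  map_continuous f

theorem mul_eq_of_mul_star_eq {p v : C} (hp : IsStarProjection p) (hv : v * star v = p) :
    p * v = v := by
  have h : (p * v - v) * star (p * v - v) =
      p * (v * star v) * p - p * (v * star v) - v * star v * p + v * star v := by
    rw [star_sub, star_mul, hp.isSelfAdjoint.star_eq]
    noncomm_ring
  rw [hv, hp.isIdempotentElem.eq, hp.isIdempotentElem.eq, sub_self, zero_sub,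
    neg_add_cancel] at h
  exact sub_eq_zero.mp ((CStarRing.mul_star_self_eq_zero_iff _).mp h)

/-- The map on unitary groups induced by a unital ⋆-homomorphism. -/
def unitaryHom {A B : Type*} [Ring A] [StarRing A] [Algebra ℂ A] [Ring B] [StarRing B]
    [Algebra ℂ B] (f : A →⋆ₐ[ℂ] B) : unitary A →* unitary B where
  toFun u := ⟨f u, Unitary.map_mem f u.2⟩
  map_one' := Subtype.ext (map_one f)
  map_mul' u v := Subtype.ext (map_mul f u.1 v.1)

theorem joined_of_norm_sub_lt {A : Type*} [CStarAlgebra A] {u w : unitary A}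
    (huw : ‖(u - w : A)‖ < 2) : Joined u w :=
  Unitary.joined u w (by rwa [norm_sub_rev])

namespace Approximates

variable {j : ∀ m, D m →⋆ₐ[ℂ] C} (hj : ∀ m, Function.Injective (j m)) (h : Approximates j)

include h in
theorem exists_isSelfAdjoint {c : C} (hc : IsSelfAdjoint c) : ∃ s : ∀ m, D m,
    (∀ m, IsSelfAdjoint (s m)) ∧ Tendsto (fun m => j m (s m)) atTop (𝓝 c) := by
  obtain ⟨s, hs⟩ := h c
  refine ⟨fun m => (2 : ℂ)⁻¹ • (s m + star (s m)), fun m => ?_, ?_⟩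
  · rw [IsSelfAdjoint, star_smul, star_add, star_star, add_comm]
    norm_num
  have h1 := (hs.add hs.star).const_smul ((2 : ℂ)⁻¹)
  rw [hc.star_eq, ← two_smul ℂ c, smul_smul, inv_mul_cancel₀ two_ne_zero, one_smul] at h1
  refine h1.congr fun m => ?_
  rw [← map_star, ← map_add, ← map_smul]

include hj h in
theorem exists_isStarProjection {p : C} (hp : IsStarProjection p) :
    ∃ m, ∃ q : D m, IsStarProjection q ∧ ∃ v : C, v * star v = p ∧ star v * v = j m q := by
  obtain ⟨s, hs, hsp⟩ := h.exists_isSelfAdjoint hp.isSelfAdjoint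
  have h1 : Tendsto (fun m => ‖j m (s m) * j m (s m) - j m (s m)‖) atTop (𝓝 0) := by
    have := ((hsp.mul hsp).sub hsp).norm
    rwa [hp.isIdempotentElem.eq, sub_self, norm_zero] at this
  have h2 : Tendsto (fun m => ‖j m (s m) - p‖) atTop (𝓝 0) :=
    tendsto_iff_norm_sub_tendsto_zero.mp hsp
  obtain ⟨m, hm1, hm2⟩ := ((h1.eventually_lt_const (show (0 : ℝ) < 3 / 16 by norm_num)).and
    (h2.eventually_lt_const (show (0 : ℝ) < 1 / 4 by norm_num))).exists
  -- An injective ⋆-homomorphism is isometric, so an estimate in C is an estimate in `D m`.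
  rw [← map_mul, ← map_sub, NonUnitalStarAlgHom.norm_map (j m) (hj m)] at hm1
  obtain ⟨q, hq, hqs⟩ := exists_isStarProjection_near (hs m) hm1
  refine ⟨m, q, hq, exists_partialIsometry_of_norm_sub_lt_one hp (hq.map (j m)) ?_⟩
  rw [← NonUnitalStarAlgHom.norm_map (j m) (hj m), map_sub] at hqs
  calc ‖p - j m q‖ = ‖(p - j m (s m)) + (j m (s m) - j m q)‖ := by congr 1; abel
    _ ≤ ‖p - j m (s m)‖ + ‖j m (s m) - j m q‖ := norm_add_le _ _
    _ < 1 := by rw [norm_sub_rev p, norm_sub_rev _ (j m q)]; linarith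

include hj h in
-- Approximants of v, cut down by the images of p and q, satisfy the hypotheses of the polar
-- decomposition lemma in `D m` for large m. The cut-downs still converge to v because p v = v = v
-- q.
theorem exists_partialIsometry {i : ℕ} (t : ∀ m, i ≤ m → D i →⋆ₐ[ℂ] D m)
    (ht : ∀ m hm x, j m (t m hm x) = j i x) {p q : D i} (hp : IsStarProjection p)
    (hq : IsStarProjection q) {v : C} (hv : v * star v = j i p) (hv' : star v * v = j i q) :
    ∃ m, ∃ hm : i ≤ m, ∃ w : D m, w * star w = t m hm p ∧ star w * w = t m hm q := by
  obtain ⟨s, hs⟩ := h v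
  have hp' := hp.map (j i)
  have hq' := hq.map (j i)
  have e1 : j i p * v = v := mul_eq_of_mul_star_eq hp' hv
  have e2 : v * j i q = v := by
    have := mul_eq_of_mul_star_eq (v := star v) hq' (by rw [star_star, hv'])
    rw [← star_star v, ← hq'.isSelfAdjoint.star_eq, ← star_mul, this]
  have hz : Tendsto (fun m => j i p * j m (s m) * j i q) atTop (𝓝 v) := by
    have := (hs.const_mul (j i p)).mul_const (j i q)
    rwa [e1, e2] at this
  have h1 := tendsto_iff_norm_sub_tendsto_zero.mp (hz.mul hz.star)
  have h2 := tendsto_iff_norm_sub_tendsto_zero.mp (hz.star.mul hz)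
  rw [hv] at h1
  rw [hv'] at h2
  obtain ⟨m, ⟨hm1, hm2⟩, hm⟩ := (((h1.eventually_lt_const one_pos).and
    (h2.eventually_lt_const one_pos)).and (eventually_ge_atTop i)).exists
  have hpm := hp.map (t m hm)
  have hqm := hq.map (t m hm)
  refine ⟨m, hm, _root_.exists_partialIsometry (z := t m hm p * s m * t m hm q) hpm hqm ?_ ?_ ?_ ?_⟩
  · rw [← mul_assoc, ← mul_assoc, hpm.isIdempotentElem.eq]
  · rw [mul_assoc, hqm.isIdempotentElem.eq]
  · rw [← NonUnitalStarAlgHom.norm_map (j m) (hj m)]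
    simpa only [map_sub, map_mul, map_star, ht] using hm1
  · rw [← NonUnitalStarAlgHom.norm_map (j m) (hj m)]
    simpa only [map_sub, map_mul, map_star, ht] using hm2

include hj h in
theorem exists_unitary (u : unitary C) :
    ∃ m, ∃ w : unitary (D m), Joined (unitaryHom (j m) w) u := by
  obtain ⟨s, hs⟩ := h u
  have h1 := tendsto_iff_norm_sub_tendsto_zero.mp (hs.star.mul hs)
  have h2 := tendsto_iff_norm_sub_tendsto_zero.mp (hs.mul hs.star)
  have h3 := tendsto_iff_norm_sub_tendsto_zero.mp hs
  rw [Unitary.star_mul_self_of_mem u.2] at h1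
  rw [Unitary.mul_star_self_of_mem u.2] at h2
  obtain ⟨m, ⟨hm1, hm2⟩, hm3⟩ := (((h1.eventually_lt_const (show (0 : ℝ) < 1 / 2 by norm_num)).and
    (h2.eventually_lt_const one_pos)).and
      (h3.eventually_lt_const (show (0 : ℝ) < 1 / 2 by norm_num))).exists
  rw [← map_star, ← map_mul, ← map_one (j m), ← map_sub,
    NonUnitalStarAlgHom.norm_map (j m) (hj m)] at hm1 hm2
  obtain ⟨w, hw⟩ := exists_unitary_near hm1.le hm2
  refine ⟨m, w, joined_of_norm_sub_lt ?_⟩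
  rw [← NonUnitalStarAlgHom.norm_map (j m) (hj m), ← NonUnitalStarAlgHom.norm_map (j m) (hj m) (s m),
    map_sub] at hw
  -- With this, ‖s m‖ ≤ 3/2, so w is within 3/4 of s m, and its image is within 5/4 < 2 of u.
  have hu : ‖(u : C)‖ ≤ 1 := by
    rcases subsingleton_or_nontrivial C with hC | hC
    · simp [Subsingleton.elim (u : C) 0]
    · exact (CStarRing.norm_coe_unitary u).le
  have hsm : ‖j m (s m)‖ ≤ 3 / 2 := by
    calc ‖j m (s m)‖ = ‖(j m (s m) - u) + u‖ := by rw [sub_add_cancel]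
      _ ≤ ‖j m (s m) - u‖ + ‖(u : C)‖ := norm_add_le _ _
      _ ≤ 3 / 2 := by linarith
  calc ‖j m w - u‖ = ‖(j m w - j m (s m)) + (j m (s m) - u)‖ := by congr 1; abel
    _ ≤ ‖j m w - j m (s m)‖ + ‖j m (s m) - u‖ := norm_add_le _ _
    _ < 2 := by linarith

include hj h in
-- A path in C cannot be lifted directly. But the identity component of the unitary group consists
-- of finite products of exponentials of self-adjoint elements. Approximating each exponent from `D
-- m` gives unitaries connected to 1 inside `D m` whose images converge to that of u; once the
-- distance is below 2, they are connected to the image of u in `D m`.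
theorem exists_joined_one {i : ℕ} (t : ∀ m, i ≤ m → D i →⋆ₐ[ℂ] D m)
    (ht : ∀ m hm x, j m (t m hm x) = j i x) {u : unitary (D i)}
    (hu : Joined 1 (unitaryHom (j i) u)) :
    ∃ m, ∃ hm : i ≤ m, Joined 1 (unitaryHom (t m hm) u) := by
  obtain ⟨l, hl⟩ := Unitary.mem_pathComponentOne_iff.mp hu
  have key (l : List (selfAdjoint C)) : ∃ w : ∀ m, unitary (D m), (∀ m, Joined 1 (w m)) ∧
      Tendsto (fun m => unitaryHom (j m) (w m)) atTop (𝓝 (l.map selfAdjoint.expUnitary).prod) := by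
    induction l with
    | nil => exact ⟨fun _ => 1, fun _ => Joined.refl 1, by simp⟩
    | cons a l ih =>
      obtain ⟨w, hw, hwt⟩ := ih
      obtain ⟨s, hs, hst⟩ := h.exists_isSelfAdjoint a.2
      refine ⟨fun m => selfAdjoint.expUnitary ⟨s m, hs m⟩ * w m, fun m => ?_, ?_⟩
      · have := (selfAdjoint.joined_one_expUnitary (⟨s m, hs m⟩ : selfAdjoint (D m))).mul (hw m)
        rwa [mul_one] at this
      · rw [List.map_cons, List.prod_cons]
        simp only [map_mul]
        refine Tendsto.mul ?_ hwt
        have h1 : Tendsto (fun m => (⟨j m (s m), (hs m).map (j m)⟩ : selfAdjoint C)) atTop (𝓝 a) :=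
          tendsto_subtype_rng.mpr hst
        refine ((selfAdjoint.continuous_expUnitary.tendsto a).comp h1).congr fun m => ?_
        refine Subtype.ext ?_
        change NormedSpace.exp (Complex.I • j m (s m)) = j m (NormedSpace.exp (Complex.I • s m))
        rw [← map_smul]
        let _ : NormedAlgebra ℚ (D m) := .restrictScalars ℚ ℂ (D m)
        let _ : NormedAlgebra ℚ C := .restrictScalars ℚ ℂ C
        exact (NormedSpace.map_exp (j m) (continuous_starAlgHom (j m)) _).symm
  obtain ⟨w, hw, hwt⟩ := key l
  rw [hl] at hwt
  have h1 := tendsto_iff_norm_sub_tendsto_zero.mp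
    ((continuous_subtype_val.tendsto (unitaryHom (j i) u)).comp hwt)
  obtain ⟨m, hm1, hm⟩ := ((h1.eventually_lt_const (show (0 : ℝ) < 2 by norm_num)).and
    (eventually_ge_atTop i)).exists
  refine ⟨m, hm, (hw m).trans (joined_of_norm_sub_lt ?_)⟩
  rw [← NonUnitalStarAlgHom.norm_map (j m) (hj m), map_sub]
  change ‖j m (w m) - j m (t m hm u)‖ < 2
  rw [ht]
  exact hm1

end Approximates
end Approximation

/-! ### Passage to matrix algebras. -/

section MatrixMaps

/-- The entrywise ⋆-homomorphism between matrix algebras. -/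
def matrixHom {A B : Type*} [Ring A] [StarRing A] [Algebra ℂ A] [Ring B] [StarRing B]
    [Algebra ℂ B] (n : Type*) [Fintype n] [DecidableEq n] (f : A →⋆ₐ[ℂ] B) :
    Matrix n n A →⋆ₐ[ℂ] Matrix n n B :=
  { f.toAlgHom.mapMatrix with
    map_star' := fun M => by
      ext i j
      simp [Matrix.star_apply, map_star] }

variable {A : Type*} [CStarAlgebra A] {S : ℕ → Type*} [∀ m, CStarAlgebra (S m)]
  {j : ∀ m, S m →⋆ₐ[ℂ] A} {n : Type*} [Fintype n] [DecidableEq n]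

/-- The C⋆-algebra of matrices over a C⋆-algebra. -/
@[reducible]
def matrixCStarAlgebra (n A : Type*) [Fintype n] [DecidableEq n] [CStarAlgebra A] :
    CStarAlgebra (Matrix n n A) :=
  let _ := CStarAlgebra.spectralOrder A
  have := CStarAlgebra.spectralOrderedRing A
  inferInstanceAs (CStarAlgebra (CStarMatrix n n A))

section

attribute [local instance] matrixCStarAlgebra

theorem Approximates.matrixHom (h : Approximates j) :
    Approximates fun m => matrixHom n (j m) := fun M => by
  choose s hs using fun a b => h (M a b)
  refine ⟨fun m => Matrix.of fun a b => s a b m, ?_⟩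
  -- Convergence for the C⋆-norm on matrices is entrywise convergence.
  exact tendsto_pi_nhds.mpr fun a => tendsto_pi_nhds.mpr fun b => hs a b

end

theorem matrixHom_injective {A B : Type*} [Ring A] [StarRing A] [Algebra ℂ A] [Ring B] [StarRing B]
    [Algebra ℂ B] {f : A →⋆ₐ[ℂ] B} (hf : Function.Injective f) :
    Function.Injective (_root_.matrixHom n f) :=
  Matrix.map_injective hf

variable (hj : ∀ m, Function.Injective (j m)) (h : Approximates j)

include hj h in
-- This and the next three results apply the lifting lemmas to matrix algebras. The C⋆-norm is
-- introduced only inside the proofs, so the statements concern plain `Matrix` rings, as the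
-- definitions of the K-groups do.
theorem Approximates.exists_matrix_isStarProjection {p : Matrix n n A} (hp : IsStarProjection p) :
    ∃ m, ∃ q : Matrix n n (S m), IsStarProjection q ∧
      ∃ v : Matrix n n A, v * vᴴ = p ∧ vᴴ * v = q.map (j m) :=
  let _ := matrixCStarAlgebra n A
  let _ := fun m => matrixCStarAlgebra n (S m)
  h.matrixHom.exists_isStarProjection (fun m => matrixHom_injective (hj m)) hp

include hj h in
theorem Approximates.exists_matrix_partialIsometry {i : ℕ} (t : ∀ m, i ≤ m → S i →⋆ₐ[ℂ] S m)
    (ht : ∀ m hm x, j m (t m hm x) = j i x) {p q : Matrix n n (S i)} (hp : IsStarProjection p)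
    (hq : IsStarProjection q) {v : Matrix n n A} (hv : v * vᴴ = p.map (j i))
    (hv' : vᴴ * v = q.map (j i)) :
    ∃ m, ∃ hm : i ≤ m, ∃ w : Matrix n n (S m),
      w * wᴴ = p.map (t m hm) ∧ wᴴ * w = q.map (t m hm) :=
  let _ := matrixCStarAlgebra n A
  let _ := fun m => matrixCStarAlgebra n (S m)
  h.matrixHom.exists_partialIsometry (fun m => matrixHom_injective (hj m))
    (fun m hm => _root_.matrixHom n (t m hm))
    (fun m hm x => Matrix.ext fun a b => ht m hm (x a b)) hp hq hv hv'

include hj h in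
theorem Approximates.exists_matrix_unitary (u : unitary (Matrix n n A)) :
    ∃ m, ∃ w : unitary (Matrix n n (S m)),
      Joined (unitaryHom (_root_.matrixHom n (j m)) w) u :=
  let _ := matrixCStarAlgebra n A
  let _ := fun m => matrixCStarAlgebra n (S m)
  h.matrixHom.exists_unitary (fun m => matrixHom_injective (hj m)) u

include hj h in
theorem Approximates.exists_matrix_joined_one {i : ℕ} (t : ∀ m, i ≤ m → S i →⋆ₐ[ℂ] S m)
    (ht : ∀ m hm x, j m (t m hm x) = j i x) {u : unitary (Matrix n n (S i))}
    (hu : Joined 1 (unitaryHom (_root_.matrixHom n (j i)) u)) :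
    ∃ m, ∃ hm : i ≤ m, Joined 1 (unitaryHom (_root_.matrixHom n (t m hm)) u) :=
  let _ := matrixCStarAlgebra n A
  let _ := fun m => matrixCStarAlgebra n (S m)
  h.matrixHom.exists_joined_one (fun m => matrixHom_injective (hj m))
    (fun m hm => _root_.matrixHom n (t m hm))
    (fun m hm x => Matrix.ext fun a b => ht m hm (x a b)) hu

end MatrixMaps

/-! ### `K`-groups -/

section KZero

variable {A : Type u} {B : Type v} [Ring A] [StarRing A] [Ring B] [StarRing B]
  {k l : Type*} [Fintype k] [DecidableEq k] [Fintype l] [DecidableEq l]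

/-- The class of a projection in a matrix algebra. -/
def projClass {n : ℕ} {p : Matrix (Fin n) (Fin n) A} (hp : IsStarProjection p) : ProjClass A :=
  ⟦⟨n, p, hp⟩⟧

theorem projClass_eq_iff {n m : ℕ} {p : Matrix (Fin n) (Fin n) A} (hp : IsStarProjection p)
    {q : Matrix (Fin m) (Fin m) A} (hq : IsStarProjection q) :
    projClass hp = projClass hq ↔ MvEquiv p q :=
  Quotient.eq (r := MatProj.setoid A)

theorem projClass_induction {P : ProjClass A → Prop}
    (h : ∀ (n : ℕ) (p : Matrix (Fin n) (Fin n) A) (hp : IsStarProjection p), P (projClass hp))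
    (x : ProjClass A) : P x :=
  Quotient.inductionOn x fun p => h p.size p.mat p.isProj

theorem ProjClass.map_projClass [Algebra ℂ A] [Algebra ℂ B] (φ : A →⋆ₐ[ℂ] Matrix k k B) {n : ℕ}
    {p : Matrix (Fin n) (Fin n) A} (hp : IsStarProjection p) :
    ProjClass.map φ (projClass hp) = projClass (ProjClass.inflateFin_equiv (φ := φ) hp) := rfl

theorem mvEquiv_of_submatrix {n m : ℕ} {p : Matrix (Fin n) (Fin n) A}
    {q : Matrix (Fin m) (Fin m) A} (hp : IsStarProjection p) (e : Fin m ≃ Fin n)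
    (h : p.submatrix e e = q) : MvEquiv p q :=
  h ▸ MvEquiv.submatrix hp e

end KZero

/-! ### Block diagonal matrices. -/

section DiagBlocks

variable {R : Type*} [Ring R] {k l m ι κ : Type*}

/-- The block diagonal matrix with equal blocks `W`. -/
def diagBlocks (ι : Type*) [DecidableEq ι] (W : Matrix k l R) : Matrix (ι × k) (ι × l) R :=
  Matrix.of fun x y => if x.1 = y.1 then W x.2 y.2 else 0

variable [DecidableEq ι] [DecidableEq κ]

theorem diagBlocks_mul [Fintype l] [Fintype ι] (W : Matrix k l R) (W' : Matrix l m R) :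
    diagBlocks ι W * diagBlocks ι W' = diagBlocks ι (W * W') := by
  ext ⟨a, b⟩ ⟨c, d⟩
  simp [diagBlocks, Matrix.mul_apply, Fintype.sum_prod_type]

theorem diagBlocks_conjTranspose [StarRing R] (W : Matrix k l R) :
    (diagBlocks ι W)ᴴ = diagBlocks ι Wᴴ := by
  ext ⟨a, b⟩ ⟨c, d⟩
  simp [diagBlocks, apply_ite star, eq_comm]

theorem diagBlocks_one [DecidableEq k] : diagBlocks ι (1 : Matrix k k R) = 1 := by
  ext ⟨a, b⟩ ⟨c, d⟩
  by_cases h : a = c <;> simp [diagBlocks, Matrix.one_apply, h]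

end DiagBlocks

/-! ### Classes of projections: conjugate homomorphisms, composition, bijectivity. -/

section Inflate

variable {A : Type u} {B : Type v} [Ring A] [StarRing A] [Ring B] [StarRing B]
  [Algebra ℂ A] [Algebra ℂ B] {k l : Type*} [Fintype k] [DecidableEq k] [Fintype l] [DecidableEq l]

theorem inflate_mul_diagBlocks {ι κ : Type} [Fintype ι] [DecidableEq ι] [Fintype κ] [DecidableEq κ]
    {φ : A →⋆ₐ[ℂ] Matrix k k B} {ψ : A →⋆ₐ[ℂ] Matrix l l B} {W : Matrix k l B}
    (hW : ∀ a, φ a * W = W * ψ a) (M : Matrix ι κ A) :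
    inflate φ M * diagBlocks κ W = diagBlocks ι W * inflate ψ M := by
  ext ⟨a, b⟩ ⟨c, d⟩
  have h := congrFun (congrFun (hW (M a c)) b) d
  simpa [diagBlocks, inflate, Matrix.mul_apply, Fintype.sum_prod_type] using h

/-- The matrix φ(p)(1 ⊗ W) is a partial isometry from ψ(p) to φ(p). W may be rectangular, so φ and ψ
may have different matrix sizes. -/
theorem ProjClass.map_eq_map_of_conj {φ : A →⋆ₐ[ℂ] Matrix k k B} {ψ : A →⋆ₐ[ℂ] Matrix l l B}
    {W : Matrix k l B} (hW : ∀ a, φ a * W = W * ψ a) (h₁ : W * Wᴴ = 1) (h₂ : Wᴴ * W = 1) :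
    ProjClass.map φ = ProjClass.map ψ := by
  ext x
  induction x using projClass_induction with | _ n p hp
  rw [ProjClass.map_projClass, ProjClass.map_projClass, projClass_eq_iff]
  have hpp : p * p = p := hp.isIdempotentElem
  have hps : pᴴ = p := hp.isSelfAdjoint
  refine ⟨(inflate φ p * diagBlocks (Fin n) W : Matrix (Fin n × k) (Fin n × l) B).submatrix
    (inflateIndex k n) (inflateIndex l n), ?_, ?_⟩
  · rw [Matrix.conjTranspose_submatrix, Matrix.submatrix_mul_equiv, Matrix.conjTranspose_mul,
      ← inflate_conjTranspose, hps, diagBlocks_conjTranspose, Matrix.mul_assoc,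
      ← Matrix.mul_assoc (diagBlocks _ W), diagBlocks_mul, h₁, diagBlocks_one, Matrix.one_mul,
      ← inflate_mul, hpp]
    rfl
  · rw [Matrix.conjTranspose_submatrix, Matrix.submatrix_mul_equiv, inflate_mul_diagBlocks hW,
      Matrix.conjTranspose_mul, ← inflate_conjTranspose, hps, diagBlocks_conjTranspose,
      Matrix.mul_assoc, ← Matrix.mul_assoc (diagBlocks _ Wᴴ), diagBlocks_mul, h₂, diagBlocks_one,
      Matrix.one_mul, ← inflate_mul, hpp]
    rfl

/-- The ⋆-homomorphism `M_k(A) → M_{k × l}(B)` given by a ⋆-homomorphism `A → M_l(B)`. -/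
def inflateHom (k : Type*) [Fintype k] [DecidableEq k] (ψ : A →⋆ₐ[ℂ] Matrix l l B) :
    Matrix k k A →⋆ₐ[ℂ] Matrix (k × l) (k × l) B where
  toFun M := Matrix.of fun x y => ψ (M x.1 y.1) x.2 y.2
  map_one' := by
    ext ⟨a, b⟩ ⟨c, d⟩
    by_cases h : a = c <;> simp [Matrix.one_apply, h]
  map_mul' M N := by
    ext x y
    simp [Matrix.mul_apply, Matrix.sum_apply, Fintype.sum_prod_type]
  map_zero' := by
    ext x y
    simp
  map_add' M N := by
    ext x y
    simp
  commutes' c := by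
    ext ⟨a, b⟩ ⟨c, d⟩
    by_cases h : a = c <;> simp [Matrix.algebraMap_matrix_apply, AlgHomClass.commutes, h]
  map_star' M := by
    ext x y
    simp [Matrix.star_apply, map_star]

theorem inflateHom_apply (ψ : A →⋆ₐ[ℂ] Matrix l l B) (M : Matrix k k A) (x y : k × l) :
    inflateHom k ψ M x y = ψ (M x.1 y.1) x.2 y.2 := rfl

/-- The identification of the index sets of `M_l(M_k(M_n(C)))` and `M_{k × l}(M_n(C))`. -/
def inflateAssoc (k l : Type*) [Fintype k] [Fintype l] (n : ℕ) :
    Fin (n * Fintype.card (k × l)) ≃ Fin (n * Fintype.card k * Fintype.card l) :=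
  (inflateIndex (k × l) n).trans ((Equiv.prodAssoc (Fin n) k l).symm.trans
    (((inflateIndex k n).symm.prodCongr (Equiv.refl l)).trans
      (inflateIndex l (n * Fintype.card k)).symm))

/-- Iterated amplification is a single amplification by `k × l` up to a permutation of the indices,
which neither K₀ nor K₁ sees. -/
theorem inflateFin_inflateFin {C : Type*} [Ring C] [StarRing C] [Algebra ℂ C]
    (φ : A →⋆ₐ[ℂ] Matrix k k B) (ψ : B →⋆ₐ[ℂ] Matrix l l C) (n : ℕ)
    (M : Matrix (Fin n) (Fin n) A) :
    (inflateFin ψ _ (inflateFin φ n M)).submatrix (inflateAssoc k l n) (inflateAssoc k l n) =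
      inflateFin ((inflateHom k ψ).comp φ) n M := by
  ext x y
  simp [inflateFin, inflate, inflateAssoc, inflateHom_apply]

theorem ProjClass.map_map {C : Type*} [Ring C] [StarRing C] [Algebra ℂ C]
    (φ : A →⋆ₐ[ℂ] Matrix k k B) (ψ : B →⋆ₐ[ℂ] Matrix l l C) (x : ProjClass A) :
    ProjClass.map ψ (ProjClass.map φ x) = ProjClass.map ((inflateHom k ψ).comp φ) x := by
  induction x using projClass_induction with | _ n p hp
  simp only [ProjClass.map_projClass]
  rw [projClass_eq_iff]
  exact mvEquiv_of_submatrix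
    (ProjClass.inflateFin_equiv (φ := ψ) (ProjClass.inflateFin_equiv (φ := φ) hp))
    (inflateAssoc k l n) (inflateFin_inflateFin φ ψ n p)

section Bijective

variable {φ : A →⋆ₐ[ℂ] Matrix k k B} (hφ : Function.Bijective φ)

include hφ in
theorem inflate_bijective (ι κ : Type) :
    Function.Bijective (inflate φ : Matrix ι κ A → Matrix (ι × k) (κ × k) B) := by
  refine ⟨fun M N h => ?_, fun M => ?_⟩
  · ext a b
    refine hφ.1 (Matrix.ext fun c d => ?_)
    exact congrFun (congrFun h (a, c)) (b, d)
  · choose g hg using hφ.2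
    refine ⟨Matrix.of fun a b => g (Matrix.of fun c d => M (a, c) (b, d)), ?_⟩
    ext x y
    simp [inflate, hg]

include hφ in
theorem inflateFin_bijective (n : ℕ) : Function.Bijective (inflateFin φ n) :=
  (Matrix.reindex (inflateIndex k n).symm (inflateIndex k n).symm).bijective.comp
    (inflate_bijective hφ (Fin n) (Fin n))

include hφ in
theorem isStarProjection_of_inflateFin {n : ℕ} {p : Matrix (Fin n) (Fin n) A}
    (hp : IsStarProjection (inflateFin φ n p)) : IsStarProjection p where
  isIdempotentElem := (inflateFin_bijective hφ n).1 <| by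
    rw [inflateFin_mul, hp.isIdempotentElem.eq]
  isSelfAdjoint := (inflateFin_bijective hφ n).1 <| by
    rw [inflateFin_star, hp.isSelfAdjoint.star_eq]

include hφ in
-- Injectivity: a partial isometry between φ(p) and φ(q) is pulled back block by block.
-- Surjectivity: a projection p over B is equivalent to p placed in one diagonal corner of
-- M_n(M_k(B)), and that matrix is in the range of the amplified φ.
theorem ProjClass.map_bijective [Nonempty k] : Function.Bijective (ProjClass.map φ) := by
  constructor
  · intro x y h
    induction x using projClass_induction with | _ n p hp
    induction y using projClass_induction with | _ m q hq
    rw [ProjClass.map_projClass, ProjClass.map_projClass, projClass_eq_iff] at h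
    obtain ⟨v, hv, hv'⟩ := h
    obtain ⟨w, hw⟩ := (inflate_bijective hφ (Fin n) (Fin m)).2
      (v.submatrix (inflateIndex k n).symm (inflateIndex k m).symm)
    rw [projClass_eq_iff]
    refine ⟨w, (inflate_bijective hφ _ _).1 ?_, (inflate_bijective hφ _ _).1 ?_⟩
    · rw [inflate_mul, inflate_conjTranspose, hw, Matrix.conjTranspose_submatrix,
        Matrix.submatrix_mul_equiv, hv]
      ext x y
      simp [inflateFin]
    · rw [inflate_mul, inflate_conjTranspose, hw, Matrix.conjTranspose_submatrix,
        Matrix.submatrix_mul_equiv, hv']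
      ext x y
      simp [inflateFin]
  · intro x
    induction x using projClass_induction with | _ n p hp
    have c₀ : k := Classical.arbitrary k
    -- Here v⋆ v = p, while v v⋆ is p in the corner of index `c₀`.
    let v : Matrix (Fin n × k) (Fin n) B := Matrix.of fun x j => if x.2 = c₀ then p x.1 j else 0
    have hpp : p * p = p := hp.isIdempotentElem
    have hps : pᴴ = p := hp.isSelfAdjoint
    have hv : vᴴ * v = p := by
      conv_rhs => rw [← hpp]
      conv_rhs => lhs; rw [← hps]
      ext a b
      simp [v, Matrix.mul_apply, Fintype.sum_prod_type, apply_ite star]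
    let w := v.submatrix (inflateIndex k n) id
    have hw : wᴴ * w = p := by
      rw [Matrix.conjTranspose_submatrix, Matrix.submatrix_mul_equiv, hv, Matrix.submatrix_id_id]
    have hwp : w * p = w := by
      have : v * p = v := by
        ext x b
        by_cases hx : x.2 = c₀
        · have := congrFun (congrFun hpp x.1) b
          simpa [v, hx, Matrix.mul_apply] using this
        · simp [v, hx, Matrix.mul_apply]
      rw [← Matrix.submatrix_id_id p]
      exact (Matrix.submatrix_mul_equiv v p _ (Equiv.refl _) _).trans (by rw [this])
    have hproj : IsStarProjection (w * wᴴ) := ⟨by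
      rw [IsIdempotentElem, Matrix.mul_assoc, ← Matrix.mul_assoc wᴴ, hw, ← Matrix.mul_assoc, hwp],
      by rw [IsSelfAdjoint, Matrix.star_eq_conjTranspose, Matrix.conjTranspose_mul,
        Matrix.conjTranspose_conjTranspose]⟩
    obtain ⟨q, hq⟩ := (inflateFin_bijective hφ n).2 (w * wᴴ)
    refine ⟨projClass (isStarProjection_of_inflateFin hφ (hq ▸ hproj)), ?_⟩
    rw [ProjClass.map_projClass, projClass_eq_iff, hq]
    exact ⟨w, rfl, hw⟩

end Bijective

end Inflate

/-! ### Classes of unitaries: conjugation, composition, bijectivity. -/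

section KOne

variable {A : Type u} {B : Type v} [CStarAlgebra A] [CStarAlgebra B]

/-- The class of a unitary in a matrix algebra. -/
def unitaryClass {n : ℕ} (u : MatUnitary A n) : KOne A :=
  Additive.ofMul ⟦⟨n, QuotientGroup.mk u⟩⟧

theorem unitaryClass_induction {P : KOne A → Prop}
    (h : ∀ (n : ℕ) (u : MatUnitary A n), P (unitaryClass u)) (x : KOne A) : P x := by
  induction x using Additive.rec with | _ x
  induction x using DirectLimit.induction with | _ n x
  induction x using QuotientGroup.induction_on with | _ u
  exact h n u

theorem unitaryClass_mul {n : ℕ} (u w : MatUnitary A n) :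
    unitaryClass (u * w) = unitaryClass u + unitaryClass w :=
  congrArg Additive.ofMul (DirectLimit.mul_def (f := classPad) n
    (QuotientGroup.mk u : UnitaryClass A n) (QuotientGroup.mk w)).symm

theorem unitaryClass_pad {n m : ℕ} (h : n ≤ m) (u : MatUnitary A n) :
    unitaryClass (unitaryPad h u) = unitaryClass u :=
  congrArg Additive.ofMul (DirectLimit.mk_apply (f := classPad) n m (QuotientGroup.mk u) h)

theorem unitaryClass_eq_zero_iff {n : ℕ} (u : MatUnitary A n) :
    unitaryClass u = 0 ↔ ∃ m, ∃ h : n ≤ m, Joined 1 (unitaryPad h u) := by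
  refine (DirectLimit.exists_eq_one (f := classPad)
    (⟨n, QuotientGroup.mk u⟩ : Σ n, UnitaryClass A n)).trans ?_
  refine exists_congr fun m => exists_congr fun h => ?_
  exact QuotientGroup.eq_one_iff (N := unitaryNull A m) (unitaryPad h u)

theorem unitaryClass_eq_of_joined {n : ℕ} {u w : MatUnitary A n} (h : Joined u w) :
    unitaryClass u = unitaryClass w := by
  have h1 : unitaryClass (u⁻¹ * w) = 0 := (unitaryClass_eq_zero_iff _).mpr
    ⟨n, le_rfl, by
      have h2 := (Joined.mul (Joined.refl u⁻¹) h).map (continuous_unitaryPad (A := A) (le_refl n))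
      rwa [inv_mul_cancel, map_one] at h2⟩
  rw [← add_zero (unitaryClass u), ← h1, ← unitaryClass_mul, mul_inv_cancel_left]

/-- Once the sizes agree, w is itself a unitary with a class in K₁, and it cancels because K₁ is
commutative. -/
theorem unitaryClass_eq_of_conj {n m : ℕ} (hnm : n = m) {u : MatUnitary A n} {u' : MatUnitary A m}
    {w : Matrix (Fin n) (Fin m) A} (h₁ : w * wᴴ = 1) (h₂ : wᴴ * w = 1) (h : u.1 * w = w * u'.1) :
    unitaryClass u = unitaryClass u' := by
  subst hnm
  let w' : MatUnitary A n := ⟨w, Unitary.mem_iff.mpr ⟨h₂, h₁⟩⟩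
  have h3 : u * w' = w' * u' := Subtype.ext h
  have h4 := congrArg unitaryClass h3
  rw [unitaryClass_mul, unitaryClass_mul, add_comm] at h4
  exact add_left_cancel h4

theorem unitaryClass_eq_of_submatrix {n m : ℕ} {u : MatUnitary A n} {u' : MatUnitary A m}
    (e : Fin m ≃ Fin n) (h : u.1.submatrix e e = u'.1) : unitaryClass u = unitaryClass u' := by
  refine unitaryClass_eq_of_conj (w := (1 : Matrix (Fin n) (Fin n) A).submatrix id e)
    (Fin.equiv_iff_eq.mp ⟨e⟩).symm ?_ ?_ ?_
  · rw [Matrix.conjTranspose_submatrix, Matrix.submatrix_mul_equiv, Matrix.conjTranspose_one,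
      Matrix.one_mul, Matrix.submatrix_id_id]
  · rw [Matrix.conjTranspose_submatrix, ← Matrix.submatrix_mul _ _ _ _ _ Function.bijective_id,
      Matrix.conjTranspose_one, Matrix.one_mul, Matrix.submatrix_one_equiv]
  · rw [← h, Matrix.submatrix_mul_equiv, Matrix.one_mul]
    ext a b
    simp [Matrix.mul_apply, Matrix.one_apply]

variable {k l : Type*} [Fintype k] [DecidableEq k] [Fintype l] [DecidableEq l]

theorem KOne.map_unitaryClass (φ : A →⋆ₐ[ℂ] Matrix k k B) {n : ℕ} (u : MatUnitary A n) :
    KOne.map φ (unitaryClass u) = unitaryClass (unitaryInflate φ n u) := rfl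

/-- The equality of cardinalities is a genuine assumption in this argument: over a general
C⋆-algebra a unitary rectangular matrix need not be square, and only a square one has a class in K₁.
-/
theorem KOne.map_eq_map_of_conj {φ : A →⋆ₐ[ℂ] Matrix k k B} {ψ : A →⋆ₐ[ℂ] Matrix l l B}
    (hkl : Fintype.card k = Fintype.card l) {W : Matrix k l B} (hW : ∀ a, φ a * W = W * ψ a)
    (h₁ : W * Wᴴ = 1) (h₂ : Wᴴ * W = 1) : KOne.map φ = KOne.map ψ := by
  refine AddMonoidHom.ext fun x => ?_
  induction x using unitaryClass_induction with | _ n u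
  rw [KOne.map_unitaryClass, KOne.map_unitaryClass]
  refine unitaryClass_eq_of_conj (by rw [hkl])
    (w := (diagBlocks (Fin n) W).submatrix (inflateIndex k n) (inflateIndex l n)) ?_ ?_ ?_
  · rw [Matrix.conjTranspose_submatrix, Matrix.submatrix_mul_equiv, diagBlocks_conjTranspose,
      diagBlocks_mul, h₁, diagBlocks_one, Matrix.submatrix_one_equiv]
  · rw [Matrix.conjTranspose_submatrix, Matrix.submatrix_mul_equiv, diagBlocks_conjTranspose,
      diagBlocks_mul, h₂, diagBlocks_one, Matrix.submatrix_one_equiv]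
  · change (inflate φ u.1).submatrix _ _ * _ = _ * (inflate ψ u.1).submatrix _ _
    rw [Matrix.submatrix_mul_equiv, Matrix.submatrix_mul_equiv, inflate_mul_diagBlocks hW]

theorem KOne.map_map {C : Type*} [CStarAlgebra C] (φ : A →⋆ₐ[ℂ] Matrix k k B)
    (ψ : B →⋆ₐ[ℂ] Matrix l l C) (x : KOne A) :
    KOne.map ψ (KOne.map φ x) = KOne.map ((inflateHom k ψ).comp φ) x := by
  induction x using unitaryClass_induction with | _ n u
  simp only [KOne.map_unitaryClass]
  exact unitaryClass_eq_of_submatrix (inflateAssoc k l n) (inflateFin_inflateFin φ ψ n u.1)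

section Bijective

variable {φ : A →⋆ₐ[ℂ] Matrix k k B} (hφ : Function.Bijective φ)

include hφ in
-- The inverse of a bijective ⋆-homomorphism is a ⋆-homomorphism, hence continuous. Continuity is
-- what allows homotopies of unitaries to be pulled back.
theorem exists_continuous_inverse_unitaryInflate (n : ℕ) :
    ∃ g : MatUnitary B (n * Fintype.card k) → MatUnitary A n, Continuous g ∧
      (∀ u, g (unitaryInflate φ n u) = u) ∧ ∀ u, unitaryInflate φ n (g u) = u := by
  let e := StarAlgEquiv.ofBijective φ hφ
  let F := Equiv.ofBijective _ (inflateFin_bijective hφ n)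
  have hF (M) : inflateFin φ n (F.symm M) = M := F.apply_symm_apply M
  have hF' (M) : F.symm (inflateFin φ n M) = M := F.symm_apply_apply M
  have hmem (u : MatUnitary B (n * Fintype.card k)) :
      F.symm u.1 ∈ unitary (Matrix (Fin n) (Fin n) A) := by
    rw [Unitary.mem_iff]
    constructor <;> refine (inflateFin_bijective hφ n).1 ?_
    · rw [inflateFin_mul, inflateFin_star, hF, inflateFin_one, Unitary.star_mul_self_of_mem u.2]
    · rw [inflateFin_mul, inflateFin_star, hF, inflateFin_one, Unitary.mul_star_self_of_mem u.2]
  refine ⟨fun u => ⟨F.symm u.1, hmem u⟩, Continuous.subtype_mk ?_ _,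
    fun u => Subtype.ext (hF' u.1), fun u => Subtype.ext (hF u.1)⟩
  have he : Continuous e.symm := by
    let _ := matrixCStarAlgebra k B
    exact continuous_starAlgHom (e.symm : Matrix k k B →⋆ₐ[ℂ] A)
  have hFs (M : Matrix (Fin (n * Fintype.card k)) (Fin (n * Fintype.card k)) B) :
      F.symm M = Matrix.of fun a b => e.symm (Matrix.of fun c d =>
        M ((inflateIndex k n).symm (a, c)) ((inflateIndex k n).symm (b, d))) := by
    rw [Equiv.symm_apply_eq]
    ext x y
    have (N : Matrix k k B) : φ (e.symm N) = N := e.apply_symm_apply N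
    change _ = inflateFin φ n _ x y
    simp [inflateFin, inflate, this]
  simp only [hFs]
  refine continuous_matrix fun a b => he.comp (continuous_matrix fun c d => ?_)
  exact continuous_subtype_val.matrix_elem _ _

include hφ in
theorem KOne.map_bijective [Nonempty k] : Function.Bijective (KOne.map φ) := by
  have hle (n : ℕ) : n ≤ n * Fintype.card k := Nat.le_mul_of_pos_right n Fintype.card_pos
  constructor
  · rw [injective_iff_map_eq_zero]
    intro x hx
    induction x using unitaryClass_induction with | _ n u
    rw [KOne.map_unitaryClass, unitaryClass_eq_zero_iff] at hx
    obtain ⟨m, hm, h⟩ := hx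
    have hnm : n ≤ m := (hle n).trans hm
    rw [unitaryClass_eq_zero_iff]
    refine ⟨m, hnm, ?_⟩
    -- The null homotopy lives in size m, which need not be a multiple of |k|. Padding it to size m
    -- |k| brings it to the range of the amplified φ.
    have h1 := h.map (continuous_unitaryPad (A := B) (hle m))
    have h2 : unitaryPad (hle m) (unitaryPad hm (unitaryInflate φ n u)) =
        unitaryInflate φ m (unitaryPad hnm u) := by
      rw [unitaryInflate_pad]
      refine Subtype.ext ?_
      ext i j
      simp only [unitaryPad, padMat, Matrix.of_apply, MonoidHom.coe_mk, OneHom.coe_mk, Fin.ext_iff]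
      split_ifs <;> first | rfl | omega
    obtain ⟨g, hg, hg1, -⟩ := exists_continuous_inverse_unitaryInflate hφ m
    have h3 := h1.map hg
    rwa [h2, hg1, map_one, ← map_one (unitaryInflate φ m), hg1] at h3
  · intro y
    induction y using unitaryClass_induction with | _ n u
    obtain ⟨g, -, -, hg⟩ := exists_continuous_inverse_unitaryInflate hφ n
    exact ⟨unitaryClass (g (unitaryPad (hle n) u)), by
      rw [KOne.map_unitaryClass, hg, unitaryClass_pad]⟩

end Bijective

end KOne

/-! ### Elements and homomorphisms of Grothendieck groups. -/

section GrothendieckGroup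

variable {M N : Type*} [AddCommMonoid M] [AddCommMonoid N]

open Algebra (GrothendieckAddGroup)

theorem grothendieck_exists_sub (z : GrothendieckAddGroup M) :
    ∃ x y : M, z = GrothendieckAddGroup.of x - GrothendieckAddGroup.of y := by
  obtain ⟨⟨x, y⟩, h⟩ := (AddLocalization.addMonoidOf (⊤ : AddSubmonoid M)).surj z
  exact ⟨x, y, eq_sub_of_add_eq h⟩

theorem grothendieck_of_eq_iff {x y : M} :
    (GrothendieckAddGroup.of x : GrothendieckAddGroup M) = GrothendieckAddGroup.of y ↔
      ∃ c, c + x = c + y :=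
  ((AddLocalization.addMonoidOf (⊤ : AddSubmonoid M)).eq_iff_exists).trans
    ⟨fun ⟨c, hc⟩ => ⟨c, hc⟩, fun ⟨c, hc⟩ => ⟨⟨c, trivial⟩, hc⟩⟩

theorem grothendieck_lift_of (f : M →+ N) (x : M) :
    GrothendieckAddGroup.lift (GrothendieckAddGroup.of.comp f) (GrothendieckAddGroup.of x) =
      (GrothendieckAddGroup.of (f x) : GrothendieckAddGroup N) :=
  congrFun (congrArg DFunLike.coe
    (GrothendieckAddGroup.lift.symm_apply_apply (GrothendieckAddGroup.of.comp f))) x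

theorem grothendieck_hom_ext {G : Type*} [AddCommGroup G] {f g : GrothendieckAddGroup M →+ G}
    (h : ∀ x, f (GrothendieckAddGroup.of x) = g (GrothendieckAddGroup.of x)) : f = g :=
  GrothendieckAddGroup.lift.symm.injective (AddMonoidHom.ext h)

end GrothendieckGroup

/-! ### Induced maps on K₀. -/

section KZeroMaps

variable {A : Type*} {B : Type*} [Ring A] [StarRing A] [Ring B] [StarRing B]
  [Algebra ℂ A] [Algebra ℂ B] {k l : Type*} [Fintype k] [DecidableEq k] [Fintype l] [DecidableEq l]

theorem KZero.map_of (φ : A →⋆ₐ[ℂ] Matrix k k B) (x : ProjClass A) :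
    KZero.map φ (Algebra.GrothendieckAddGroup.of x) =
      Algebra.GrothendieckAddGroup.of (ProjClass.map φ x) :=
  grothendieck_lift_of _ x

theorem KZero.map_eq_map_of_conj {φ : A →⋆ₐ[ℂ] Matrix k k B} {ψ : A →⋆ₐ[ℂ] Matrix l l B}
    {W : Matrix k l B} (hW : ∀ a, φ a * W = W * ψ a) (h₁ : W * Wᴴ = 1) (h₂ : Wᴴ * W = 1) :
    KZero.map φ = KZero.map ψ := by
  rw [KZero.map, ProjClass.map_eq_map_of_conj hW h₁ h₂, KZero.map]

theorem KZero.map_map {C : Type*} [Ring C] [StarRing C] [Algebra ℂ C]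
    (φ : A →⋆ₐ[ℂ] Matrix k k B) (ψ : B →⋆ₐ[ℂ] Matrix l l C) (x : KZero A) :
    KZero.map ψ (KZero.map φ x) = KZero.map ((inflateHom k ψ).comp φ) x := by
  have : (KZero.map ψ).comp (KZero.map φ) = KZero.map ((inflateHom k ψ).comp φ) :=
    grothendieck_hom_ext fun x => by
      simp only [AddMonoidHom.comp_apply, KZero.map_of, ProjClass.map_map]
  exact congrFun (congrArg DFunLike.coe this) x

theorem KZero.map_bijective {φ : A →⋆ₐ[ℂ] Matrix k k B} (hφ : Function.Bijective φ) [Nonempty k] :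
    Function.Bijective (KZero.map φ) := by
  have hb := ProjClass.map_bijective hφ
  constructor
  · rw [injective_iff_map_eq_zero]
    intro z hz
    obtain ⟨x, y, rfl⟩ := grothendieck_exists_sub z
    rw [map_sub, sub_eq_zero, KZero.map_of, KZero.map_of, grothendieck_of_eq_iff] at hz
    obtain ⟨c, hc⟩ := hz
    obtain ⟨c, rfl⟩ := hb.2 c
    rw [← map_add, ← map_add] at hc
    rw [sub_eq_zero, grothendieck_of_eq_iff]
    exact ⟨c, hb.1 hc⟩
  · intro z
    obtain ⟨x, y, rfl⟩ := grothendieck_exists_sub z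
    obtain ⟨x, rfl⟩ := hb.2 x
    obtain ⟨y, rfl⟩ := hb.2 y
    exact ⟨.of x - .of y, by rw [map_sub, KZero.map_of, KZero.map_of]⟩

end KZeroMaps

/-! ### Plain ⋆-homomorphisms as homomorphisms into matrices of size one. -/

section UnitHom

variable {A : Type*} {B : Type*} [Ring A] [StarRing A] [Ring B] [StarRing B]
  [Algebra ℂ A] [Algebra ℂ B]

/-- A ⋆-homomorphism `A → B` as a ⋆-homomorphism `A → M_1(B)`. -/
def unitHom (f : A →⋆ₐ[ℂ] B) : A →⋆ₐ[ℂ] Matrix Unit Unit B where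
  toFun a := Matrix.of fun _ _ => f a
  map_one' := by
    ext
    simp
  map_mul' a b := by
    ext
    simp [Matrix.mul_apply]
  map_zero' := by
    ext
    simp
  map_add' a b := by
    ext
    simp
  commutes' c := by
    ext
    simp [Matrix.algebraMap_matrix_apply, AlgHomClass.commutes]
  map_star' a := by
    ext
    simp [Matrix.star_apply, map_star]

theorem unitHom_apply (f : A →⋆ₐ[ℂ] B) (a : A) (x y : Unit) : unitHom f a x y = f a := rfl

theorem inflateFin_unitHom (f : A →⋆ₐ[ℂ] B) (n : ℕ) (M : Matrix (Fin n) (Fin n) A) :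
    ∃ e : Fin n ≃ Fin (n * Fintype.card Unit),
      (inflateFin (unitHom f) n M).submatrix e e = M.map f := by
  -- The sizes `n * Fintype.card Unit` and `n` are matched by a bijection of index sets, avoiding a
  -- cast.
  let E := (inflateIndex Unit n).trans (Equiv.prodPUnit (Fin n))
  have hE (a : Fin n) : (inflateIndex Unit n (E.symm a)).1 = a := E.apply_symm_apply a
  refine ⟨E.symm, ?_⟩
  ext a b
  change f (M _ _) = f (M a b)
  rw [hE, hE]

theorem ProjClass.map_unitHom (f : A →⋆ₐ[ℂ] B) {n : ℕ} {p : Matrix (Fin n) (Fin n) A}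
    (hp : IsStarProjection p) :
    ProjClass.map (unitHom f) (projClass hp) = projClass (hp.map (matrixHom (Fin n) f)) := by
  obtain ⟨e, he⟩ := inflateFin_unitHom f n p
  rw [ProjClass.map_projClass, projClass_eq_iff]
  exact mvEquiv_of_submatrix (ProjClass.inflateFin_equiv (φ := unitHom f) hp) e he

theorem KOne.map_unitHom {A B : Type*} [CStarAlgebra A] [CStarAlgebra B] (f : A →⋆ₐ[ℂ] B) {n : ℕ}
    (u : MatUnitary A n) :
    KOne.map (unitHom f) (unitaryClass u) = unitaryClass (unitaryHom (matrixHom (Fin n) f) u) := by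
  obtain ⟨e, he⟩ := inflateFin_unitHom f n u.1
  rw [KOne.map_unitaryClass]
  exact unitaryClass_eq_of_submatrix e he

theorem ProjClass.map_unitHom_comp {C : Type*} [Ring C] [StarRing C] [Algebra ℂ C]
    {f : A →⋆ₐ[ℂ] B} {g : B →⋆ₐ[ℂ] C} {h : A →⋆ₐ[ℂ] C} (hc : ∀ a, g (f a) = h a)
    (x : ProjClass A) :
    ProjClass.map (unitHom g) (ProjClass.map (unitHom f) x) = ProjClass.map (unitHom h) x := by
  induction x using projClass_induction with | _ n p hp
  simp only [ProjClass.map_unitHom]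
  congr 1
  exact Matrix.ext fun a b => hc (p a b)

theorem KZero.map_unitHom_comp {C : Type*} [Ring C] [StarRing C] [Algebra ℂ C]
    {f : A →⋆ₐ[ℂ] B} {g : B →⋆ₐ[ℂ] C} {h : A →⋆ₐ[ℂ] C} (hc : ∀ a, g (f a) = h a) (x : KZero A) :
    KZero.map (unitHom g) (KZero.map (unitHom f) x) = KZero.map (unitHom h) x := by
  obtain ⟨x, y, rfl⟩ := grothendieck_exists_sub x
  simp only [map_sub, KZero.map_of, ProjClass.map_unitHom_comp hc]

theorem KOne.map_unitHom_comp {A B C : Type*} [CStarAlgebra A] [CStarAlgebra B] [CStarAlgebra C]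
    {f : A →⋆ₐ[ℂ] B} {g : B →⋆ₐ[ℂ] C} {h : A →⋆ₐ[ℂ] C} (hc : ∀ a, g (f a) = h a) (x : KOne A) :
    KOne.map (unitHom g) (KOne.map (unitHom f) x) = KOne.map (unitHom h) x := by
  induction x using unitaryClass_induction with | _ n u
  simp only [KOne.map_unitHom]
  congr 1
  exact Subtype.ext (Matrix.ext fun a b => hc (u.1 a b))

end UnitHom

/-! ### Representatives of a common size. -/

section CommonSize

variable {A : Type*} [Ring A] [StarRing A]

/-- Replace p by p ⊕ 0 and q by 0 ⊕ q. An equivalence between matrices of one size is implemented by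
a square matrix, hence by an element of a C⋆-algebra, to which the lifting lemmas apply. -/
theorem exists_projClass_pair (x y : ProjClass A) :
    ∃ (n : ℕ) (p q : Matrix (Fin n) (Fin n) A) (hp : IsStarProjection p) (hq : IsStarProjection q),
      x = projClass hp ∧ y = projClass hq := by
  induction x using projClass_induction with | _ n p hp
  induction y using projClass_induction with | _ m q hq
  have hpp : p * p = p := hp.isIdempotentElem
  have hps : pᴴ = p := hp.isSelfAdjoint
  have hqq : q * q = q := hq.isIdempotentElem
  have hqs : qᴴ = q := hq.isSelfAdjoint
  have h₁ : MvEquiv p (Matrix.fromBlocks p 0 0 (0 : Matrix (Fin m) (Fin m) A)) := by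
    refine ⟨Matrix.fromCols p 0, ?_, ?_⟩
    · rw [Matrix.conjTranspose_fromCols_eq_fromRows_conjTranspose, Matrix.fromCols_mul_fromRows]
      simp [hps, hpp]
    · rw [Matrix.conjTranspose_fromCols_eq_fromRows_conjTranspose, Matrix.fromRows_mul_fromCols]
      simp [hps, hpp]
  have h₂ : MvEquiv q (Matrix.fromBlocks (0 : Matrix (Fin n) (Fin n) A) 0 0 q) := by
    refine ⟨Matrix.fromCols 0 q, ?_, ?_⟩
    · rw [Matrix.conjTranspose_fromCols_eq_fromRows_conjTranspose, Matrix.fromCols_mul_fromRows]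
      simp [hqs, hqq]
    · rw [Matrix.conjTranspose_fromCols_eq_fromRows_conjTranspose, Matrix.fromRows_mul_fromCols]
      simp [hqs, hqq]
  have h₀ (a : ℕ) : IsStarProjection (0 : Matrix (Fin a) (Fin a) A) := .zero _
  refine ⟨n + m, _, _, (MatProj.add ⟨n, p, hp⟩ ⟨m, 0, h₀ m⟩).isProj,
    (MatProj.add ⟨n, 0, h₀ n⟩ ⟨m, q, hq⟩).isProj, ?_, ?_⟩
  · refine (projClass_eq_iff _ _).mpr ?_
    exact h₁.trans hp (MatProj.isProj _) (MatProj.mat_add_equiv ⟨n, p, hp⟩ ⟨m, 0, h₀ m⟩).symm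
  · refine (projClass_eq_iff _ _).mpr ?_
    exact h₂.trans hq (MatProj.isProj _) (MatProj.mat_add_equiv ⟨n, 0, h₀ n⟩ ⟨m, q, hq⟩).symm

end CommonSize

/-! ### Continuity of K₀ and K₁. -/

section Continuity

variable {A : Type*} [CStarAlgebra A] {S : ℕ → Type*} [∀ m, CStarAlgebra (S m)]
  {j : ∀ m, S m →⋆ₐ[ℂ] A} (hj : ∀ m, Function.Injective (j m)) (h : Approximates j)
  (t : ∀ i m, i ≤ m → S i →⋆ₐ[ℂ] S m) (ht : ∀ i m hm x, j m (t i m hm x) = j i x)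

include hj ht in
theorem transition_comp {i m l : ℕ} (him : i ≤ m) (hml : m ≤ l) (x : S i) :
    t m l hml (t i m him x) = t i l (him.trans hml) x :=
  hj l (by rw [ht, ht, ht])

include hj h in
theorem ProjClass.exists_map_unitHom (x : ProjClass A) :
    ∃ m, ∃ y : ProjClass (S m), ProjClass.map (unitHom (j m)) y = x := by
  induction x using projClass_induction with | _ n p hp
  obtain ⟨m, q, hq, v, hv, hv'⟩ := h.exists_matrix_isStarProjection hj hp
  refine ⟨m, projClass hq, ?_⟩
  rw [ProjClass.map_unitHom, projClass_eq_iff]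
  exact MvEquiv.symm ⟨v, hv, hv'⟩

include hj h ht in
theorem ProjClass.exists_map_eq_map {i : ℕ} {x y : ProjClass (S i)}
    (hxy : ProjClass.map (unitHom (j i)) x = ProjClass.map (unitHom (j i)) y) :
    ∃ m, ∃ hm : i ≤ m,
      ProjClass.map (unitHom (t i m hm)) x = ProjClass.map (unitHom (t i m hm)) y := by
  obtain ⟨n, p, q, hp, hq, rfl, rfl⟩ := exists_projClass_pair x y
  rw [ProjClass.map_unitHom, ProjClass.map_unitHom, projClass_eq_iff] at hxy
  obtain ⟨v, hv, hv'⟩ := hxy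
  obtain ⟨m, hm, w, hw, hw'⟩ :=
    h.exists_matrix_partialIsometry hj (t i) (ht i) hp hq hv hv'
  refine ⟨m, hm, ?_⟩
  rw [ProjClass.map_unitHom, ProjClass.map_unitHom, projClass_eq_iff]
  exact ⟨w, hw, hw'⟩

include hj h t ht in
theorem KZero.exists_map_unitHom (z : KZero A) :
    ∃ m, ∃ y : KZero (S m), KZero.map (unitHom (j m)) y = z := by
  obtain ⟨x, y, rfl⟩ := grothendieck_exists_sub z
  obtain ⟨m, x, rfl⟩ := ProjClass.exists_map_unitHom hj h x
  obtain ⟨l, y, rfl⟩ := ProjClass.exists_map_unitHom hj h y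
  refine ⟨max m l, .of (ProjClass.map (unitHom (t m _ (le_max_left m l))) x) -
    .of (ProjClass.map (unitHom (t l _ (le_max_right m l))) y), ?_⟩
  rw [map_sub, KZero.map_of, KZero.map_of, ProjClass.map_unitHom_comp (ht _ _ _),
    ProjClass.map_unitHom_comp (ht _ _ _)]

include hj h ht in
-- Vanishing in the Grothendieck group means c + x = c + y for some c over A. As c also comes from a
-- stage, everything moves to a common stage, and the equality of classes then holds at a later one.
theorem KZero.exists_map_eq_zero {i : ℕ} {z : KZero (S i)} (hz : KZero.map (unitHom (j i)) z = 0) :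
    ∃ m, ∃ hm : i ≤ m, KZero.map (unitHom (t i m hm)) z = 0 := by
  obtain ⟨x, y, rfl⟩ := grothendieck_exists_sub z
  rw [map_sub, sub_eq_zero, KZero.map_of, KZero.map_of, grothendieck_of_eq_iff] at hz
  obtain ⟨c, hc⟩ := hz
  obtain ⟨l, c, rfl⟩ := ProjClass.exists_map_unitHom hj h c
  have hi := le_max_left i l
  have hl := le_max_right i l
  rw [← ProjClass.map_unitHom_comp (ht i _ hi), ← ProjClass.map_unitHom_comp (ht i _ hi),
    ← ProjClass.map_unitHom_comp (ht l _ hl), ← map_add, ← map_add] at hc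
  obtain ⟨m, hm, hxy⟩ := ProjClass.exists_map_eq_map hj h t ht hc
  refine ⟨m, hi.trans hm, ?_⟩
  rw [map_sub, sub_eq_zero, KZero.map_of, KZero.map_of, grothendieck_of_eq_iff]
  refine ⟨ProjClass.map (unitHom (t _ m hm)) (ProjClass.map (unitHom (t l _ hl)) c), ?_⟩
  rw [← ProjClass.map_unitHom_comp (transition_comp hj t ht hi hm),
    ← ProjClass.map_unitHom_comp (transition_comp hj t ht hi hm), ← map_add, ← map_add]
  exact hxy

include hj h in
theorem KOne.exists_map_unitHom (z : KOne A) :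
    ∃ m, ∃ y : KOne (S m), KOne.map (unitHom (j m)) y = z := by
  induction z using unitaryClass_induction with | _ n u
  obtain ⟨m, w, hw⟩ := h.exists_matrix_unitary hj u
  exact ⟨m, unitaryClass w, by rw [KOne.map_unitHom, unitaryClass_eq_of_joined hw]⟩

theorem unitaryPad_unitaryHom {B : Type*} [CStarAlgebra B] (f : A →⋆ₐ[ℂ] B) {n m : ℕ} (hnm : n ≤ m)
    (u : MatUnitary A n) : unitaryPad hnm (unitaryHom (matrixHom (Fin n) f) u) =
      unitaryHom (matrixHom (Fin m) f) (unitaryPad hnm u) := by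
  refine Subtype.ext (Matrix.ext fun a b => ?_)
  change padMat n m (u.1.map f) a b = f (padMat n m u.1 a b)
  simp only [padMat, Matrix.of_apply]
  split_ifs <;> simp

include hj h ht in
theorem KOne.exists_map_eq_zero {i : ℕ} {z : KOne (S i)} (hz : KOne.map (unitHom (j i)) z = 0) :
    ∃ m, ∃ hm : i ≤ m, KOne.map (unitHom (t i m hm)) z = 0 := by
  induction z using unitaryClass_induction with | _ n u
  rw [KOne.map_unitHom, unitaryClass_eq_zero_iff] at hz
  obtain ⟨l, hl, hu⟩ := hz
  rw [unitaryPad_unitaryHom] at hu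
  obtain ⟨m, hm, hw⟩ := h.exists_matrix_joined_one hj (t i) (ht i) hu
  refine ⟨m, hm, ?_⟩
  rw [KOne.map_unitHom, unitaryClass_eq_zero_iff]
  exact ⟨l, hl, by rwa [unitaryPad_unitaryHom]⟩

end Continuity

/-! ### Recognition of a sequential colimit of abelian groups. -/

section SequentialColimit

/-- In the application L is the system of K-groups of the subalgebras, N the K-group of the closure
of their union, and M the isomorphic system of K-groups of the C⋆_r(Γ_i). The maps g_i e_i⁻¹ form a
cocone on M, and `hsurj` and `hinj` make the induced map from the colimit bijective. -/
theorem nonempty_iso_colimit_ofSequence {M : ℕ → Type u} [∀ i, AddCommGroup (M i)]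
    (f : ∀ i, M i →+ M (i + 1)) {N : Type u} [AddCommGroup N] {L : ℕ → Type u}
    [∀ i, AddCommGroup (L i)] (t : ∀ i m, i ≤ m → L i →+ L m) (e : ∀ i, L i →+ M i)
    (g : ∀ i, L i →+ N) (he : ∀ i, Function.Bijective (e i))
    (ht : ∀ i x, t i i le_rfl x = x)
    (htt : ∀ i m l him hml x, t m l hml (t i m him x) = t i l (him.trans hml) x)
    (hef : ∀ i x, e (i + 1) (t i (i + 1) i.le_succ x) = f i (e i x))
    (hg : ∀ i x, g (i + 1) (t i (i + 1) i.le_succ x) = g i x)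
    (hsurj : ∀ y, ∃ i x, g i x = y)
    (hinj : ∀ i x, g i x = 0 → ∃ m, ∃ hm : i ≤ m, t i m hm x = 0) :
    Nonempty (AddCommGrpCat.of N ≅
      colimit (Functor.ofSequence fun i => AddCommGrpCat.ofHom (f i))) := by
  let F := Functor.ofSequence fun i => AddCommGrpCat.ofHom (f i)
  let E i := AddEquiv.ofBijective (e i) (he i)
  let G i : M i →+ N := (g i).comp (E i).symm.toAddMonoidHom
  have hGe i x : G i (e i x) = g i x := congrArg (g i) ((E i).symm_apply_apply x)
  have hE i y : ∃ x, e i x = y := (he i).2 y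
  have hG i y : G (i + 1) (f i y) = G i y := by
    obtain ⟨x, rfl⟩ := hE i y
    rw [← hef, hGe, hGe, hg]
  let α : F ⟶ (Functor.const ℕ).obj (AddCommGrpCat.of N) :=
    NatTrans.ofSequence (fun i => AddCommGrpCat.ofHom (G i)) fun i => by
      rw [Functor.ofSequence_map_homOfLE_succ]
      ext y
      exact hG i y
  have hF i m (hm : i ≤ m) x : F.map (homOfLE hm) (e i x) = e m (t i m hm x) := by
    induction m, hm using Nat.le_induction with
    | base =>
      rw [ht]
      exact ConcreteCategory.congr_hom (F.map_id i) (e i x)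
    | succ m hm ih =>
      rw [← htt i m (m + 1) hm m.le_succ, hef, ← ih]
      have h1 : homOfLE (hm.trans m.le_succ) = homOfLE hm ≫ homOfLE m.le_succ := rfl
      rw [h1, F.map_comp]
      change F.map (homOfLE m.le_succ) _ = _
      rw [Functor.ofSequence_map_homOfLE_succ]
      rfl
  let d : colimit F ⟶ AddCommGrpCat.of N := colimit.desc F ⟨_, α⟩
  have hd i y : d (colimit.ι F i y) = G i y :=
    ConcreteCategory.congr_hom (colimit.ι_desc (⟨_, α⟩ : Cocone F) i) y
  have hbij : Function.Bijective d := by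
    constructor
    · refine (injective_iff_map_eq_zero d.hom).mpr fun z hz => ?_
      -- Filtered colimits of abelian groups are computed on underlying sets, so each element of the
      -- colimit comes from one stage.
      have := preservesSmallestFilteredColimits_of_preservesFilteredColimits
        (forget AddCommGrpCat.{u})
      obtain ⟨i, y, rfl⟩ := Concrete.colimit_exists_rep F z
      obtain ⟨x, rfl⟩ := hE i y
      have hz' : G i (e i x) = 0 := (hd i _).symm.trans hz
      rw [hGe] at hz'
      obtain ⟨m, hm, h0⟩ := hinj i x hz'
      have h1 := ConcreteCategory.congr_hom (colimit.w F (homOfLE hm)) (e i x)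
      rw [← h1]
      change colimit.ι F m (F.map (homOfLE hm) (e i x)) = 0
      rw [hF, h0, map_zero]
      exact map_zero (colimit.ι F m).hom
    · intro y
      obtain ⟨i, x, rfl⟩ := hsurj y
      exact ⟨colimit.ι F i (e i x), (hd i _).trans (hGe i x)⟩
  have : IsIso d := (ConcreteCategory.isIso_iff_bijective d).mpr hbij
  exact ⟨(asIso d).symm⟩

end SequentialColimit

namespace EllTwo

/-! ### Operators on ℓ² induced by injections of index sets. -/

section Embeddings

variable {ι : Type*} {κ : Type*} {μ : Type*}

open Classical in
/-- The basis vector of `ℓ²(ι)` at `i`. -/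
def basisVec (i : ι) : EllTwo ι := lp.single 2 i (1 : ℂ)

theorem inner_basisVec (i : ι) (ξ : EllTwo ι) : inner ℂ (basisVec i) ξ = ξ i := by
  classical
  simp [basisVec, lp.inner_single_left]

theorem basisVec_apply_self (i : ι) : basisVec i i = 1 := by
  classical
  exact lp.single_apply_self _ _ _

theorem basisVec_apply_ne {i j : ι} (h : j ≠ i) : basisVec i j = 0 := by
  classical
  exact lp.single_apply_ne _ _ _ h

theorem basisVec_apply_of_injective {f : ι → κ} (hf : Function.Injective f) (i j : ι) :
    basisVec (f i) (f j) = basisVec i j := by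
  by_cases h : j = i
  · rw [h, basisVec_apply_self, basisVec_apply_self]
  · rw [basisVec_apply_ne h, basisVec_apply_ne (hf.ne h)]

/-- Basis vectors span a dense subspace; this reduces most operator identities below to computations
with indices. -/
theorem clm_ext {F : Type*} [NormedAddCommGroup F] [NormedSpace ℂ F] {S T : EllTwo ι →L[ℂ] F}
    (h : ∀ i, S (basisVec i) = T (basisVec i)) : S = T := by
  classical
  refine ContinuousLinearMap.ext fun ξ => ?_
  have h1 : HasSum (fun i => lp.single 2 i (ξ i)) ξ := lp.hasSum_single (by norm_num) ξ
  have h2 (i : ι) : lp.single 2 i (ξ i) = ξ i • basisVec i := by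
    rw [basisVec, ← lp.single_smul, smul_eq_mul, mul_one]
  simp only [h2] at h1
  refine (h1.mapL S).unique ?_
  simpa only [map_smul, h] using h1.mapL T

/-- The operator `(R ξ)(i) = ξ(f i)` from `ℓ²(κ)` to `ℓ²(ι)` for an injective map `f : ι → κ`. -/
def comapOp (f : ι → κ) (hf : Function.Injective f) : EllTwo κ →L[ℂ] EllTwo ι :=
  have hs (ξ : EllTwo κ) : Summable fun i => ‖ξ i‖ ^ (2 : ℝ≥0∞).toReal :=
    (memℓp_gen_iff (by norm_num)).mp (lp.memℓp ξ)
  LinearMap.mkContinuous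
    { toFun := fun ξ => ⟨fun i => ξ (f i),
        (memℓp_gen_iff (p := 2) (by norm_num)).mpr ((hs ξ).comp_injective hf)⟩
      map_add' := fun _ _ => rfl
      map_smul' := fun _ _ => rfl } 1 fun ξ => by
    rw [one_mul, lp.norm_eq_tsum_rpow (by norm_num), lp.norm_eq_tsum_rpow (by norm_num)]
    refine Real.rpow_le_rpow (tsum_nonneg fun i => by positivity) ?_ (by norm_num)
    exact tsum_comp_le_tsum_of_inj (hs ξ) (fun i => by positivity) hf

/-- The isometry from `ℓ²(ι)` to `ℓ²(κ)` mapping the basis vector at `i` to that at `f i`. -/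
def embOp (f : ι → κ) (hf : Function.Injective f) : EllTwo ι →L[ℂ] EllTwo κ :=
  adjoint (comapOp f hf)

variable {f : ι → κ} (hf : Function.Injective f)

theorem adjoint_embOp : adjoint (embOp f hf) = comapOp f hf :=
  ContinuousLinearMap.adjoint_adjoint _

theorem comapOp_basisVec (i : ι) : comapOp f hf (basisVec (f i)) = basisVec i := by
  ext j
  exact basisVec_apply_of_injective hf i j

theorem comapOp_basisVec_of_notMem {k : κ} (h : ∀ i, f i ≠ k) : comapOp f hf (basisVec k) = 0 := by
  ext j
  exact basisVec_apply_ne (h j)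

theorem embOp_basisVec (i : ι) : embOp f hf (basisVec i) = basisVec (f i) := by
  ext k
  rw [← inner_basisVec k, embOp, ContinuousLinearMap.adjoint_inner_right]
  by_cases h : ∃ j, f j = k
  · obtain ⟨j, rfl⟩ := h
    rw [comapOp_basisVec, inner_basisVec, basisVec_apply_of_injective hf]
  · rw [not_exists] at h
    rw [comapOp_basisVec_of_notMem hf h, inner_zero_left, basisVec_apply_ne (Ne.symm (h i))]

theorem permOp_basisVec (σ : Equiv.Perm ι) (i : ι) :
    permOp σ (basisVec i) = basisVec (σ i) := by
  ext j
  rw [permOp_apply, ← basisVec_apply_of_injective σ.injective, σ.apply_symm_apply]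

theorem mulOp_basisVec (g : ι → ℂ) (C : ℝ) (hg : ∀ i, ‖g i‖ ≤ C) (i : ι) :
    mulOp g C hg (basisVec i) = g i • basisVec i := by
  ext j
  rw [mulOp_apply, lp.coeFn_smul, Pi.smul_apply, smul_eq_mul]
  by_cases h : j = i
  · rw [h]
  · rw [basisVec_apply_ne h, mul_zero, mul_zero]

theorem comapOp_comp_embOp : comapOp f hf ∘L embOp f hf = 1 :=
  clm_ext fun i => by
    simp [embOp_basisVec, comapOp_basisVec]

theorem comapOp_comp_embOp_of_eq {g : μ → κ} (hg : Function.Injective g) {t : μ → ι}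
    (ht : Function.Injective t) (h : ∀ i, g i = f (t i)) :
    comapOp f hf ∘L embOp g hg = embOp t ht :=
  clm_ext fun i => by
    simp [embOp_basisVec, h, comapOp_basisVec]

theorem comapOp_comp_embOp_of_ne {g : μ → κ} (hg : Function.Injective g)
    (h : ∀ i j, f i ≠ g j) : comapOp f hf ∘L embOp g hg = 0 :=
  clm_ext fun i => by
    simp [embOp_basisVec, comapOp_basisVec_of_notMem hf fun j => h j i]

theorem permOp_eq_embOp (σ : Equiv.Perm ι) : permOp σ = embOp σ σ.injective :=
  clm_ext fun i => by rw [permOp_basisVec, embOp_basisVec]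

theorem adjoint_mulOp (g : ι → ℂ) (C : ℝ) (hg : ∀ i, ‖g i‖ ≤ C) :
    adjoint (mulOp g C hg) = mulOp (fun i => star (g i)) C (fun i => by simpa using hg i) := by
  refine ContinuousLinearMap.ext fun ξ => lp.ext (funext fun i => ?_)
  rw [← inner_basisVec i, ContinuousLinearMap.adjoint_inner_right, mulOp_basisVec,
    inner_smul_left, inner_basisVec, mulOp_apply]
  rfl

theorem mulOp_comp_embOp {g : κ → ℂ} {C : ℝ} (hg : ∀ i, ‖g i‖ ≤ C) :
    mulOp g C hg ∘L embOp f hf = embOp f hf ∘L mulOp (g ∘ f) C (fun i => hg (f i)) :=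
  clm_ext fun i => by
    simp [embOp_basisVec, mulOp_basisVec]

theorem mulOp_comp_embOp_const {g : κ → ℂ} {C : ℝ} (hg : ∀ i, ‖g i‖ ≤ C) {c : ℂ}
    (hc : ∀ i, g (f i) = c) : mulOp g C hg ∘L embOp f hf = c • embOp f hf :=
  clm_ext fun i => by
    simp [embOp_basisVec, mulOp_basisVec, hc]

/-- The bijection `e` says that the images of the maps J c partition the image of f. Hence the
projections onto the corresponding coordinate subspaces add up. -/
theorem sum_embOp_comp_comapOp {k : Type*} [Fintype k] {J : k → μ → κ}
    (hJ : ∀ c, Function.Injective (J c)) (e : ι ≃ k × μ) (h : ∀ i, J (e i).1 (e i).2 = f i) :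
    ∑ c, embOp (J c) (hJ c) ∘L comapOp (J c) (hJ c) = embOp f hf ∘L comapOp f hf := by
  classical
  have hJ2 c d a b (hcd : J c a = J d b) : (c, a) = (d, b) := by
    have h1 := h (e.symm (c, a))
    have h2 := h (e.symm (d, b))
    rw [e.apply_symm_apply] at h1 h2
    exact e.symm.injective (hf (h1.symm.trans (hcd.trans h2)))
  refine clm_ext fun y => ?_
  rw [sum_apply]
  simp only [ContinuousLinearMap.comp_apply]
  by_cases hy : ∃ i, f i = y
  · obtain ⟨i, rfl⟩ := hy
    rw [comapOp_basisVec, embOp_basisVec, Finset.sum_eq_single (e i).1]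
    · rw [← h, comapOp_basisVec, embOp_basisVec]
    · intro c _ hc
      rw [comapOp_basisVec_of_notMem, map_zero]
      intro a ha
      rw [← h] at ha
      exact hc (congrArg Prod.fst (hJ2 _ _ _ _ ha))
    · simp
  · rw [not_exists] at hy
    rw [comapOp_basisVec_of_notMem hf hy, map_zero]
    refine Finset.sum_eq_zero fun c _ => ?_
    rw [comapOp_basisVec_of_notMem, map_zero]
    intro a ha
    refine hy (e.symm (c, a)) ?_
    rw [← h, e.apply_symm_apply, ha]

end Embeddings

end EllTwo

/-! ### Compression to matrices -/

section Frames

variable {H K : Type*} [NormedAddCommGroup H] [InnerProductSpace ℂ H] [CompleteSpace H]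
  [NormedAddCommGroup K] [InnerProductSpace ℂ K] [CompleteSpace K]
  {k l : Type*} [Fintype k] [DecidableEq k] [Fintype l] [DecidableEq l]

/-- Isometries with pairwise orthogonal ranges. -/
def IsFrame (V : k → H →L[ℂ] K) : Prop :=
  ∀ c d, adjoint (V c) ∘L V d = if c = d then 1 else 0

/-- The projection onto the sum of the ranges of the members of a frame. -/
def frameProj (V : k → H →L[ℂ] K) : K →L[ℂ] K := ∑ c, V c ∘L adjoint (V c)

variable {V : k → H →L[ℂ] K} (hV : IsFrame V)

omit [DecidableEq k] in
theorem adjoint_frameProj (V : k → H →L[ℂ] K) : adjoint (frameProj V) = frameProj V := by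
  rw [frameProj, map_sum]
  refine Finset.sum_congr rfl fun c _ => ?_
  rw [ContinuousLinearMap.adjoint_comp, ContinuousLinearMap.adjoint_adjoint]

include hV in
theorem frameProj_comp (c : k) : frameProj V ∘L V c = V c := by
  rw [frameProj, ContinuousLinearMap.finsetSum_comp]
  simp only [ContinuousLinearMap.comp_assoc]
  rw [Finset.sum_eq_single c]
  · rw [hV c c, if_pos rfl]
    rfl
  · intro d _ hd
    rw [hV d c, if_neg hd, ContinuousLinearMap.comp_zero]
  · simp

omit [DecidableEq k] in
-- Summing over e inserts the frame projection between T and T'; it commutes with T' and fixes the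
-- range of U'. The outer families U, U' are left free so that the result also covers two different
-- frames.
theorem sum_compression {l m : Type*} {T T' : K →L[ℂ] K} (h : frameProj V ∘L T' = T' ∘L frameProj V)
    (U : l → H →L[ℂ] K) (U' : m → H →L[ℂ] K)
    (hU' : ∀ d, frameProj V ∘L U' d = U' d) (c : l) (d : m) :
    ∑ e, (adjoint (U c) ∘L T ∘L V e) ∘L (adjoint (V e) ∘L T' ∘L U' d) =
      adjoint (U c) ∘L (T ∘L T') ∘L U' d := by
  have h1 : ∑ e, (adjoint (U c) ∘L T ∘L V e) ∘L (adjoint (V e) ∘L T' ∘L U' d) =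
      adjoint (U c) ∘L T ∘L (frameProj V ∘L T') ∘L U' d := by
    simp only [frameProj, ContinuousLinearMap.finsetSum_comp, ContinuousLinearMap.comp_finsetSum,
      ContinuousLinearMap.comp_assoc]
  rw [h1, h, ContinuousLinearMap.comp_assoc, hU']
  rfl

/-- The operators that commute with the projection of a frame and whose matrix coefficients with
respect to the frame lie in `B`. -/
def frameAlgebra (hV : IsFrame V) (B : StarSubalgebra ℂ (H →L[ℂ] H)) :
    StarSubalgebra ℂ (K →L[ℂ] K) where
  carrier := {T | frameProj V ∘L T = T ∘L frameProj V ∧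
    ∀ c d, adjoint (V c) ∘L T ∘L V d ∈ B}
  mul_mem' {S T} hS hT := by
    refine ⟨?_, fun c d => ?_⟩
    · change frameProj V ∘L S ∘L T = S ∘L T ∘L frameProj V
      rw [← hT.1, ← ContinuousLinearMap.comp_assoc, hS.1, ContinuousLinearMap.comp_assoc]
    · change adjoint (V c) ∘L (S ∘L T) ∘L V d ∈ B
      rw [← sum_compression hT.1 V V (frameProj_comp hV)]
      exact sum_mem fun e _ => mul_mem (hS.2 c e) (hT.2 e d)
  add_mem' {S T} hS hT := by
    refine ⟨by rw [ContinuousLinearMap.comp_add, ContinuousLinearMap.add_comp, hS.1, hT.1],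
      fun c d => ?_⟩
    rw [ContinuousLinearMap.add_comp, ContinuousLinearMap.comp_add]
    exact add_mem (hS.2 c d) (hT.2 c d)
  algebraMap_mem' r := by
    have h : algebraMap ℂ (K →L[ℂ] K) r = r • 1 := Algebra.algebraMap_eq_smul_one r
    rw [h]
    refine ⟨by ext; simp, fun c d => ?_⟩
    have h1 : adjoint (V c) ∘L (r • (1 : K →L[ℂ] K)) ∘L V d = r • (adjoint (V c) ∘L V d) := by
      ext
      simp
    rw [h1, hV]
    refine B.smul_mem ?_ r
    split_ifs
    exacts [one_mem B, zero_mem B]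
  star_mem' {T} hT := by
    rw [Set.mem_ofPred_eq, ContinuousLinearMap.star_eq_adjoint]
    refine ⟨?_, fun c d => ?_⟩
    · have h := congrArg adjoint hT.1
      rw [ContinuousLinearMap.adjoint_comp, ContinuousLinearMap.adjoint_comp,
        adjoint_frameProj] at h
      exact h.symm
    · have h := star_mem (hT.2 d c)
      rw [ContinuousLinearMap.star_eq_adjoint, ContinuousLinearMap.adjoint_comp,
        ContinuousLinearMap.adjoint_comp, ContinuousLinearMap.adjoint_adjoint] at h
      exact h

variable {B : StarSubalgebra ℂ (H →L[ℂ] H)}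

theorem isClosed_frameAlgebra (hB : IsClosed (B : Set (H →L[ℂ] H))) :
    IsClosed (frameAlgebra hV B : Set (K →L[ℂ] K)) := by
  have h1 : IsClosed {T : K →L[ℂ] K | frameProj V * T = T * frameProj V} :=
    isClosed_eq (continuous_const.mul continuous_id) (continuous_id.mul continuous_const)
  have h2 c d : Continuous fun T : K →L[ℂ] K => adjoint (V c) ∘L T ∘L V d := by fun_prop
  have h3 : IsClosed (⋂ c, ⋂ d, (fun T : K →L[ℂ] K => adjoint (V c) ∘L T ∘L V d) ⁻¹' B) :=
    isClosed_iInter fun c => isClosed_iInter fun d => hB.preimage (h2 c d)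
  convert h1.inter h3 using 1
  ext T
  simp only [Set.mem_inter_iff, Set.mem_iInter]
  rfl

omit [DecidableEq l] in
theorem coe_matrix_mul_apply {m n : Type*} (M : Matrix m l B) (N : Matrix l n B) (c : m) (d : n) :
    ((M * N) c d : H →L[ℂ] H) = ∑ e, (M c e : H →L[ℂ] H) ∘L (N e d : H →L[ℂ] H) := by
  rw [Matrix.mul_apply, AddSubmonoidClass.coe_finsetSum]
  rfl

omit [Fintype k] in
theorem coe_matrix_one_apply (c d : k) :
    ((1 : Matrix k k B) c d : H →L[ℂ] H) = if c = d then 1 else 0 := by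
  rw [Matrix.one_apply]
  split_ifs <;> rfl

/-- The matrix coefficients with respect to a frame, as a ⋆-homomorphism. -/
def compression {S : StarSubalgebra ℂ (K →L[ℂ] K)} (hS : S ≤ frameAlgebra hV B) :
    S →⋆ₐ[ℂ] Matrix k k B where
  toFun T := Matrix.of fun c d => ⟨adjoint (V c) ∘L T.1 ∘L V d, (hS T.2).2 c d⟩
  map_one' := by
    refine Matrix.ext fun c d => Subtype.ext ?_
    change adjoint (V c) ∘L V d = ((1 : Matrix k k B) c d : H →L[ℂ] H)
    rw [hV, Matrix.one_apply]
    split_ifs <;> rfl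
  map_mul' T T' := by
    refine Matrix.ext fun c d => Subtype.ext ?_
    rw [coe_matrix_mul_apply]
    exact (sum_compression (hS T'.2).1 V V (frameProj_comp hV) c d).symm
  map_zero' := by
    refine Matrix.ext fun c d => Subtype.ext ?_
    exact (congrArg _ (ContinuousLinearMap.zero_comp _)).trans (ContinuousLinearMap.comp_zero _)
  map_add' T T' := by
    refine Matrix.ext fun c d => Subtype.ext ?_
    exact (congrArg _ (ContinuousLinearMap.add_comp _ _ _)).trans
      (ContinuousLinearMap.comp_add _ _ _)
  commutes' r := by
    refine Matrix.ext fun c d => Subtype.ext ?_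
    have h1 : adjoint (V c) ∘L (algebraMap ℂ (K →L[ℂ] K) r) ∘L V d =
        r • (adjoint (V c) ∘L V d) := by
      rw [Algebra.algebraMap_eq_smul_one]
      ext
      simp
    refine h1.trans ?_
    rw [hV, Matrix.algebraMap_matrix_apply]
    split_ifs
    · exact (Algebra.algebraMap_eq_smul_one r).symm
    · exact smul_zero r
  map_star' T := by
    refine Matrix.ext fun c d => Subtype.ext ?_
    change adjoint (V c) ∘L adjoint T.1 ∘L V d = adjoint (adjoint (V d) ∘L T.1 ∘L V c)
    rw [ContinuousLinearMap.adjoint_comp, ContinuousLinearMap.adjoint_comp,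
      ContinuousLinearMap.adjoint_adjoint, ContinuousLinearMap.comp_assoc]

variable {L : Type*} [NormedAddCommGroup L] [InnerProductSpace ℂ L] [CompleteSpace L]

/-- Two frames with the same projection give conjugate matrices of coefficients. -/
theorem exists_frame_change {V' : l → H →L[ℂ] K} (hV : IsFrame V) (hV' : IsFrame V')
    (h : frameProj V = frameProj V') (hB : ∀ c d, adjoint (V c) ∘L V' d ∈ B) :
    ∃ W : Matrix k l B, W * Wᴴ = 1 ∧ Wᴴ * W = 1 ∧
      ∀ T : K →L[ℂ] K, frameProj V ∘L T = T ∘L frameProj V →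
        ∀ (M : Matrix k k B) (N : Matrix l l B),
          (∀ c d, (M c d : H →L[ℂ] H) = adjoint (V c) ∘L T ∘L V d) →
          (∀ c d, (N c d : H →L[ℂ] H) = adjoint (V' c) ∘L T ∘L V' d) → M * W = W * N := by
  have h1 : frameProj V ∘L (1 : K →L[ℂ] K) = (1 : K →L[ℂ] K) ∘L frameProj V := rfl
  have h1' : frameProj V' ∘L (1 : K →L[ℂ] K) = (1 : K →L[ℂ] K) ∘L frameProj V' := rfl
  have hW c d : adjoint (adjoint (V c) ∘L V' d) = adjoint (V' d) ∘L V c := by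
    rw [ContinuousLinearMap.adjoint_comp, ContinuousLinearMap.adjoint_adjoint]
  have hVV c : frameProj V ∘L V' c = V' c := by rw [h, frameProj_comp hV']
  have hVV' c : frameProj V' ∘L V c = V c := by rw [← h, frameProj_comp hV]
  -- W holds the coefficients of the identity operator between the two frames, so all three claims
  -- become instances of `sum_compression`.
  let W : Matrix k l B := Matrix.of fun c d => ⟨_, hB c d⟩
  have hWc c d : (W c d : H →L[ℂ] H) = adjoint (V c) ∘L (1 : K →L[ℂ] K) ∘L V' d := rfl
  have hWs c d : (Wᴴ c d : H →L[ℂ] H) = adjoint (V' c) ∘L (1 : K →L[ℂ] K) ∘L V d := hW d c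
  refine ⟨W, Matrix.ext fun c d => Subtype.ext ?_,
    Matrix.ext fun c d => Subtype.ext ?_, fun T hT M N hM hN => Matrix.ext fun c d =>
      Subtype.ext ?_⟩
  · rw [coe_matrix_mul_apply, coe_matrix_one_apply, ← hV]
    simp only [hWc, hWs]
    exact sum_compression h1' V V hVV' c d
  · rw [coe_matrix_mul_apply, coe_matrix_one_apply, ← hV']
    simp only [hWc, hWs]
    exact sum_compression h1 V' V' hVV c d
  · rw [coe_matrix_mul_apply, coe_matrix_mul_apply]
    simp only [hWc, hM, hN]
    rw [sum_compression h1 V V' hVV c d, sum_compression (h ▸ hT) V V' (frameProj_comp hV') c d]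
    rfl

end Frames

/-! ### Frames given by the cosets of a subgroup. -/

section CosetFrames

open EllTwo

variable {G : Type*} [Group G] {M : Type*} [Group M] {κ : Type*} {φ : M →* G} {e : G → κ}

theorem injective_cosetMap (hφ : Function.Injective φ) (he : Function.Injective e) (a : G) :
    Function.Injective fun h => e (a * φ h) :=
  fun _ _ h => hφ (mul_left_cancel (he h))

/-- The isometry from `ℓ²(M)` to `ℓ²(κ)` mapping the basis vector at `h` to that at
`e (a * φ h)`. -/
def cosetOp (hφ : Function.Injective φ) (he : Function.Injective e) (a : G) :
    EllTwo M →L[ℂ] EllTwo κ :=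
  embOp (fun h => e (a * φ h)) (injective_cosetMap hφ he a)

variable (hφ : Function.Injective φ) (he : Function.Injective e)

theorem cosetOp_basisVec (a : G) (h : M) :
    cosetOp hφ he a (basisVec h) = basisVec (e (a * φ h)) :=
  embOp_basisVec _ _

/-- Representatives a and a φ(m) parametrise the same coset, and the parametrisations differ by left
translation by m. For different cosets the ranges are orthogonal. Thus every coefficient is some λ_m
or 0. -/
theorem adjoint_cosetOp_comp_of_eq {a b : G} {m : M} (h : b = a * φ m) :
    adjoint (cosetOp hφ he a) ∘L cosetOp hφ he b = leftRegular M m := by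
  rw [cosetOp, cosetOp, adjoint_embOp, comapOp_comp_embOp_of_eq (t := fun x => m * x) _ _
    (mul_right_injective m), leftRegular, permOp_eq_embOp]
  · rfl
  · intro x
    rw [h, map_mul, mul_assoc]

theorem adjoint_cosetOp_comp_of_notMem {a b : G} (h : a⁻¹ * b ∉ φ.range) :
    adjoint (cosetOp hφ he a) ∘L cosetOp hφ he b = 0 := by
  rw [cosetOp, cosetOp, adjoint_embOp, comapOp_comp_embOp_of_ne]
  intro x y hxy
  refine h ⟨x * y⁻¹, ?_⟩
  have h2 := he hxy
  rw [map_mul, map_inv, eq_inv_mul_iff_mul_eq, ← mul_assoc, h2, mul_inv_cancel_right]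

theorem adjoint_cosetOp_comp_mem (a b : G) :
    adjoint (cosetOp hφ he a) ∘L cosetOp hφ he b ∈ reducedGroupCStar M := by
  by_cases h : a⁻¹ * b ∈ φ.range
  · obtain ⟨m, hm⟩ := h
    rw [adjoint_cosetOp_comp_of_eq hφ he (m := m) (by rw [hm, mul_inv_cancel_left])]
    exact (groupUnitary m).2
  · rw [adjoint_cosetOp_comp_of_notMem hφ he h]
    exact zero_mem _

/-- The family `s` represents every left coset of the range of the injective homomorphism `φ`
exactly once. -/
def IsTransversal {k : Type*} (φ : M →* G) (s : k → G) : Prop :=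
  Function.Bijective fun p : k × M => s p.1 * φ p.2

variable {k l : Type*} {s : k → G}

theorem IsTransversal.eq_of_mem (hs : IsTransversal φ s) {c d : k}
    (h : (s c)⁻¹ * s d ∈ φ.range) : c = d := by
  obtain ⟨m, hm⟩ := h
  refine congrArg Prod.fst (hs.1 (a₁ := (c, m)) (a₂ := (d, 1)) ?_)
  change s c * φ m = s d * φ 1
  rw [hm, map_one, mul_one, mul_inv_cancel_left]

theorem isTransversal_of_mk_eq {L : Subgroup G} {s : G ⧸ L → G} (hφ : Function.Injective φ)
    (hL : φ.range = L) (hs : ∀ c, QuotientGroup.mk (s c) = c) : IsTransversal φ s := by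
  subst hL
  constructor
  · rintro ⟨c, m⟩ ⟨d, m'⟩ h
    change s c * φ m = s d * φ m' at h
    have h1 := congrArg (QuotientGroup.mk (s := φ.range)) h
    rw [QuotientGroup.mk_mul_of_mem _ (MonoidHom.mem_range.mpr ⟨m, rfl⟩),
      QuotientGroup.mk_mul_of_mem _ (MonoidHom.mem_range.mpr ⟨m', rfl⟩), hs, hs] at h1
    subst h1
    rw [hφ (mul_left_cancel h)]
  · intro g
    have h1 : (s (QuotientGroup.mk g))⁻¹ * g ∈ φ.range := QuotientGroup.eq.mp (hs _)
    obtain ⟨m, hm⟩ := h1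
    exact ⟨(QuotientGroup.mk g, m), by dsimp only; rw [hm, mul_inv_cancel_left]⟩

/-- Transversals multiply along a tower of groups; this is the index set on which a compression
followed by a transfer is computed. -/
theorem IsTransversal.comp {N : Type*} [Group N] {ψ : N →* M} {r : l → M}
    (hs : IsTransversal φ s) (hr : IsTransversal ψ r) :
    IsTransversal (φ.comp ψ) fun x : k × l => s x.1 * φ (r x.2) := by
  have h := Function.Bijective.comp hs
    ((Function.bijective_id.prodMap hr).comp (Equiv.prodAssoc k l N).bijective)
  rw [IsTransversal]
  convert h using 1
  funext x
  exact (mul_assoc _ _ _).trans (congrArg _ (map_mul φ _ _).symm)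

theorem IsTransversal.bijective_mk (hs : IsTransversal φ s) :
    Function.Bijective fun c => (QuotientGroup.mk (s c) : G ⧸ φ.range) := by
  refine ⟨fun c d h => hs.eq_of_mem (QuotientGroup.eq.mp h), fun x => ?_⟩
  induction x using QuotientGroup.induction_on with
  | H g =>
    obtain ⟨⟨c, m⟩, h⟩ := hs.2 g
    refine ⟨c, ?_⟩
    rw [← h]
    exact (QuotientGroup.mk_mul_of_mem _ (MonoidHom.mem_range.mpr ⟨m, rfl⟩)).symm

theorem IsTransversal.card_eq {s' : l → G} [Fintype k] [Fintype l] (hs : IsTransversal φ s)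
    (hs' : IsTransversal φ s') : Fintype.card k = Fintype.card l :=
  Fintype.card_congr ((Equiv.ofBijective _ hs.bijective_mk).trans
    (Equiv.ofBijective _ hs'.bijective_mk).symm)

variable [DecidableEq k]

theorem isFrame_cosetOp (hs : IsTransversal φ s) : IsFrame fun c => cosetOp hφ he (s c) := by
  intro c d
  split_ifs with h
  · subst h
    simp only [cosetOp, adjoint_embOp, comapOp_comp_embOp]
  · exact adjoint_cosetOp_comp_of_notMem hφ he fun h' => h (hs.eq_of_mem h')

variable [Fintype k]

omit [DecidableEq k] in
-- The cosets exhaust G, so the projection is onto the span of the basis vectors indexed by e(G). In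
-- particular it does not depend on the transversal or even on the subgroup.
theorem frameProj_cosetOp (hs : IsTransversal φ s) :
    frameProj (fun c => cosetOp hφ he (s c)) = embOp e he ∘L comapOp e he := by
  simp only [frameProj, cosetOp, adjoint_embOp]
  refine sum_embOp_comp_comapOp he _ (Equiv.ofBijective _ hs).symm fun g => ?_
  exact congrArg e ((Equiv.ofBijective _ hs).apply_symm_apply g)

end CosetFrames

/-! ### Commutation with partial isometries between coordinate subspaces. -/

namespace EllTwo

variable {ι κ : Type*} {e e' : ι → κ} (he : Function.Injective e) (he' : Function.Injective e')

theorem mulOp_comp_embOp_comp_comapOp {g : κ → ℂ} {C : ℝ} (hg : ∀ i, ‖g i‖ ≤ C)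
    (h : ∀ i, g (e i) = g (e' i)) :
    mulOp g C hg ∘L embOp e he ∘L comapOp e' he' =
      (embOp e he ∘L comapOp e' he') ∘L mulOp g C hg := by
  rw [← ContinuousLinearMap.comp_assoc, mulOp_comp_embOp, ContinuousLinearMap.comp_assoc,
    ContinuousLinearMap.comp_assoc]
  congr 1
  refine ContinuousLinearMap.ext fun ξ => lp.ext (funext fun i => ?_)
  exact congrArg (· * ξ (e' i)) (h i)

theorem permOp_comp_embOp_comp_comapOp {σ : Equiv.Perm κ} (τ : Equiv.Perm ι)
    (h : ∀ i, σ (e i) = e (τ i)) (h' : ∀ i, σ (e' i) = e' (τ i)) :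
    permOp σ ∘L embOp e he ∘L comapOp e' he' = (embOp e he ∘L comapOp e' he') ∘L permOp σ := by
  have h1 : permOp σ ∘L embOp e he = embOp e he ∘L permOp τ := by
    refine clm_ext fun i => ?_
    simp [embOp_basisVec, permOp_basisVec, h]
  have h2 : permOp τ ∘L comapOp e' he' = comapOp e' he' ∘L permOp σ := by
    refine ContinuousLinearMap.ext fun ξ => lp.ext (funext fun i => ?_)
    have h3 : e' (τ.symm i) = σ.symm (e' i) := by
      rw [Equiv.eq_symm_apply, h', Equiv.apply_symm_apply]
    exact congrArg (fun j => ξ j) h3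
  rw [← ContinuousLinearMap.comp_assoc, h1, ContinuousLinearMap.comp_assoc, h2,
    ContinuousLinearMap.comp_assoc]

end EllTwo

/-! ### The subalgebra of functions factoring through a coset space, and its commutant. -/

section PulledCrossedProduct

open EllTwo

variable {G : Type u} [Group G] {X : Type v}

theorem injective_mul_prodMk (x : X) (t : G) :
    Function.Injective fun g : G => (g * t⁻¹, x) :=
  fun _ _ h => mul_right_cancel (congrArg Prod.fst h)

/-- The partial isometry that maps the basis vector at `(g t'⁻¹, x')` to that at `(g t⁻¹, x)`. -/
def orbitOp (x x' : X) (t t' : G) : EllTwo (G × X) →L[ℂ] EllTwo (G × X) :=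
  embOp _ (injective_mul_prodMk x t) ∘L comapOp _ (injective_mul_prodMk x' t')

theorem adjoint_orbitOp (x x' : X) (t t' : G) :
    adjoint (orbitOp x x' t t') = orbitOp x' x t' t := by
  rw [orbitOp, ContinuousLinearMap.adjoint_comp, adjoint_embOp]
  rfl

theorem orbitOp_basisVec (x x' : X) (t t' g : G) :
    orbitOp x x' t t' (basisVec (g * t'⁻¹, x')) = basisVec (g * t⁻¹, x) := by
  rw [orbitOp, ContinuousLinearMap.comp_apply,
    comapOp_basisVec (injective_mul_prodMk x' t'), embOp_basisVec]

theorem crossedGroup_comp_orbitOp (x x' : X) (t t' g : G) :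
    crossedGroup G X g ∘L orbitOp x x' t t' = orbitOp x x' t t' ∘L crossedGroup G X g :=
  permOp_comp_embOp_comp_comapOp _ _ (Equiv.mulLeft g)
    (fun _ => Prod.ext (mul_assoc _ _ _).symm rfl) fun _ => Prod.ext (mul_assoc _ _ _).symm rfl

variable [TopologicalSpace G] [TopologicalSpace X] [CompactSpace X] [MulAction G X]
  {Λ : Subgroup G} (q : C(X, G ⧸ Λ))

/-- The C⋆-subalgebra of `C(X) ⋊_r G` generated by the functions that factor through a map
`q : X → G ⧸ Λ` and by the operators `λ_g`. -/
def pulledCrossedProduct : StarSubalgebra ℂ (EllTwo (G × X) →L[ℂ] EllTwo (G × X)) :=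
  (StarAlgebra.adjoin ℂ (Set.range (fun f : C(G ⧸ Λ, ℂ) => crossedFun G X (f.comp q)) ∪
    Set.range (crossedGroup G X))).topologicalClosure

instance : IsClosed (pulledCrossedProduct q : Set (EllTwo (G × X) →L[ℂ] EllTwo (G × X))) :=
  StarSubalgebra.isClosed_topologicalClosure _

theorem crossedFun_mem_pulledCrossedProduct (f : C(G ⧸ Λ, ℂ)) :
    crossedFun G X (f.comp q) ∈ pulledCrossedProduct q :=
  StarSubalgebra.le_topologicalClosure _ (StarAlgebra.subset_adjoin ℂ _ (.inl ⟨f, rfl⟩))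

theorem crossedGroup_mem_pulledCrossedProduct (g : G) :
    crossedGroup G X g ∈ pulledCrossedProduct q :=
  StarSubalgebra.le_topologicalClosure _ (StarAlgebra.subset_adjoin ℂ _ (.inr ⟨g, rfl⟩))

variable {q} in
theorem pulledCrossedProduct_le {S : StarSubalgebra ℂ (EllTwo (G × X) →L[ℂ] EllTwo (G × X))}
    (hS : IsClosed (S : Set (EllTwo (G × X) →L[ℂ] EllTwo (G × X))))
    (h₁ : ∀ f : C(G ⧸ Λ, ℂ), crossedFun G X (f.comp q) ∈ S) (h₂ : ∀ g, crossedGroup G X g ∈ S) :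
    pulledCrossedProduct q ≤ S := by
  refine StarSubalgebra.topologicalClosure_minimal (StarAlgebra.adjoin_le ?_) hS
  rintro _ (⟨f, rfl⟩ | ⟨g, rfl⟩)
  exacts [h₁ f, h₂ g]

variable {q} (hq : ∀ (g : G) (x : X), q (g • x) = g • q x)
include hq

/-- At the basis vector indexed by (g t⁻¹, x) the function takes the value f(g t⁻¹ q(x)) = f(gΛ),
which depends on neither t nor x. -/
theorem crossedFun_comp_orbitOp {x x' : X} {t t' : G} (hx : q x = QuotientGroup.mk t)
    (hx' : q x' = QuotientGroup.mk t') (f : C(G ⧸ Λ, ℂ)) :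
    crossedFun G X (f.comp q) ∘L orbitOp x x' t t' =
      orbitOp x x' t t' ∘L crossedFun G X (f.comp q) := by
  refine mulOp_comp_embOp_comp_comapOp _ _ _ fun g => congrArg f ?_
  change q ((g * t⁻¹) • x) = q ((g * t'⁻¹) • x')
  rw [hq, hq, hx, hx', MulAction.Quotient.smul_mk, MulAction.Quotient.smul_mk]
  simp

theorem comp_orbitOp {x x' : X} {t t' : G} (hx : q x = QuotientGroup.mk t)
    (hx' : q x' = QuotientGroup.mk t') {T : EllTwo (G × X) →L[ℂ] EllTwo (G × X)}
    (hT : T ∈ pulledCrossedProduct q) : T ∘L orbitOp x x' t t' = orbitOp x x' t t' ∘L T := by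
  -- The centralizer is a closed ⋆-subalgebra, so checking generators suffices. It also requires
  -- commutation with the adjoint, which is the same operator with the two points exchanged.
  have h : pulledCrossedProduct q ≤ StarSubalgebra.centralizer ℂ {orbitOp x x' t t'} := by
    refine pulledCrossedProduct_le ?_ (fun f => ?_) fun g => ?_
    · exact Set.isClosed_centralizer _
    · rw [StarSubalgebra.mem_centralizer_iff]
      rintro _ rfl
      rw [ContinuousLinearMap.star_eq_adjoint, adjoint_orbitOp]
      exact ⟨(crossedFun_comp_orbitOp hq hx hx' f).symm,
        (crossedFun_comp_orbitOp hq hx' hx f).symm⟩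
    · rw [StarSubalgebra.mem_centralizer_iff]
      rintro _ rfl
      rw [ContinuousLinearMap.star_eq_adjoint, adjoint_orbitOp]
      exact ⟨(crossedGroup_comp_orbitOp _ _ _ _ g).symm,
        (crossedGroup_comp_orbitOp _ _ _ _ g).symm⟩
  exact (((StarSubalgebra.mem_centralizer_iff ℂ).mp (h hT)) _ rfl).1.symm

end PulledCrossedProduct

/-! ### A criterion for surjectivity onto a matrix algebra. -/

section SurjectivityOntoMatrices

variable {A B : Type*} {n : Type*} [Fintype n] [DecidableEq n]

variable (n B) in
/-- The embedding of an algebra as the scalar matrices. -/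
def diagonalHom [Ring B] [StarRing B] [Algebra ℂ B] : B →⋆ₐ[ℂ] Matrix n n B where
  toFun b := Matrix.diagonal fun _ => b
  map_one' := Matrix.diagonal_one
  map_mul' _ _ := (Matrix.diagonal_mul_diagonal _ _).symm
  map_zero' := Matrix.diagonal_zero
  map_add' _ _ := (Matrix.diagonal_add _ _).symm
  commutes' _ := rfl
  map_star' _ := (Matrix.diagonal_conjTranspose _).symm

/-- The range of an injective ⋆-homomorphism is closed. It contains the scalar matrices b for b in
the generating set, hence for all b in B; multiplying these by matrix units, which are available
because 1 lies in S, gives every matrix. -/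
theorem surjective_of_single_mem_range [CStarAlgebra A] [CStarAlgebra B] {S : Set B}
    (hS : (StarAlgebra.adjoin ℂ S).topologicalClosure = ⊤) (h₁ : 1 ∈ S)
    {ρ : A →⋆ₐ[ℂ] Matrix n n B} (hρ : Function.Injective ρ)
    (h : ∀ c d, ∀ b ∈ S, ∃ a, ρ a = Matrix.single c d b) : Function.Surjective ρ := by
  let _ := matrixCStarAlgebra n B
  have hR : IsClosed (ρ.range : Set (Matrix n n B)) := by
    exact (NonUnitalStarAlgHom.isometry ρ hρ).isClosedEmbedding.isClosed_range
  have h2 : (StarAlgebra.adjoin ℂ S).topologicalClosure ≤ ρ.range.comap (diagonalHom B n) := by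
    refine StarSubalgebra.topologicalClosure_minimal (StarAlgebra.adjoin_le fun b hb => ?_)
      (hR.preimage (continuous_starAlgHom (diagonalHom B n)))
    change Matrix.diagonal (fun _ => b) ∈ ρ.range
    rw [← Matrix.sum_single_eq_diagonal]
    exact sum_mem fun c _ => h c c b hb
  have h3 (b : B) : diagonalHom B n b ∈ ρ.range := by
    rw [hS] at h2
    exact h2 (StarSubalgebra.mem_top)
  intro M
  change M ∈ ρ.range
  rw [Matrix.matrix_eq_sum_single M]
  refine sum_mem fun c _ => sum_mem fun d _ => ?_
  have h4 : Matrix.single c d (M c d) = diagonalHom B n (M c d) * Matrix.single c d 1 := by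
    ext a b
    change _ = ((Matrix.diagonal fun _ => M c d : Matrix n n B) *
      (Matrix.single c d 1 : Matrix n n B) : Matrix n n B) a b
    rw [Matrix.diagonal_mul, Matrix.single_apply, Matrix.single_apply, mul_ite, mul_one, mul_zero]
  rw [h4]
  exact mul_mem (h3 _) (h c d 1 h₁)

theorem topologicalClosure_adjoin_groupUnitary (G : Type*) [Group G] :
    (StarAlgebra.adjoin ℂ (Set.range (groupUnitary (G := G)))).topologicalClosure = ⊤ := by
  refine top_unique fun x _ => ?_
  have h1 : (x : EllTwo G →L[ℂ] EllTwo G) ∈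
      closure (StarAlgebra.adjoin ℂ (Set.range (leftRegular G)) :
        Set (EllTwo G →L[ℂ] EllTwo G)) := x.2
  have h2 : StarAlgebra.adjoin ℂ (Set.range (leftRegular G)) =
      (StarAlgebra.adjoin ℂ (Set.range (groupUnitary (G := G)))).map
        (reducedGroupCStar G).subtype := by
    rw [StarAlgHom.map_adjoin, ← Set.range_comp]
    rfl
  rw [h2] at h1
  exact closure_subtype.mpr h1

end SurjectivityOntoMatrices

/-! ### Compression to the slice over a base point is an isomorphism onto matrices. -/

section PulledCompression

open EllTwo

variable {G : Type u} [Group G] {X : Type v}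

omit [Group G] in
theorem injective_prodMk (x : X) : Function.Injective fun g : G => (g, x) :=
  fun _ _ h => congrArg Prod.fst h

variable {M : Type*} [Group M] {φ : M →* G} (hφ : Function.Injective φ)

/-- The frame spans exactly the slice over x. Writing its projection as an `orbitOp` makes the
invariance of the slice a case of `comp_orbitOp`. -/
theorem frameProj_pulled {k : Type*} [Fintype k] {s : k → G} (hs : IsTransversal φ s) (x : X) :
    frameProj (fun c => cosetOp hφ (injective_prodMk x) (s c)) = orbitOp x x 1 1 := by
  rw [frameProj_cosetOp _ _ hs]
  simp only [orbitOp, inv_one, mul_one]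

theorem crossedGroup_comp_cosetOp (x : X) (g a : G) :
    crossedGroup G X g ∘L cosetOp hφ (injective_prodMk x) a =
      cosetOp hφ (injective_prodMk x) (g * a) :=
  clm_ext fun i => by
    rw [ContinuousLinearMap.comp_apply, cosetOp_basisVec, cosetOp_basisVec, crossedGroup,
      permOp_basisVec, mul_assoc]
    rfl

variable [TopologicalSpace G] [TopologicalSpace X] [CompactSpace X] [MulAction G X]
  {Λ : Subgroup G} {q : C(X, G ⧸ Λ)} (hq : ∀ (g : G) (x : X), q (g • x) = g • q x) {x₀ : X}
  (hx₀ : q x₀ = QuotientGroup.mk 1)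
include hq hx₀

theorem crossedFun_comp_cosetOp (f : C(G ⧸ Λ, ℂ)) (a : G) :
    crossedFun G X (f.comp q) ∘L cosetOp Λ.subtype_injective (injective_prodMk x₀) a =
      f (QuotientGroup.mk a) • cosetOp Λ.subtype_injective (injective_prodMk x₀) a := by
  refine mulOp_comp_embOp_const _ _ fun h => ?_
  change f (q ((a * h) • x₀)) = _
  rw [hq, hx₀, MulAction.Quotient.smul_mk, smul_eq_mul, mul_one,
    QuotientGroup.mk_mul_of_mem _ h.2]

variable {s : G ⧸ Λ → G} (hs : IsTransversal Λ.subtype s) [Fintype (G ⧸ Λ)]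
  [DecidableEq (G ⧸ Λ)]

theorem pulledCrossedProduct_le_frameAlgebra :
    pulledCrossedProduct q ≤ frameAlgebra
      (isFrame_cosetOp Λ.subtype_injective (injective_prodMk x₀) hs) (reducedGroupCStar Λ) := by
  have h T (hT : T ∈ pulledCrossedProduct q) : frameProj
      (fun c => cosetOp Λ.subtype_injective (injective_prodMk x₀) (s c)) ∘L T =
      T ∘L frameProj (fun c => cosetOp Λ.subtype_injective (injective_prodMk x₀) (s c)) := by
    rw [frameProj_pulled _ hs]
    exact (comp_orbitOp hq hx₀ hx₀ hT).symm
  refine pulledCrossedProduct_le (isClosed_frameAlgebra _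
      (StarSubalgebra.isClosed_topologicalClosure _))
    (fun f => ⟨h _ (crossedFun_mem_pulledCrossedProduct q f), fun c d => ?_⟩)
    fun g => ⟨h _ (crossedGroup_mem_pulledCrossedProduct q g), fun c d => ?_⟩
  · rw [crossedFun_comp_cosetOp hq hx₀, ContinuousLinearMap.comp_smul]
    exact SMulMemClass.smul_mem _ (adjoint_cosetOp_comp_mem _ _ _ _)
  · rw [crossedGroup_comp_cosetOp]
    exact adjoint_cosetOp_comp_mem _ _ _ _

/-- The ⋆-homomorphism from the C⋆-algebra generated by `C(G ⧸ Λ)` and `G` to the matrices over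
`C⋆_r(Λ)` given by a transversal of `Λ`. -/
def pulledCompression : pulledCrossedProduct q →⋆ₐ[ℂ]
    Matrix (G ⧸ Λ) (G ⧸ Λ) (reducedGroupCStar Λ) :=
  compression _ (pulledCrossedProduct_le_frameAlgebra hq hx₀ hs)

theorem pulledCompression_apply (T : pulledCrossedProduct q) (c d : G ⧸ Λ) :
    (pulledCompression hq hx₀ hs T c d : EllTwo Λ →L[ℂ] EllTwo Λ) =
      adjoint (cosetOp Λ.subtype_injective (injective_prodMk x₀) (s c)) ∘L T.1 ∘L
        cosetOp Λ.subtype_injective (injective_prodMk x₀) (s d) := rfl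

theorem pulledCompression_injective : Function.Injective (pulledCompression hq hx₀ hs) := by
  rw [injective_iff_map_eq_zero]
  intro T hT
  have hF := isFrame_cosetOp Λ.subtype_injective (injective_prodMk x₀) hs
  have h1 d : T.1 ∘L cosetOp Λ.subtype_injective (injective_prodMk x₀) (s d) = 0 := by
    rw [← frameProj_comp hF d, ← ContinuousLinearMap.comp_assoc,
      ← (pulledCrossedProduct_le_frameAlgebra hq hx₀ hs T.2).1, frameProj,
      ContinuousLinearMap.comp_assoc, ContinuousLinearMap.finsetSum_comp]
    refine Finset.sum_eq_zero fun c _ => ?_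
    have h2 : (pulledCompression hq hx₀ hs T c d : EllTwo Λ →L[ℂ] EllTwo Λ) = 0 := by
      rw [hT]
      rfl
    rw [pulledCompression_apply] at h2
    rw [ContinuousLinearMap.comp_assoc, h2, ContinuousLinearMap.comp_zero]
  have h2 (g : G) : T.1 (basisVec (g, x₀)) = 0 := by
    obtain ⟨⟨c, h⟩, rfl⟩ := hs.2 g
    have h3 := congrArg (fun S => S (basisVec h)) (h1 c)
    rwa [ContinuousLinearMap.comp_apply, cosetOp_basisVec] at h3
  refine Subtype.ext (clm_ext fun ⟨g, x⟩ => ?_)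
  -- T vanishes on the slice over x₀; an `orbitOp` commuting with T carries the basis vector at (g
  -- t, x₀) to the one at (g, x).
  obtain ⟨t, ht⟩ := QuotientGroup.mk_surjective (q x)
  have h3 := congrArg (fun S => S (basisVec (g * t, x₀))) (comp_orbitOp hq ht.symm hx₀ T.2)
  have h4 := orbitOp_basisVec x x₀ t 1 (g * t)
  rw [inv_one, mul_one, mul_inv_cancel_right] at h4
  rw [ContinuousLinearMap.comp_apply, ContinuousLinearMap.comp_apply, h4, h2, map_zero] at h3
  exact h3

theorem exists_pulledCompression_eq_single [DiscreteTopology G] (c d : G ⧸ Λ) (h : Λ) :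
    ∃ T, pulledCompression hq hx₀ hs T = Matrix.single c d (groupUnitary h) := by
  let χ : C(G ⧸ Λ, ℂ) :=
    ⟨fun x => if x = QuotientGroup.mk (s d) then 1 else 0, continuous_of_discreteTopology⟩
  -- The indicator χ keeps only column d, and the group element sends the representative s d to s c
  -- h.
  refine ⟨⟨_, crossedGroup_mem_pulledCrossedProduct q (s c * h * (s d)⁻¹)⟩ *
    ⟨_, crossedFun_mem_pulledCrossedProduct q χ⟩, Matrix.ext fun a b => Subtype.ext ?_⟩
  have hΛ := Λ.subtype_injective
  have h1 : (pulledCompression hq hx₀ hs (⟨_, crossedGroup_mem_pulledCrossedProduct q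
      (s c * h * (s d)⁻¹)⟩ * ⟨_, crossedFun_mem_pulledCrossedProduct q χ⟩) a b :
        EllTwo Λ →L[ℂ] EllTwo Λ) = χ (QuotientGroup.mk (s b)) •
      (adjoint (cosetOp hΛ (injective_prodMk x₀) (s a)) ∘L
        cosetOp hΛ (injective_prodMk x₀) (s c * h * (s d)⁻¹ * s b)) := by
    rw [← crossedGroup_comp_cosetOp, ← ContinuousLinearMap.comp_smul,
      ← ContinuousLinearMap.comp_smul, ← crossedFun_comp_cosetOp hq hx₀]
    rfl
  rw [h1, Matrix.single_apply]
  by_cases hbd : b = d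
  · subst hbd
    have hχ : χ (QuotientGroup.mk (s b)) = 1 := if_pos rfl
    rw [hχ, one_smul, inv_mul_cancel_right]
    by_cases hac : c = a
    · subst hac
      rw [if_pos ⟨rfl, rfl⟩]
      exact adjoint_cosetOp_comp_of_eq _ _ rfl
    · rw [if_neg fun h' => hac h'.1]
      refine adjoint_cosetOp_comp_of_notMem _ _ fun h' => hac (hs.eq_of_mem ?_).symm
      have h2 := mul_mem h' (inv_mem (MonoidHom.mem_range.mpr ⟨h, rfl⟩))
      rwa [mul_assoc, Subgroup.subtype_apply, mul_inv_cancel_right] at h2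
  · have hχ : χ (QuotientGroup.mk (s b)) = 0 := if_neg fun h' => hbd (hs.bijective_mk.1 (by
      rw [QuotientGroup.eq] at h' ⊢
      rwa [Subgroup.range_subtype]))
    rw [hχ, zero_smul, if_neg fun h' => hbd h'.2.symm]
    rfl

theorem pulledCompression_bijective [DiscreteTopology G] :
    Function.Bijective (pulledCompression hq hx₀ hs) := by
  refine ⟨pulledCompression_injective hq hx₀ hs, surjective_of_single_mem_range
    (topologicalClosure_adjoin_groupUnitary Λ) ⟨1, ?_⟩ (pulledCompression_injective hq hx₀ hs) ?_⟩
  · refine Subtype.ext (clm_ext fun i => ?_)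
    exact (permOp_basisVec _ i).trans (congrArg basisVec (one_mul i))
  · rintro c d _ ⟨h, rfl⟩
    exact exists_pulledCompression_eq_single hq hx₀ hs c d h

end PulledCompression

theorem inflateHom_comp_apply {A B C k l : Type*} [Ring A] [StarRing A] [Algebra ℂ A] [Ring B]
    [StarRing B] [Algebra ℂ B] [Ring C] [StarRing C] [Algebra ℂ C] [Fintype k] [DecidableEq k]
    [Fintype l] [DecidableEq l] (ψ : B →⋆ₐ[ℂ] Matrix l l C) (φ : A →⋆ₐ[ℂ] Matrix k k B) (a : A)
    (x y : k × l) : ((inflateHom k ψ).comp φ) a x y = ψ (φ a x.1 y.1) x.2 y.2 := rfl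

theorem StarSubalgebra.val_inclusion {R A : Type*} [CommSemiring R] [StarRing R] [Semiring A]
    [StarRing A] [Algebra R A] [StarModule R A] {S T : StarSubalgebra R A} (h : S ≤ T) (x : S) :
    (StarSubalgebra.inclusion h x).1 = x.1 := rfl

/-! ### Matrices as a tensor product. -/

section MatrixTensor

variable (n : Type*) [Fintype n] [DecidableEq n] (A : Type*) [Ring A] [StarRing A] [Algebra ℂ A]
  [StarModule ℂ A]

/-- The ⋆-isomorphism `M_n(ℂ) ⊗ A ≃ M_n(A)`. -/
def tensorMatrixStarEquiv : Matrix n n ℂ ⊗[ℂ] A ≃⋆ₐ[ℂ] Matrix n n A :=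
  StarAlgEquiv.ofAlgEquiv
    ((Algebra.TensorProduct.comm ℂ (Matrix n n ℂ) A).trans (matrixEquivTensor n ℂ A).symm)
    fun x => by
      induction x using TensorProduct.induction_on with
      | zero => simp
      | add x y hx hy => rw [star_add, map_add, map_add, star_add, hx, hy]
      | tmul M a =>
        ext i j
        have h : star (algebraMap ℂ A (M j i)) = algebraMap ℂ A (star (M j i)) :=
          (algebraMap_star_comm _).symm
        simp [TensorProduct.star_tmul, Matrix.star_apply, h, (Algebra.commutes _ _).symm]

end MatrixTensor

/-! ### The transfer homomorphism as a compression on ℓ²(G). -/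

section Transfer

open EllTwo

variable {G : Type*} [Group G] {M : Type*} [Group M] {φ : M →* G} (hφ : Function.Injective φ)
  {k : Type*} [Fintype k] [DecidableEq k] {s : k → G} (hs : IsTransversal φ s)

include hs in
omit [DecidableEq k] in
theorem frameProj_cosetOp_id :
    frameProj (fun c => cosetOp hφ Function.injective_id (s c)) = 1 := by
  rw [frameProj_cosetOp _ _ hs]
  refine clm_ext fun g => ?_
  have h : comapOp id Function.injective_id (basisVec g) = basisVec g := rfl
  rw [ContinuousLinearMap.comp_apply, h, embOp_basisVec]
  rfl

theorem leftRegular_comp_cosetOp (g a : G) :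
    leftRegular G g ∘L cosetOp hφ Function.injective_id a =
      cosetOp hφ Function.injective_id (g * a) :=
  clm_ext fun i => by
    rw [ContinuousLinearMap.comp_apply, cosetOp_basisVec, cosetOp_basisVec, leftRegular,
      permOp_basisVec, id, id, mul_assoc]
    rfl

theorem reducedGroupCStar_le_frameAlgebra : reducedGroupCStar G ≤
    frameAlgebra (isFrame_cosetOp hφ Function.injective_id hs) (reducedGroupCStar M) := by
  refine StarSubalgebra.topologicalClosure_minimal (StarAlgebra.adjoin_le ?_)
    (isClosed_frameAlgebra _ (StarSubalgebra.isClosed_topologicalClosure _))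
  rintro _ ⟨g, rfl⟩
  refine ⟨by rw [frameProj_cosetOp_id hφ hs]; rfl, fun c d => ?_⟩
  rw [leftRegular_comp_cosetOp]
  exact adjoint_cosetOp_comp_mem _ _ _ _

/-- The transfer homomorphism given by a transversal. -/
def transferHom : reducedGroupCStar G →⋆ₐ[ℂ] Matrix k k (reducedGroupCStar M) :=
  compression _ (reducedGroupCStar_le_frameAlgebra hφ hs)

theorem transferHom_apply (T : reducedGroupCStar G) (c d : k) :
    (transferHom hφ hs T c d : EllTwo M →L[ℂ] EllTwo M) =
      adjoint (cosetOp hφ Function.injective_id (s c)) ∘L T.1 ∘L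
        cosetOp hφ Function.injective_id (s d) := rfl

theorem transferHom_groupUnitary_of_eq {g : G} {c d : k} {m : M} (h : (s c)⁻¹ * g * s d = φ m) :
    transferHom hφ hs (groupUnitary g) c d = groupUnitary m := by
  refine Subtype.ext ?_
  rw [transferHom_apply]
  change _ ∘L leftRegular G g ∘L _ = _
  rw [leftRegular_comp_cosetOp]
  refine adjoint_cosetOp_comp_of_eq _ _ ?_
  rw [← h, ← mul_assoc, ← mul_assoc, mul_inv_cancel, one_mul]

theorem transferHom_groupUnitary_of_notMem {g : G} {c d : k}
    (h : (s c)⁻¹ * g * s d ∉ φ.range) : transferHom hφ hs (groupUnitary g) c d = 0 := by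
  refine Subtype.ext ?_
  rw [transferHom_apply]
  change _ ∘L leftRegular G g ∘L _ = _
  rw [leftRegular_comp_cosetOp]
  refine adjoint_cosetOp_comp_of_notMem _ _ ?_
  rwa [← mul_assoc]

end Transfer

/-! ### Inclusions of subalgebras correspond to transfers up to conjugation. -/

section Compatibility

open EllTwo

variable {G : Type u} [Group G] [TopologicalSpace G] {X : Type v}
  [TopologicalSpace X] [CompactSpace X] [MulAction G X]
  {Λ Λ' : Subgroup G} {q : C(X, G ⧸ Λ)} (hq : ∀ (g : G) (x : X), q (g • x) = g • q x)
  {q' : C(X, G ⧸ Λ')} (hq' : ∀ (g : G) (x : X), q' (g • x) = g • q' x) {x₀ : X}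
  (hx₀ : q x₀ = QuotientGroup.mk 1) (hx₀' : q' x₀ = QuotientGroup.mk 1)
  {s : G ⧸ Λ → G} (hs : IsTransversal Λ.subtype s) [Fintype (G ⧸ Λ)] [DecidableEq (G ⧸ Λ)]
  {s' : G ⧸ Λ' → G} (hs' : IsTransversal Λ'.subtype s') [Fintype (G ⧸ Λ')]
  [DecidableEq (G ⧸ Λ')] (hΛ : Λ' ≤ Λ) {l : Type*} [Fintype l] [DecidableEq l] {r : l → Λ}
  (hr : IsTransversal (Subgroup.inclusion hΛ) r)
  (hle : pulledCrossedProduct q ≤ pulledCrossedProduct q')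

omit [TopologicalSpace G] [TopologicalSpace X] [CompactSpace X] [MulAction G X] [Fintype (G ⧸ Λ)]
  [DecidableEq (G ⧸ Λ)] [Fintype (G ⧸ Λ')] [DecidableEq (G ⧸ Λ')] in
theorem cosetOp_subtype_comp_cosetOp_inclusion (x : X) (a : G) (b : Λ) :
    cosetOp Λ.subtype_injective (injective_prodMk x) a ∘L
      cosetOp (Subgroup.inclusion_injective hΛ) Function.injective_id b =
      cosetOp Λ'.subtype_injective (injective_prodMk x) (a * b) :=
  clm_ext fun i => by
    rw [ContinuousLinearMap.comp_apply, cosetOp_basisVec, cosetOp_basisVec, cosetOp_basisVec,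
      id, map_mul, mul_assoc]
    rfl

omit [Fintype (G ⧸ Λ')] [DecidableEq (G ⧸ Λ')] in
theorem coe_inflateHom_transferHom_pulledCompression (T : pulledCrossedProduct q)
    (c d : (G ⧸ Λ) × l) :
    (((inflateHom (G ⧸ Λ) (transferHom (Subgroup.inclusion_injective hΛ) hr)).comp
      (pulledCompression hq hx₀ hs)) T c d : EllTwo Λ' →L[ℂ] EllTwo Λ') =
    adjoint (cosetOp Λ'.subtype_injective (injective_prodMk x₀) (s c.1 * r c.2)) ∘L T.1 ∘L
      cosetOp Λ'.subtype_injective (injective_prodMk x₀) (s d.1 * r d.2) := by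
  rw [inflateHom_comp_apply, transferHom_apply, pulledCompression_apply,
    ← cosetOp_subtype_comp_cosetOp_inclusion hΛ, ← cosetOp_subtype_comp_cosetOp_inclusion hΛ,
    ContinuousLinearMap.adjoint_comp]
  simp only [ContinuousLinearMap.comp_assoc]

omit [Fintype (G ⧸ Λ)] [DecidableEq (G ⧸ Λ)] in
theorem coe_inflateHom_pulledCompression_inclusion (T : pulledCrossedProduct q)
    (c d : Unit × (G ⧸ Λ')) :
    (((inflateHom Unit (pulledCompression hq' hx₀' hs')).comp
      (unitHom (StarSubalgebra.inclusion hle))) T c d : EllTwo Λ' →L[ℂ] EllTwo Λ') =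
    adjoint (cosetOp Λ'.subtype_injective (injective_prodMk x₀) (s' c.2)) ∘L T.1 ∘L
      cosetOp Λ'.subtype_injective (injective_prodMk x₀) (s' d.2) := by
  rw [inflateHom_comp_apply, unitHom_apply, pulledCompression_apply,
    StarSubalgebra.val_inclusion]

include hq hq' hx₀' hs' in
-- Both composites compress T to the same slice over x₀, one along the transversal s r of Λ', the
-- other along s'. The two frames have the same projection, so `exists_frame_change` supplies W.
theorem exists_transferHom_pulledCompression_conj :
    ∃ W : Matrix ((G ⧸ Λ) × l) (Unit × (G ⧸ Λ')) (reducedGroupCStar Λ'),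
      W * Wᴴ = 1 ∧ Wᴴ * W = 1 ∧ ∀ T, ((inflateHom (G ⧸ Λ)
        (transferHom (Subgroup.inclusion_injective hΛ) hr)).comp
          (pulledCompression hq hx₀ hs)) T * W =
        W * ((inflateHom Unit (pulledCompression hq' hx₀' hs')).comp
          (unitHom (StarSubalgebra.inclusion hle))) T := by
  have hsr : IsTransversal Λ'.subtype fun x : (G ⧸ Λ) × l => s x.1 * r x.2 := hs.comp hr
  have hs'' : IsTransversal Λ'.subtype fun x : Unit × (G ⧸ Λ') => s' x.2 :=
    Function.Bijective.comp hs' ((Equiv.punitProd (G ⧸ Λ')).prodCongr (Equiv.refl Λ')).bijective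
  have hi := Λ'.subtype_injective
  obtain ⟨W, h₁, h₂, h⟩ := exists_frame_change (B := reducedGroupCStar Λ')
    (isFrame_cosetOp hi (injective_prodMk x₀) hsr) (isFrame_cosetOp hi (injective_prodMk x₀) hs'')
    ((frameProj_pulled hi hsr x₀).trans (frameProj_pulled hi hs'' x₀).symm)
    fun c d => adjoint_cosetOp_comp_mem _ _ _ _
  refine ⟨W, h₁, h₂, fun T => h T.1 ?_ _ _
    (coe_inflateHom_transferHom_pulledCompression hq hx₀ hs hΛ hr T)
    (coe_inflateHom_pulledCompression_inclusion hq' hx₀' hs' hle T)⟩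
  rw [frameProj_pulled hi hsr]
  exact (comp_orbitOp hq hx₀ hx₀ T.2).symm

end Compatibility

/-! ### K-theory of an inductive limit of matrix algebras. -/

section InductiveLimit

variable {A : Type u} [CStarAlgebra A] {S : ℕ → Type u} [∀ m, CStarAlgebra (S m)]
  {j : ∀ m, S m →⋆ₐ[ℂ] A} (hj : ∀ m, Function.Injective (j m)) (h : Approximates j)
  (t : ∀ i m, i ≤ m → S i →⋆ₐ[ℂ] S m) (ht : ∀ i m hm x, j m (t i m hm x) = j i x)
  {B : ℕ → Type u} [∀ i, CStarAlgebra (B i)] {k l : ℕ → Type*} [∀ i, Fintype (k i)]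
  [∀ i, DecidableEq (k i)] [∀ i, Nonempty (k i)] [∀ i, Fintype (l i)] [∀ i, DecidableEq (l i)]
  {ρ : ∀ i, S i →⋆ₐ[ℂ] Matrix (k i) (k i) (B i)} (hρ : ∀ i, Function.Bijective (ρ i))
  {τ : ∀ i, B i →⋆ₐ[ℂ] Matrix (l i) (l i) (B (i + 1))}
  (hW : ∀ i, ∃ W : Matrix (k i × l i) (Unit × k (i + 1)) (B (i + 1)), W * Wᴴ = 1 ∧ Wᴴ * W = 1 ∧
    ∀ a, ((inflateHom (k i) (τ i)).comp (ρ i)) a * W =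
      W * ((inflateHom Unit (ρ (i + 1))).comp (unitHom (t i (i + 1) i.le_succ))) a)

include hj ht in
theorem bijective_transition_self (i : ℕ) : Function.Bijective (unitHom (t i i le_rfl)) := by
  have h1 x : t i i le_rfl x = x := hj i (ht i i le_rfl x)
  constructor
  · intro x y hxy
    have h2 := congrFun (congrFun hxy ()) ()
    rwa [unitHom_apply, unitHom_apply, h1, h1] at h2
  · intro M
    exact ⟨M () (), Matrix.ext fun _ _ => h1 _⟩

include hj h ht hρ hW

theorem KZero.nonempty_iso_colimit : Nonempty (AddCommGrpCat.of (KZero A) ≅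
    colimit (Functor.ofSequence fun i => AddCommGrpCat.ofHom (KZero.map (τ i)))) := by
  refine nonempty_iso_colimit_ofSequence (fun i => KZero.map (τ i))
    (fun i m him => KZero.map (unitHom (t i m him))) (fun i => KZero.map (ρ i))
    (fun i => KZero.map (unitHom (j i))) (fun i => KZero.map_bijective (hρ i)) (fun i x => ?_)
    (fun i m l him hml x => KZero.map_unitHom_comp (transition_comp hj t ht him hml) x)
    (fun i x => ?_) (fun i x => KZero.map_unitHom_comp (ht _ _ _) x)
    (KZero.exists_map_unitHom hj h t ht) fun i x hx => KZero.exists_map_eq_zero hj h t ht hx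
  -- The map induced by the transition from i to itself is idempotent and injective, hence the
  -- identity.
  · exact (KZero.map_bijective (bijective_transition_self hj t ht i)).1
      (KZero.map_unitHom_comp (transition_comp hj t ht le_rfl le_rfl) x)
  · obtain ⟨W, h₁, h₂, hW⟩ := hW i
    rw [KZero.map_map, KZero.map_map, KZero.map_eq_map_of_conj hW h₁ h₂]

theorem KOne.nonempty_iso_colimit
    (hkl : ∀ i, Fintype.card (k i × l i) = Fintype.card (Unit × k (i + 1))) :
    Nonempty (AddCommGrpCat.of (KOne A) ≅
      colimit (Functor.ofSequence fun i => AddCommGrpCat.ofHom (KOne.map (τ i)))) := by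
  refine nonempty_iso_colimit_ofSequence (fun i => KOne.map (τ i))
    (fun i m him => KOne.map (unitHom (t i m him))) (fun i => KOne.map (ρ i))
    (fun i => KOne.map (unitHom (j i))) (fun i => KOne.map_bijective (hρ i)) (fun i x => ?_)
    (fun i m l him hml x => KOne.map_unitHom_comp (transition_comp hj t ht him hml) x)
    (fun i x => ?_) (fun i x => KOne.map_unitHom_comp (ht _ _ _) x)
    (KOne.exists_map_unitHom hj h) fun i x hx => KOne.exists_map_eq_zero hj h t ht hx
  · exact (KOne.map_bijective (bijective_transition_self hj t ht i)).1
      (KOne.map_unitHom_comp (transition_comp hj t ht le_rfl le_rfl) x)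
  · obtain ⟨W, h₁, h₂, hW⟩ := hW i
    rw [KOne.map_map, KOne.map_map, KOne.map_eq_map_of_conj (hkl i) hW h₁ h₂]

end InductiveLimit

/-! ### Approximation from a dense increasing union. -/

section DenseUnion

variable {E : Type*} [CStarAlgebra E] {S : ℕ → StarSubalgebra ℂ E} {T : StarSubalgebra ℂ E}
  [∀ m, IsClosed (S m : Set E)] [IsClosed (T : Set E)]

theorem approximates_inclusion (hS : Monotone S) (hle : ∀ m, S m ≤ T)
    (hT : T ≤ (⨆ m, S m).topologicalClosure) :
    Approximates fun m => StarSubalgebra.inclusion (hle m) := by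
  intro c
  have hne m : (S m : Set E).Nonempty := ⟨0, zero_mem _⟩
  -- The distance to `S m` need not be attained; the slack 1/(m+1) tends to 0 and gives a choice for
  -- every m.
  have h1 m : ∃ s ∈ (S m : Set E), dist (c : E) s < Metric.infDist (c : E) (S m) + 1 / (m + 1) :=
    (Metric.infDist_lt_iff (hne m)).mp (lt_add_of_pos_right _ Nat.one_div_pos_of_nat)
  choose s hs hcs using h1
  refine ⟨fun m => ⟨s m, hs m⟩, tendsto_subtype_rng.mpr ?_⟩
  change Tendsto s atTop (𝓝 (c : E))
  refine Metric.tendsto_atTop.mpr fun ε hε => ?_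
  have hc : (c : E) ∈ closure (⋃ m, (S m : Set E)) := by
    rw [← StarSubalgebra.coe_iSup_of_directed hS.directed_le]
    exact hT c.2
  obtain ⟨a, ha, hca⟩ := Metric.mem_closure_iff.mp hc (ε / 2) (half_pos hε)
  obtain ⟨m₀, ha⟩ := Set.mem_iUnion.mp ha
  obtain ⟨m₁, hm₁⟩ := exists_nat_one_div_lt (half_pos hε)
  refine ⟨max m₀ m₁, fun m hm => ?_⟩
  have h2 : Metric.infDist (c : E) (S m) ≤ dist (c : E) a :=
    Metric.infDist_le_dist_of_mem (hS ((le_max_left _ _).trans hm) ha)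
  have h3 : (1 : ℝ) / (m + 1) ≤ 1 / (m₁ + 1) :=
    Nat.one_div_le_one_div ((le_max_right _ _).trans hm)
  rw [dist_comm]
  linarith [hcs m]

end DenseUnion

/-! ### Density of the stages in the crossed product. -/

section CrossedProduct

variable {G : Type u} [Group G] [TopologicalSpace G] {X : Type v}
  [TopologicalSpace X] [CompactSpace X] [MulAction G X]

variable (G X) in
/-- The representation of `C(X)` on `ℓ²(G × X)` as a ⋆-homomorphism. -/
def crossedFunHom : C(X, ℂ) →⋆ₐ[ℂ] (EllTwo (G × X) →L[ℂ] EllTwo (G × X)) where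
  toFun := crossedFun G X
  map_one' := ContinuousLinearMap.ext fun ξ => lp.ext (funext fun _ => one_mul _)
  map_mul' _ _ := ContinuousLinearMap.ext fun ξ => lp.ext (funext fun _ => mul_assoc _ _ _)
  map_zero' := ContinuousLinearMap.ext fun ξ => lp.ext (funext fun _ => zero_mul _)
  map_add' _ _ := ContinuousLinearMap.ext fun ξ => lp.ext (funext fun _ => add_mul _ _ _)
  commutes' _ := ContinuousLinearMap.ext fun ξ => lp.ext (funext fun _ => rfl)
  map_star' _ := ContinuousLinearMap.ext fun ξ => lp.ext (funext fun _ => by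
    rw [ContinuousLinearMap.star_eq_adjoint, crossedFun, crossedFun, EllTwo.adjoint_mulOp]
    rfl)

variable {Λ Λ' : Subgroup G} {q : C(X, G ⧸ Λ)} {q' : C(X, G ⧸ Λ')}

theorem pulledCrossedProduct_mono [DiscreteTopology G] (p : G ⧸ Λ' → G ⧸ Λ)
    (h : ∀ x, p (q' x) = q x) : pulledCrossedProduct q ≤ pulledCrossedProduct q' := by
  refine pulledCrossedProduct_le (StarSubalgebra.isClosed_topologicalClosure _) (fun f => ?_)
    (crossedGroup_mem_pulledCrossedProduct q')
  have h1 : f.comp q = (f.comp ⟨p, continuous_of_discreteTopology⟩).comp q' :=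
    ContinuousMap.ext fun x => congrArg f (h x).symm
  rw [h1]
  exact crossedFun_mem_pulledCrossedProduct q' _

theorem pulledCrossedProduct_le_reducedCrossedProduct :
    pulledCrossedProduct q ≤ reducedCrossedProduct G X :=
  pulledCrossedProduct_le (StarSubalgebra.isClosed_topologicalClosure _)
    (fun _ => StarSubalgebra.le_topologicalClosure _ (StarAlgebra.subset_adjoin ℂ _ (.inl ⟨_, rfl⟩)))
    fun g => StarSubalgebra.le_topologicalClosure _ (StarAlgebra.subset_adjoin ℂ _ (.inr ⟨g, rfl⟩))

theorem pulledCrossedProduct_id [CompactSpace (G ⧸ Λ)] :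
    pulledCrossedProduct (ContinuousMap.id (G ⧸ Λ)) = reducedCrossedProduct G (G ⧸ Λ) := rfl

/-- The functions whose multiplication operators lie in the closure of the union form a closed
⋆-subalgebra of C(X). It contains the indicators of the fibres of every q i, so it separates points
and is everything by Stone–Weierstrass. -/
theorem reducedCrossedProduct_le_of_separates [DiscreteTopology G] {Λs : ℕ → Subgroup G}
    {q : ∀ i, C(X, G ⧸ Λs i)} (hq : ∀ x y, (∀ i, q i x = q i y) → x = y) :
    reducedCrossedProduct G X ≤ (⨆ i, pulledCrossedProduct (q i)).topologicalClosure := by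
  have hle i : pulledCrossedProduct (q i) ≤ (⨆ i, pulledCrossedProduct (q i)).topologicalClosure :=
    (le_iSup (fun i => pulledCrossedProduct (q i)) i).trans
      (StarSubalgebra.le_topologicalClosure _)
  have hcl := StarSubalgebra.isClosed_topologicalClosure (⨆ i, pulledCrossedProduct (q i))
  let P : StarSubalgebra ℂ C(X, ℂ) :=
    (⨆ i, pulledCrossedProduct (q i)).topologicalClosure.comap (crossedFunHom G X)
  have hP : IsClosed (P : Set C(X, ℂ)) := hcl.preimage (continuous_starAlgHom (crossedFunHom G X))
  have hsep : P.SeparatesPoints := by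
    intro x y hxy
    obtain ⟨i, hi⟩ : ∃ i, q i x ≠ q i y := by
      by_contra! h'
      exact hxy (hq x y h')
    classical
    let χ : C(G ⧸ Λs i, ℂ) :=
      ⟨fun z => if z = q i x then 1 else 0, continuous_of_discreteTopology⟩
    refine ⟨χ.comp (q i), ⟨χ.comp (q i), hle i (crossedFun_mem_pulledCrossedProduct (q i) χ), rfl⟩, ?_⟩
    simp [χ, hi.symm]
  have htop : P = ⊤ := by
    rw [← ContinuousMap.starSubalgebra_topologicalClosure_eq_top_of_separatesPoints P hsep]
    exact le_antisymm (StarSubalgebra.le_topologicalClosure _)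
      (StarSubalgebra.topologicalClosure_minimal le_rfl hP)
  refine StarSubalgebra.topologicalClosure_minimal (StarAlgebra.adjoin_le ?_) hcl
  rintro _ (⟨f, rfl⟩ | ⟨g, rfl⟩)
  · have hf : f ∈ P := htop ▸ StarSubalgebra.mem_top
    exact hf
  · exact hle 0 (crossedGroup_mem_pulledCrossedProduct _ g)

end CrossedProduct

/-! ### Coset spaces and the coordinates of the odometer. -/

section Coordinates

variable {G : Type u} [Group G]

theorem isTransversal_out (Λ : Subgroup G) :
    IsTransversal Λ.subtype (Quotient.out : G ⧸ Λ → G) :=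
  isTransversal_of_mk_eq Λ.subtype_injective Λ.range_subtype fun c => Quotient.out_eq' c

theorem nonempty_starAlgEquiv_crossedProduct_cosets [TopologicalSpace G] [DiscreteTopology G]
    (Λ : Subgroup G) [Λ.FiniteIndex] :
    Nonempty (reducedCrossedProduct G (G ⧸ Λ) ≃⋆ₐ[ℂ]
      Matrix (G ⧸ Λ) (G ⧸ Λ) ℂ ⊗[ℂ] reducedGroupCStar Λ) := by
  rw [← pulledCrossedProduct_id]
  exact ⟨(StarAlgEquiv.ofBijective _ (pulledCompression_bijective
    (q := ContinuousMap.id (G ⧸ Λ)) (x₀ := QuotientGroup.mk 1) (fun _ _ => rfl) rfl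
    (isTransversal_out Λ))).trans (tensorMatrixStarEquiv _ _).symm⟩

variable (Gs : ℕ → Subgroup G) (hs : ∀ i, Gs (i + 1) ≤ Gs i)

/-- The point of the odometer all of whose coordinates are trivial cosets. -/
def odometerBase : odometer Gs hs := ⟨fun _ => QuotientGroup.mk 1, fun _ => rfl⟩

variable [TopologicalSpace G]

/-- The coordinate maps of the odometer. -/
def odometerCoord (i : ℕ) : C(odometer Gs hs, G ⧸ Gs i) :=
  ⟨fun x => x.1 i, (continuous_apply i).comp continuous_subtype_val⟩

theorem odometerCoord_smul (i : ℕ) (g : G) (x : odometer Gs hs) :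
    odometerCoord Gs hs i (g • x) = g • odometerCoord Gs hs i x := rfl

variable [DiscreteTopology G] [∀ i, (Gs i).FiniteIndex]

theorem monotone_pulledCrossedProduct_odometerCoord :
    Monotone fun i => pulledCrossedProduct (odometerCoord Gs hs i) :=
  monotone_nat_of_le_succ fun i =>
    pulledCrossedProduct_mono (Subgroup.quotientMapOfLE (hs i)) fun x => x.2 i

theorem reducedCrossedProduct_odometer_le : reducedCrossedProduct G (odometer Gs hs) ≤
    (⨆ i, pulledCrossedProduct (odometerCoord Gs hs i)).topologicalClosure :=
  reducedCrossedProduct_le_of_separates fun _ _ h => Subtype.ext (funext h)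

end Coordinates

/-! ### Application to odometers. -/

section Odometers

variable {Γ : Type u} [Group Γ] {Γs : ℕ → Subgroup Γ}
  (hs : ∀ i, Γs (i + 1) ≤ Γs i) {r : ∀ i, Γs i ⧸ (Γs (i + 1)).subgroupOf (Γs i) → Γs i}
  (hr : ∀ i, IsTransversal (Subgroup.inclusion (hs i)) (r i))

section

variable [∀ i, (Γs i).FiniteIndex]

/-- The transfer homomorphisms of a decreasing sequence of finite index subgroups. -/
def odometerTransfer (i : ℕ) : reducedGroupCStar (Γs i) →⋆ₐ[ℂ]
    Matrix (Γs i ⧸ (Γs (i + 1)).subgroupOf (Γs i)) (Γs i ⧸ (Γs (i + 1)).subgroupOf (Γs i))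
      (reducedGroupCStar (Γs (i + 1))) :=
  transferHom (Subgroup.inclusion_injective (hs i)) (hr i)

theorem odometerTransfer_groupUnitary (i : ℕ) (g : Γs i) :
    odometerTransfer hs hr i (groupUnitary g) = cosetMatrix (Γs i) (Γs (i + 1)) (r i) g := by
  refine Matrix.ext fun c d => ?_
  rw [cosetMatrix, Matrix.of_apply, odometerTransfer]
  split_ifs with h
  · exact transferHom_groupUnitary_of_eq _ _ rfl
  · refine transferHom_groupUnitary_of_notMem _ _ fun h' => h ?_
    rwa [Subgroup.inclusion_range, Subgroup.mem_subgroupOf] at h'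

end

variable [TopologicalSpace Γ] [DiscreteTopology Γ] [∀ i, (Γs i).FiniteIndex]

variable (Γs) in
/-- The C⋆-subalgebras whose union is dense in the crossed product of the odometer. -/
abbrev odometerStage (i : ℕ) :
    StarSubalgebra ℂ (EllTwo (Γ × odometer Γs hs) →L[ℂ] EllTwo (Γ × odometer Γs hs)) :=
  pulledCrossedProduct (odometerCoord Γs hs i)

/-- The inclusion of a stage into the crossed product of the odometer. -/
def odometerStageInclusion (i : ℕ) :
    odometerStage Γs hs i →⋆ₐ[ℂ] reducedCrossedProduct Γ (odometer Γs hs) :=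
  StarSubalgebra.inclusion pulledCrossedProduct_le_reducedCrossedProduct

/-- The inclusion of a stage into a later one. -/
def odometerStageTransition (i m : ℕ) (h : i ≤ m) :
    odometerStage Γs hs i →⋆ₐ[ℂ] odometerStage Γs hs m :=
  StarSubalgebra.inclusion (monotone_pulledCrossedProduct_odometerCoord Γs hs h)

/-- The isomorphism of a stage with the matrices over a reduced group C⋆-algebra. -/
def odometerStageHom (i : ℕ) : odometerStage Γs hs i →⋆ₐ[ℂ]
    Matrix (Γ ⧸ Γs i) (Γ ⧸ Γs i) (reducedGroupCStar (Γs i)) :=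
  pulledCompression (odometerCoord_smul Γs hs i) (x₀ := odometerBase Γs hs) rfl
    (isTransversal_out (Γs i))

theorem odometerStageHom_bijective (i : ℕ) : Function.Bijective (odometerStageHom hs i) :=
  pulledCompression_bijective _ _ _

theorem odometerStageInclusion_injective (i : ℕ) :
    Function.Injective (odometerStageInclusion hs i) :=
  StarSubalgebra.inclusion_injective _

theorem approximates_odometerStageInclusion : Approximates (odometerStageInclusion hs) :=
  approximates_inclusion (monotone_pulledCrossedProduct_odometerCoord Γs hs)
    (fun _ => pulledCrossedProduct_le_reducedCrossedProduct)
    (reducedCrossedProduct_odometer_le Γs hs)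

theorem odometerStageInclusion_transition (i m : ℕ) (h : i ≤ m) (x : odometerStage Γs hs i) :
    odometerStageInclusion hs m (odometerStageTransition hs i m h x) =
      odometerStageInclusion hs i x :=
  Subtype.ext <| by
    rw [odometerStageInclusion, StarSubalgebra.val_inclusion, odometerStageTransition,
      StarSubalgebra.val_inclusion, odometerStageInclusion, StarSubalgebra.val_inclusion]

theorem exists_odometerTransfer_conj (i : ℕ) :
    ∃ W : Matrix ((Γ ⧸ Γs i) × (Γs i ⧸ (Γs (i + 1)).subgroupOf (Γs i))) (Unit × (Γ ⧸ Γs (i + 1)))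
        (reducedGroupCStar (Γs (i + 1))),
      W * Wᴴ = 1 ∧ Wᴴ * W = 1 ∧ ∀ T,
        ((inflateHom (Γ ⧸ Γs i) (odometerTransfer hs hr i)).comp (odometerStageHom hs i)) T * W =
        W * ((inflateHom Unit (odometerStageHom hs (i + 1))).comp
          (unitHom (odometerStageTransition hs i (i + 1) i.le_succ))) T :=
  exists_transferHom_pulledCompression_conj (odometerCoord_smul Γs hs i)
    (odometerCoord_smul Γs hs (i + 1)) (x₀ := odometerBase Γs hs) rfl rfl
    (isTransversal_out (Γs i)) (isTransversal_out (Γs (i + 1))) (hs i) (hr i)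
    (monotone_pulledCrossedProduct_odometerCoord Γs hs i.le_succ)

theorem KZero.nonempty_iso_colimit_odometer : Nonempty (AddCommGrpCat.of
      (KZero (reducedCrossedProduct Γ (odometer Γs hs))) ≅
    colimit (Functor.ofSequence fun i =>
      AddCommGrpCat.ofHom (KZero.map (odometerTransfer hs hr i)))) :=
  KZero.nonempty_iso_colimit (odometerStageInclusion_injective hs)
    (approximates_odometerStageInclusion hs) (odometerStageTransition hs)
    (odometerStageInclusion_transition hs) (odometerStageHom_bijective hs)
    (exists_odometerTransfer_conj hs hr)

theorem KOne.nonempty_iso_colimit_odometer : Nonempty (AddCommGrpCat.of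
      (KOne (reducedCrossedProduct Γ (odometer Γs hs))) ≅
    colimit (Functor.ofSequence fun i =>
      AddCommGrpCat.ofHom (KOne.map (odometerTransfer hs hr i)))) :=
  KOne.nonempty_iso_colimit (odometerStageInclusion_injective hs)
    (approximates_odometerStageInclusion hs) (odometerStageTransition hs)
    (odometerStageInclusion_transition hs) (odometerStageHom_bijective hs)
    (exists_odometerTransfer_conj hs hr) fun i => by
      -- Both index sets parametrise transversals of `Γs (i + 1)` in Γ, so they have the same size.
      rw [Fintype.card_prod Unit, Fintype.card_unit, one_mul]
      exact IsTransversal.card_eq ((isTransversal_out (Γs i)).comp (hr i))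
        (isTransversal_out (Γs (i + 1)))

end Odometers

end

theorem mainTheorem10 {Γ : Type u} [Group Γ] [TopologicalSpace Γ] [DiscreteTopology Γ] :
    (∀ (Λ : Subgroup Γ) [Λ.FiniteIndex],
      Nonempty (reducedCrossedProduct Γ (Γ ⧸ Λ) ≃⋆ₐ[ℂ]
        Matrix (Γ ⧸ Λ) (Γ ⧸ Λ) ℂ ⊗[ℂ] reducedGroupCStar Λ)) ∧
    ∀ (Γs : ℕ → Subgroup Γ) [∀ i, (Γs i).FiniteIndex] (hs : ∀ i, Γs (i + 1) < Γs i)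
      (r : ∀ i, Γs i ⧸ (Γs (i + 1)).subgroupOf (Γs i) → Γs i)
      (_hr : ∀ i c, (QuotientGroup.mk (r i c) : Γs i ⧸ (Γs (i + 1)).subgroupOf (Γs i)) = c),
      ∃ τ : ∀ i, reducedGroupCStar (Γs i) →⋆ₐ[ℂ]
          Matrix (Γs i ⧸ (Γs (i + 1)).subgroupOf (Γs i)) (Γs i ⧸ (Γs (i + 1)).subgroupOf (Γs i))
            (reducedGroupCStar (Γs (i + 1))),
        (∀ i g, τ i (groupUnitary g) = cosetMatrix (Γs i) (Γs (i + 1)) (r i) g) ∧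
        Nonempty (AddCommGrpCat.of
            (KZero (reducedCrossedProduct Γ (odometer Γs fun i => (hs i).le))) ≅
          colimit (Functor.ofSequence fun i => AddCommGrpCat.ofHom (KZero.map (τ i)))) ∧
        Nonempty (AddCommGrpCat.of
            (KOne (reducedCrossedProduct Γ (odometer Γs fun i => (hs i).le))) ≅
          colimit (Functor.ofSequence fun i => AddCommGrpCat.ofHom (KOne.map (τ i)))) := by
  refine ⟨fun Λ _ => nonempty_starAlgEquiv_crossedProduct_cosets Λ, fun Γs _ hs r hr => ?_⟩
  have hr' i : IsTransversal (Subgroup.inclusion (hs i).le) (r i) :=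
    isTransversal_of_mk_eq (Subgroup.inclusion_injective (hs i).le)
      (Subgroup.inclusion_range (hs i).le) (hr i)
  exact ⟨odometerTransfer (fun i => (hs i).le) hr',
    odometerTransfer_groupUnitary (fun i => (hs i).le) hr',
    KZero.nonempty_iso_colimit_odometer (fun i => (hs i).le) hr',
    KOne.nonempty_iso_colimit_odometer (fun i => (hs i).le) hr'⟩
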